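/- **Setting.** Let $X_t=\Psi(X_{t-1},\varepsilon_t)$, $t\ge 1$, where $\Psi:\mathbb R\times\mathbb S\to\mathbb R$ is measurable, $\varepsilon_1,\varepsilon_2,\dots$ are i.i.d. random elements of a measurable space $\mathbb S$, independent of $X_0$, and $\Psi(X_0,\varepsilon_1)$ has the same law as $X_0$. Let $0<\alpha<\infty$, $0\le p\le 1$, $p(1)=p$, $p(-1)=1-p$, and $(x)_+^\alpha=\max(x,0)^\alpha$. Assume: 1. $\Pr(|X_0|>xy)/\Pr(|X_0|>x)\to y^{-\alpha}$ for all $y>0$, and $\Pr(X_0>x)/\Pr(|X_0|>x)\to p$, as $x\to\infty$. 2. There is a measurable $\mathbb V\subset\mathbb S$ with $\Pr(\varepsilon_1\in\mathbb V)=1$ such that $x^{-1}\Psi(x,v)\to\phi(v,\sigma)$ as $x\to\sigma\infty$ for all $v\in\mathbb V$ and all $\sigma\in\{-1,1\}$ with $p(\sigma)>0$. Moreover, if $\Pr[\phi(\varepsilon_1,\sigma)=0]>0$ for some such $\sigma$, there is a measurable $\mathbb W\subset\mathbb V$ with $\Pr(\varepsilon_1\in\mathbb W)=1$ and $\sup_{|y|\le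 x}|\Psi(y,v)|=O(x)$ as $x\to\infty$ for all $v\in\mathbb W$. Let $\mu$ be the law of $(I,I\phi(\varepsilon_1,I))$, where $I$ is independent of $\varepsilon_1$ and $\Pr(I=\sigma)=p(\sigma)$ for $\sigma\in\{-1,1\}$. **Back-and-forth tail chains.** Let $\mathcal M_{p,\alpha}$ be the set of laws of pairs $(I,M)$ on $\{-1,1\}\times\mathbb R$ with $\Pr(I=\sigma)=p(\sigma)$ and $\mathrm E[(\sigma M)_+^\alpha]\le p(\sigma)$ for $\sigma\in\{-1,1\}$. Two laws $\mathcal L(I,M)$ and $\mathcal L(I^*,M^*)$ in $\mathcal M_{p,\alpha}$ are adjoint if $\mathrm E[(xI)_+^\alpha\wedge(yM)_+^\alpha]=\mathrm E[(xM^*)_+^\alpha\wedge(yI^*)_+^\alpha]$ for all $x,y\in\mathbb R$. A process $\{M_t:t\in\mathbb Z\}$ is a back-and-forth tail chain with index $\alpha$ and forward transition law $\mu\in\mathcal M_{p,\alpha}$ if $\mathcal L(M_0,M_1)=\mu$; $\mathcal L(M_0,M_{-1})\in\mathcal M_{p,\alpha}$ is adjoint to $\mu$; and, for every $t\ge1$,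 the conditional law of $M_t$ given $M_{t-1}=x_{t-1},M_{t-2}=x_{t-2},\dots$ is $\mathcal L(x_{t-1}M_1/M_0\mid M_0=\operatorname{sign}x_{t-1})$ if $x_{t-1}\ne0$ and $\delta_0$ if $x_{t-1}=0$, with the mirrored statement (indices negated) also true. **Statement.** A back-and-forth tail chain with index $\alpha$ and forward transition law $\mu$ exists. For every integer $t\ge0$ there is a unique Radon measure $\mu_t$ on $[-\infty,\infty]^{t+1}\setminus\{0\}$ such that $$\frac1{\Pr(|X_0|>x)}\Pr[(x^{-1}X_0,\dots,x^{-1}X_t)\in\cdot\,]\to\mu_t\quad\text{vaguely as }x\to\infty.$$ Let $\{M_t\}$ be any such tail chain. Then $\Pr(M_1=0)=0$ if and only if $\mathrm E[|M_{-1}|^\alpha]=1$, and $\Pr(M_{-1}=0)=0$ if and only if $\mathrm E[|M_1|^\alpha]=1$. Moreover, for every $t\ge0$: (a) if $\Pr(M_1=0)=0$, then for every $\mu_t$-integrable $f$ $$\int f\,d\mu_t=\int_0^\infty\mathrm E[f(zM_{-t},\dots,zM_0)]\,d(-z^{-\alpha});$$ (b) if $\Pr(M_{-1}=0)=0$, then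 for every $\mu_t$-integrable $f$ $$\int f\,d\mu_t=\int_0^\infty\mathrm E[f(zM_0,\dots,zM_t)]\,d(-z^{-\alpha}).$$ Here $d(-z^{-\alpha})=\alpha z^{-\alpha-1}dz$, and the right-hand sides are absolutely convergent. -/

import Mathlib

open MeasureTheory ProbabilityTheory Filter Topology

noncomputable section

namespace TailChain

/-- `p(σ)`: `p(+1) = p`, `p(-1) = 1 - p`. Only used for `σ = 1` and `σ = -1`. -/
def signProb (p σ : ℝ) : ℝ := if σ = 1 then p else 1 - p

/-- The law on `{-1, 1}` that gives mass `p` to `1` and `1 - p` to `-1`. -/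
def signLaw (p : ℝ) : Measure ℝ :=
  ENNReal.ofReal p • Measure.dirac 1 + ENNReal.ofReal (1 - p) • Measure.dirac (-1)

/-- `(x)_+^α`, as an extended nonnegative number. -/
def posPow (α x : ℝ) : ENNReal := ENNReal.ofReal ((max x 0) ^ α)

/-- A stationary Markov chain in recursive form: `X_t = Ψ(X_{t-1}, ε_t)` for `t ≥ 1`, where
`ε_1, ε_2, …` are i.i.d. and independent of `X_0`, and `Ψ(X_0, ε_1)` has the law of `X_0`.
The innovation `ε_t` of the mathematics is `ε (t - 1)` here. -/
structure IsStationaryChain {Ω S : Type*} [MeasurableSpace Ω] [MeasurableSpace S]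
    (P : Measure Ω) (Ψ : ℝ → S → ℝ) (ε : ℕ → Ω → S) (X : ℕ → Ω → ℝ) : Prop where
  measurable_update : Measurable (Function.uncurry Ψ)
  measurable_innov : ∀ t, Measurable (ε t)
  measurable_init : Measurable (X 0)
  indep_innov : iIndepFun ε P
  ident_innov : ∀ t, IdentDistrib (ε t) (ε 0) P P
  indep_init : IndepFun (X 0) (fun ω t => ε t ω) P
  recursion : ∀ t ω, X (t + 1) ω = Ψ (X t ω) (ε t ω)
  stationary : IdentDistrib (fun ω => Ψ (X 0 ω) (ε 0 ω)) (X 0) P P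

/-- Regular variation of `|ξ|` with index `α` and tail balance `p`. -/
structure HasRegVarTails {Ω : Type*} [MeasurableSpace Ω]
    (P : Measure Ω) (ξ : Ω → ℝ) (α p : ℝ) : Prop where
  index_pos : 0 < α
  balance_nonneg : 0 ≤ p
  balance_le_one : p ≤ 1
  regVar : ∀ y : ℝ, 0 < y →
    Tendsto (fun x : ℝ => P.real {ω | x * y < |ξ ω|} / P.real {ω | x < |ξ ω|})
      atTop (𝓝 (y ^ (-α)))
  balance : Tendsto (fun x : ℝ => P.real {ω | x < ξ ω} / P.real {ω | x < |ξ ω|})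
      atTop (𝓝 p)

/-- Asymptotic linearity of `Ψ(·, v)`: for all `v` in a measurable set `V` of full probability and
all signs `σ` with `p(σ) > 0`, `Ψ(x, v) / x → φ(v, σ)` as `x → σ∞`; and if `φ(ε_1, σ)` vanishes
with positive probability for such a `σ`, then for all `v` in a measurable subset `W` of `V` of
full probability, `sup_{|y| ≤ x} |Ψ(y, v)| = O(x)` as `x → ∞`. -/
def AsympLinear {Ω S : Type*} [MeasurableSpace Ω] [MeasurableSpace S]
    (P : Measure Ω) (Ψ : ℝ → S → ℝ) (e : Ω → S) (p : ℝ) (φ : S → ℝ → ℝ) : Prop :=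
  ∃ V : Set S, MeasurableSet V ∧ P {ω | e ω ∈ V} = 1 ∧
    (∀ σ : ℝ, (σ = 1 ∨ σ = -1) → 0 < signProb p σ → ∀ v ∈ V,
      Tendsto (fun x : ℝ => (σ * x)⁻¹ * Ψ (σ * x) v) atTop (𝓝 (φ v σ))) ∧
    ((∃ σ : ℝ, (σ = 1 ∨ σ = -1) ∧ 0 < signProb p σ ∧ 0 < P {ω | φ (e ω) σ = 0}) →
      ∃ W : Set S, MeasurableSet W ∧ W ⊆ V ∧ P {ω | e ω ∈ W} = 1 ∧
        ∀ v ∈ W, ∃ C x₀ : ℝ, ∀ x : ℝ, x₀ ≤ x → ∀ y : ℝ, |y| ≤ x → |Ψ y v| ≤ C * x)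

/-- The law of `(M_0, M_1)`, `M_1 = M_0 φ(ε_1, sign M_0)`, where `M_0` has law `signLaw p` and is
independent of `ε_1`, which has law `κ`. -/
def tailStepLaw {S : Type*} [MeasurableSpace S] (p : ℝ) (κ : Measure S) (φ : S → ℝ → ℝ) :
    Measure (ℝ × ℝ) :=
  ((signLaw p).prod κ).map (fun q => (q.1, q.1 * φ q.2 (Real.sign q.1)))

/-- The class `𝓜_{p,α}` of laws of pairs `(I, M)` on `{-1, 1} × ℝ`. -/
structure MemClass (p α : ℝ) (μ : Measure (ℝ × ℝ)) : Prop where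
  isProbability : IsProbabilityMeasure μ
  prob_one : μ {q | q.1 = 1} = ENNReal.ofReal p
  prob_neg_one : μ {q | q.1 = -1} = ENNReal.ofReal (1 - p)
  support : ∀ᵐ q ∂μ, q.1 = 1 ∨ q.1 = -1
  moment : ∀ σ : ℝ, (σ = 1 ∨ σ = -1) → ∫⁻ q, posPow α (σ * q.2) ∂μ ≤ μ {q | q.1 = σ}

/-- Two laws `μ = 𝓛(I, M)` and `μ' = 𝓛(I*, M*)` in `𝓜_{p,α}` are adjoint. -/
structure IsAdjoint (p α : ℝ) (μ μ' : Measure (ℝ × ℝ)) : Prop where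
  mem_left : MemClass p α μ
  mem_right : MemClass p α μ'
  adjoint : ∀ x y : ℝ,
    ∫⁻ q, min (posPow α (x * q.1)) (posPow α (y * q.2)) ∂μ =
      ∫⁻ q, min (posPow α (x * q.2)) (posPow α (y * q.1)) ∂μ'

/-- The transition law at `x`: the law of `x M / I` given `I = sign x` if `x ≠ 0`, where `(I, M)`
has law `μ`, and the point mass at `0` if `x = 0`. -/
def stepKernel (μ : Measure (ℝ × ℝ)) (x : ℝ) : Measure ℝ :=
  if x = 0 then Measure.dirac 0
  else (ProbabilityTheory.cond μ {q | q.1 = Real.sign x}).map (fun q => x * (q.2 / q.1))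

/-- For every `t ≥ 1`, the conditional law of `M_t` given the whole past `(M_s)_{s < t}` is the
transition law at `M_{t-1}` built on the law of `(M_0, M_1)`; this is expressed by the
defining property of conditional distributions. -/
def HasForwardTransitions {Ω : Type*} [MeasurableSpace Ω] (Q : Measure Ω) (M : ℤ → Ω → ℝ) : Prop :=
  ∀ t : ℤ, 1 ≤ t → ∀ A : Set Ω,
    MeasurableSet[⨆ s ∈ Set.Iio t, MeasurableSpace.comap (M s) inferInstance] A →
    ∀ B : Set ℝ, MeasurableSet B →
      Q (A ∩ M t ⁻¹' B) =
        ∫⁻ ω in A, stepKernel (Q.map (fun ω => (M 0 ω, M 1 ω))) (M (t - 1) ω) B ∂Q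

/-- `(M_t)_{t ∈ ℤ}` is a back-and-forth tail chain with index `α` and forward transition law
`μ ∈ 𝓜_{p,α}`. -/
structure IsBFTC {Ω : Type*} [MeasurableSpace Ω] (Q : Measure Ω) (p α : ℝ)
    (μ : Measure (ℝ × ℝ)) (M : ℤ → Ω → ℝ) : Prop where
  isProbability : IsProbabilityMeasure Q
  measurable : ∀ t, Measurable (M t)
  law_forward : Q.map (fun ω => (M 0 ω, M 1 ω)) = μ
  law_backward : IsAdjoint p α μ (Q.map (fun ω => (M 0 ω, M (-1) ω)))
  forward : HasForwardTransitions Q M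
  backward : HasForwardTransitions Q (fun t => M (-t))

/-- The punctured space `[-∞, ∞]^d \ {0}`. -/
abbrev PuncturedSpace (d : ℕ) : Type := {x : Fin d → EReal // x ≠ 0}

/-- The measure `P[(X_0/x, …, X_t/x) ∈ ·] / P(|X_0| > x)` on `[-∞, ∞]^{t+1} \ {0}`. -/
def scaledLaw {Ω : Type*} [MeasurableSpace Ω] (P : Measure Ω) (X : ℕ → Ω → ℝ) (t : ℕ) (x : ℝ) :
    Measure (PuncturedSpace (t + 1)) :=
  (P {ω | x < |X 0 ω|})⁻¹ •
    (P.map (fun ω (i : Fin (t + 1)) => ((x⁻¹ * X i ω : ℝ) : EReal))).comap Subtype.val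

/-- `m` is a Radon measure (Borel, finite on compact sets) on `[-∞, ∞]^{t+1} \ {0}` and
the scaled laws of `(X_0, …, X_t)` converge vaguely to `m` as `x → ∞`. -/
def IsLimitMeasure {Ω : Type*} [MeasurableSpace Ω] (P : Measure Ω) (X : ℕ → Ω → ℝ) (t : ℕ)
    (m : Measure (PuncturedSpace (t + 1))) : Prop :=
  IsFiniteMeasureOnCompacts m ∧
    ∀ g : PuncturedSpace (t + 1) → ℝ, Continuous g → HasCompactSupport g →
      Tendsto (fun x : ℝ => ∫ u, g u ∂(scaledLaw P X t x)) atTop (𝓝 (∫ u, g u ∂m))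

/-- The measure `d(-z^{-α}) = α z^{-α-1} dz` on `(0, ∞)`. -/
def powMeasure (α : ℝ) : Measure ℝ :=
  (volume.restrict (Set.Ioi 0)).withDensity (fun z => ENNReal.ofReal (α * z ^ (-α - 1)))

/-- The vector `(z M_0, …, z M_t)`. -/
def forwardVec {Ω : Type*} (M : ℤ → Ω → ℝ) (t : ℕ) (z : ℝ) (ω : Ω) : Fin (t + 1) → EReal :=
  fun i => ((z * M (i : ℤ) ω : ℝ) : EReal)

/-- The vector `(z M_{-t}, …, z M_0)`. -/
def backwardVec {Ω : Type*} (M : ℤ → Ω → ℝ) (t : ℕ) (z : ℝ) (ω : Ω) : Fin (t + 1) → EReal :=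
  fun i => ((z * M ((i : ℤ) - (t : ℤ)) ω : ℝ) : EReal)

/-- For every `m`-integrable `f`, `∫ f dm = ∫_0^∞ E[f(vec z)] d(-z^{-α})`, the right-hand side being
absolutely convergent. A function on `[-∞, ∞]^d \ {0}` is given as the restriction of a function on
`[-∞, ∞]^d`, whose value at `0` is arbitrary. -/
def HasPolarFormula {Ω : Type*} [MeasurableSpace Ω] (Q : Measure Ω) (α : ℝ) {d : ℕ}
    (m : Measure (PuncturedSpace d)) (vec : ℝ → Ω → Fin d → EReal) : Prop :=
  ∀ f : (Fin d → EReal) → ℝ, Integrable (fun u : PuncturedSpace d => f u.1) m →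
    Integrable (fun q : ℝ × Ω => f (vec q.1 q.2)) ((powMeasure α).prod Q) ∧
      ∫ u, f u.1 ∂m = ∫ z, (∫ ω, f (vec z ω) ∂Q) ∂(powMeasure α)

end TailChain

end

noncomputable section

namespace TailChain

/-! Start the chain from a large value. By asymptotic linearity the path divided by `x` then follows
the homogeneous recursion `u ↦ u φ(ε, sign u)`, and by regular variation the radius of `X 0 / x` has
limit measure `d(-z^{-α})`. Hence for continuous `F` vanishing where the first coordinate is small,
the normalized expectations of `F` converge to its integral under the law of `z (M_0, …, M_t)`
(`tendsto_integral_scaled`). Freezing the innovations reduces this to one-dimensional tail integrals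
of continuously convergent functions (`tendsto_tail_integral`).

Functions that vanish only near the origin are treated by induction on `t`
(`exists_tendsto_integral`). The trace of `F` on `{x_0 = 0}` depends on the last `t` coordinates
only and is handled by stationarity; the remainder vanishes on `{x_0 = 0}` and is uniformly close to
functions of the first kind. Riesz representation then gives `μ_t`. Two facts are retained about
these measures (`IsTailFamily`): on `{x_0 ≠ 0}`, `μ_t` is the polar law of the forward chain, and
off the origin `μ_{t+1}` projects to `μ_t` when the first coordinate is dropped. What remains is to
control `{x_0 = 0}`.

If `E|M_1|^α = 1`, then `{|x_1| > δ}` has the same mass `δ^{-α}` with and without the condition `x_0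
≠ 0`. So `{x_0 = 0}` is null, and `μ_t` is the forward polar law (`IsTailFamily.eq_forward`).

If `M_1` does not vanish, the last coordinate is nonzero `μ_t`-almost everywhere. Adjointness says
that the polar laws of the pairs `(M_0, M_1)` and `(M_{-1}, M_0)` agree off the axes
(`IsAdjoint.restrict_polarPair`), which is a detailed balance relation between forward and backward
transitions. Iterating it identifies the forward polar law with the reversed backward one on vectors
without zeros (`IsAdjoint.polarLaw_reverse`). This settles `{x_0 ≠ 0}`; projection and induction
settle `{x_0 = 0}` (`IsTailFamily.eq_backward`). The same relation gives `E|M_{-1}|^α = P(M_1 ≠ 0)`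
and its mirror image, hence the two equivalences.

For existence of the tail chain, stationarity yields the moment bound that places the one-step law
in the class (`tailStepLaw_mem`), a change of measure produces an adjoint law
(`MemClass.isAdjoint_adjointLaw`), and independent innovations on the two half-lines of time drive
the two directions (`MemClass.exists_isBFTC`). -/

/-! ### The radial measure d(-z^{-α}) -/

instance sigmaFinite_powMeasure (α : ℝ) : SigmaFinite (powMeasure α) :=
  SigmaFinite.withDensity_ofReal _

theorem powMeasure_Ioi {α : ℝ} (hα : 0 < α) {a : ℝ} (ha : 0 < a) :
    powMeasure α (Set.Ioi a) = ENNReal.ofReal (a ^ (-α)) := by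
  have hsub : Set.Ioi a ⊆ Set.Ioi 0 := Set.Ioi_subset_Ioi ha.le
  rw [powMeasure, withDensity_apply _ measurableSet_Ioi,
    Measure.restrict_restrict measurableSet_Ioi, Set.inter_eq_left.2 hsub,
    ← ofReal_integral_eq_lintegral_ofReal]
  · rw [integral_const_mul, integral_Ioi_rpow_of_lt (by linarith) ha]
    congr 1
    have : -α - 1 + 1 = -α := by ring
    rw [this]
    field_simp
  · exact (integrableOn_Ioi_rpow_of_lt (by linarith) ha).const_mul _
  · filter_upwards [ae_restrict_mem measurableSet_Ioi] with z hz
    exact mul_nonneg hα.le (Real.rpow_nonneg (hsub hz).le _)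

theorem powMeasure_Iic (α : ℝ) : powMeasure α (Set.Iic 0) = 0 := by
  rw [powMeasure, withDensity_apply _ measurableSet_Iic,
    Measure.restrict_restrict measurableSet_Iic, Set.Iic_inter_Ioi, Set.Ioc_self,
    Measure.restrict_empty, lintegral_zero_measure]

theorem ae_powMeasure_pos (α : ℝ) : ∀ᵐ z ∂powMeasure α, 0 < z := by
  have : {z : ℝ | ¬0 < z} = Set.Iic 0 := by ext z; simp
  rw [ae_iff, this]
  exact powMeasure_Iic α

/-- Half-lines form a π-system and each `(1/(n+1), ∞)` has finite mass, so the measures agree on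
each of these and on their union; the mass near `0` may be infinite. -/
theorem measure_ext_of_tails {μ ν : Measure ℝ} (hμ : μ (Set.Iic 0) = 0) (hν : ν (Set.Iic 0) = 0)
    (h : ∀ a : ℝ, 0 < a → μ (Set.Ioi a) = ν (Set.Ioi a))
    (hfin : ∀ a : ℝ, 0 < a → μ (Set.Ioi a) ≠ ⊤) : μ = ν := by
  have hU : (⋃ n : ℕ, Set.Ioi (1 / ((n : ℝ) + 1))) = Set.Ioi 0 := by
    ext z
    simp only [Set.mem_iUnion, Set.mem_Ioi]
    exact ⟨fun ⟨n, hn⟩ => lt_trans (by positivity) hn, fun hz => exists_nat_one_div_lt hz⟩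
  have key : μ.restrict (Set.Ioi 0) = ν.restrict (Set.Ioi 0) := by
    rw [← hU, Measure.restrict_iUnion_congr]
    intro n
    have ha : (0 : ℝ) < 1 / ((n : ℝ) + 1) := by positivity
    have : IsFiniteMeasure (μ.restrict (Set.Ioi (1 / ((n : ℝ) + 1)))) :=
      ⟨by rw [Measure.restrict_apply_univ]; exact (hfin _ ha).lt_top⟩
    have hI : ∀ b : ℝ, Set.Ioi b ∩ Set.Ioi (1 / ((n : ℝ) + 1)) =
        Set.Ioi (max b (1 / ((n : ℝ) + 1))) := fun b => Set.Ioi_inter_Ioi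
    refine ext_of_generate_finite _ (borel_eq_generateFrom_Ioi ℝ ▸ BorelSpace.measurable_eq)
      isPiSystem_Ioi ?_ ?_
    · rintro s ⟨b, rfl⟩
      rw [Measure.restrict_apply measurableSet_Ioi, Measure.restrict_apply measurableSet_Ioi, hI,
        h _ (lt_max_of_lt_right ha)]
    · rw [Measure.restrict_apply_univ, Measure.restrict_apply_univ, h _ ha]
  have e : ∀ m : Measure ℝ, m (Set.Iic 0) = 0 → m.restrict (Set.Ioi 0) = m := by
    intro m hm
    refine Measure.restrict_eq_self_of_ae_mem ?_
    rw [ae_iff]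
    simpa [Set.Iic] using hm
  rw [← e μ hμ, key, e ν hν]

/-! ### Quantile representation and one-sided tail integrals -/

/-- The upper quantile function of a tail function. -/
def upperQuantile (T : ℝ → ℝ) (s : ℝ) : ℝ := sSup {y | s < T y}

section Quantile

variable {Ω : Type*} [MeasurableSpace Ω] (P : Measure Ω) [IsProbabilityMeasure P]
  (Z : Ω → ℝ)

theorem antitone_tail : Antitone fun y : ℝ => P.real {ω | y < Z ω} := fun _ _ hab =>
  measureReal_mono fun _ h => lt_of_le_of_lt hab h

theorem tendsto_tail_atTop (hZ : Measurable Z) :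
    Tendsto (fun y : ℝ => P.real {ω | y < Z ω}) atTop (𝓝 0) := by
  have h := tendsto_measure_iInter_atTop (μ := P) (s := fun y : ℝ => {ω | y < Z ω})
    (fun y => (measurableSet_lt measurable_const hZ).nullMeasurableSet)
    (fun a b hab ω h => lt_of_le_of_lt hab h) ⟨0, measure_ne_top _ _⟩
  have h0 : (⋂ y : ℝ, {ω | y < Z ω}) = ∅ := by
    ext ω
    simp only [Set.mem_iInter, Set.mem_ofPred_eq, Set.mem_empty_iff_false, iff_false, not_forall]
    exact ⟨Z ω, lt_irrefl _⟩
  rw [h0, measure_empty] at h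
  exact (ENNReal.tendsto_toReal ENNReal.zero_ne_top).comp h

theorem tendsto_tail_atBot :
    Tendsto (fun y : ℝ => P.real {ω | y < Z ω}) atBot (𝓝 1) := by
  have h := tendsto_measure_iUnion_atBot (μ := P) (s := fun y : ℝ => {ω | y < Z ω})
    (fun a b hab ω h => lt_of_le_of_lt hab h)
  have h0 : (⋃ y : ℝ, {ω | y < Z ω}) = Set.univ := by
    ext ω
    simp only [Set.mem_iUnion, Set.mem_ofPred_eq, Set.mem_univ, iff_true]
    exact ⟨Z ω - 1, by linarith⟩
  rw [h0, measure_univ] at h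
  exact (ENNReal.tendsto_toReal ENNReal.one_ne_top).comp h

/-- Right continuity of the tail function, which makes the quantile inequality
`lt_upperQuantile_iff` an equivalence with strict signs on both sides. -/
theorem exists_gt_tail {y s : ℝ} (h : s < P.real {ω | y < Z ω}) :
    ∃ y' > y, s < P.real {ω | y' < Z ω} := by
  have hU : (⋃ n : ℕ, {ω | y + 1 / ((n : ℝ) + 1) < Z ω}) = {ω | y < Z ω} := by
    ext ω
    simp only [Set.mem_iUnion, Set.mem_ofPred_eq]
    refine ⟨fun ⟨n, hn⟩ => lt_trans (by linarith [show (0 : ℝ) < 1 / ((n : ℝ) + 1) by positivity])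
      hn,
      fun hz => ?_⟩
    obtain ⟨n, hn⟩ := exists_nat_one_div_lt (sub_pos.2 hz)
    exact ⟨n, by linarith⟩
  have ht := tendsto_measure_iUnion_atTop (μ := P)
    (s := fun n : ℕ => {ω | y + 1 / ((n : ℝ) + 1) < Z ω}) (by
      intro m n hmn ω h
      have : (1 : ℝ) / ((n : ℝ) + 1) ≤ 1 / ((m : ℝ) + 1) := Nat.one_div_le_one_div hmn
      simp only [Set.mem_ofPred_eq] at h ⊢
      linarith)
  rw [hU] at ht
  have ht' := (ENNReal.tendsto_toReal (measure_ne_top P _)).comp ht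
  obtain ⟨n, hn⟩ := (ht'.eventually (lt_mem_nhds h)).exists
  exact ⟨y + 1 / ((n : ℝ) + 1), by linarith [show (0 : ℝ) < 1 / ((n : ℝ) + 1) by positivity], hn⟩

theorem lt_upperQuantile_iff (hZ : Measurable Z) {s : ℝ} (h0 : 0 < s) (h1 : s < 1) (y : ℝ) :
    y < upperQuantile (fun y => P.real {ω | y < Z ω}) s ↔ s < P.real {ω | y < Z ω} := by
  have hne : {y | s < P.real {ω | y < Z ω}}.Nonempty :=
    ((tendsto_tail_atBot P Z).eventually (lt_mem_nhds h1)).exists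
  have hbdd : BddAbove {y | s < P.real {ω | y < Z ω}} := by
    obtain ⟨a, ha⟩ := ((tendsto_tail_atTop P Z hZ).eventually (gt_mem_nhds h0)).exists
    refine ⟨a, fun y hy => ?_⟩
    by_contra! hlt
    exact absurd (antitone_tail P Z hlt.le) (not_le.2 (lt_trans ha hy))
  constructor
  · intro h
    obtain ⟨y', hy', hlt⟩ := exists_lt_of_lt_csSup hne h
    exact lt_of_lt_of_le hy' (antitone_tail P Z hlt.le)
  · intro h
    obtain ⟨y', hy', hlt⟩ := exists_gt_tail P Z h
    exact lt_of_lt_of_le hy' (le_csSup hbdd hlt)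

theorem aemeasurable_upperQuantile (hZ : Measurable Z) :
    AEMeasurable (upperQuantile fun y => P.real {ω | y < Z ω})
      (volume.restrict (Set.Ioo (0 : ℝ) 1)) := by
  refine aemeasurable_restrict_of_antitoneOn measurableSet_Ioo fun s hs s' hs' hss => ?_
  refine le_of_forall_lt fun y hy => ?_
  rw [lt_upperQuantile_iff P Z hZ hs'.1 hs'.2] at hy
  rw [lt_upperQuantile_iff P Z hZ hs.1 hs.2]
  exact lt_of_le_of_lt hss hy

/-- Inverse transform sampling from the upper end: inside `(0, 1)` the preimage of `(y, ∞)` is `(0,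
P(Z > y))`, so tail behaviour is behaviour near `0`. -/
theorem map_upperQuantile (hZ : Measurable Z) :
    (volume.restrict (Set.Ioo (0 : ℝ) 1)).map (upperQuantile fun y => P.real {ω | y < Z ω}) =
      P.map Z := by
  have hq := aemeasurable_upperQuantile P Z hZ
  have : IsProbabilityMeasure (P.map Z) := Measure.isProbabilityMeasure_map hZ.aemeasurable
  symm
  refine ext_of_generate_finite _ (borel_eq_generateFrom_Ioi ℝ ▸ BorelSpace.measurable_eq)
      isPiSystem_Ioi ?_ ?_
  · rintro s ⟨y, rfl⟩
    rw [Measure.map_apply hZ measurableSet_Ioi, Measure.map_apply_of_aemeasurable hq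
      measurableSet_Ioi,
      Measure.restrict_apply₀' measurableSet_Ioo.nullMeasurableSet]
    have : (upperQuantile fun y => P.real {ω | y < Z ω}) ⁻¹' Set.Ioi y ∩ Set.Ioo 0 1 =
        Set.Ioo 0 (P.real {ω | y < Z ω}) := by
      ext s
      simp only [Set.mem_inter_iff, Set.mem_preimage, Set.mem_Ioi, Set.mem_Ioo]
      constructor
      · rintro ⟨h, h0, h1⟩
        exact ⟨h0, (lt_upperQuantile_iff P Z hZ h0 h1 y).1 h⟩
      · rintro ⟨h0, h⟩
        have h1 : s < 1 := lt_of_lt_of_le h measureReal_le_one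
        exact ⟨(lt_upperQuantile_iff P Z hZ h0 h1 y).2 h, h0, h1⟩
    rw [this, Real.volume_Ioo, sub_zero, ofReal_measureReal]
    rfl
  · rw [measure_univ, Measure.map_apply_of_aemeasurable hq MeasurableSet.univ]
    simp

end Quantile

/-- `(c / r) ^ α⁻¹` is the scaling limit of the quantile function; it exceeds `a` exactly for `r` in
`(0, c a^{-α})`. -/
theorem map_rpow_volume {α c : ℝ} (hα : 0 < α) (hc : 0 < c) :
    (volume.restrict (Set.Ioi (0 : ℝ))).map (fun r => (c / r) ^ α⁻¹) =
      ENNReal.ofReal c • powMeasure α := by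
  have hm : Measurable fun r : ℝ => (c / r) ^ α⁻¹ := by fun_prop
  have htail : ∀ a : ℝ, 0 < a → (volume.restrict (Set.Ioi (0 : ℝ))).map
      (fun r => (c / r) ^ α⁻¹) (Set.Ioi a) = ENNReal.ofReal (c * a ^ (-α)) := by
    intro a ha
    rw [Measure.map_apply hm measurableSet_Ioi, Measure.restrict_apply (hm measurableSet_Ioi)]
    have : (fun r : ℝ => (c / r) ^ α⁻¹) ⁻¹' Set.Ioi a ∩ Set.Ioi 0 = Set.Ioo 0 (c * a ^ (-α)) := by
      ext r
      simp only [Set.mem_inter_iff, Set.mem_preimage, Set.mem_Ioi, Set.mem_Ioo]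
      rw [and_comm]
      refine and_congr_right fun hr => ?_
      rw [Real.lt_rpow_inv_iff_of_pos ha.le (by positivity) hα, lt_div_iff₀ hr, Real.rpow_neg ha.le,
        ← div_eq_mul_inv, lt_div_iff₀ (by positivity), mul_comm]
    rw [this, Real.volume_Ioo, sub_zero]
  refine measure_ext_of_tails ?_ ?_ ?_ ?_
  · rw [Measure.map_apply hm measurableSet_Iic, Measure.restrict_apply (hm measurableSet_Iic)]
    have : (fun r : ℝ => (c / r) ^ α⁻¹) ⁻¹' Set.Iic 0 ∩ Set.Ioi 0 = ∅ := by
      ext r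
      simp only [Set.mem_inter_iff, Set.mem_preimage, Set.mem_Iic, Set.mem_Ioi,
        Set.mem_empty_iff_false, iff_false, not_and, not_lt]
      intro h
      by_contra! hr
      exact absurd h (not_le.2 (by positivity))
    rw [this, measure_empty]
  · rw [Measure.smul_apply, powMeasure_Iic, smul_zero]
  · intro a ha
    rw [htail a ha, Measure.smul_apply, powMeasure_Ioi hα ha, smul_eq_mul,
      ENNReal.ofReal_mul hc.le]
  · intro a ha
    rw [htail a ha]
    exact ENNReal.ofReal_ne_top

theorem integral_rpow_volume {α c : ℝ} (hα : 0 < α) (hc : 0 < c) {g : ℝ → ℝ} (hg : Measurable g) :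
    ∫ r in Set.Ioi 0, g ((c / r) ^ α⁻¹) = c * ∫ z, g z ∂powMeasure α := by
  rw [← integral_map (φ := fun r : ℝ => (c / r) ^ α⁻¹)
    (by fun_prop) (hg.aestronglyMeasurable), map_rpow_volume hα hc, integral_smul_measure,
    ENNReal.toReal_ofReal hc.le, smul_eq_mul]

/-- Convergence of tail expectations of a regularly varying random variable, for functions that
converge continuously. -/
theorem tendsto_tail_integral {Ω : Type*} [MeasurableSpace Ω] (P : Measure Ω)
    [IsProbabilityMeasure P] {Z : Ω → ℝ} (hZ : Measurable Z) {b : ℝ → ℝ} (hb : ∀ x, 0 < b x)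
    {α c : ℝ} (hα : 0 < α) (hc : 0 ≤ c)
    (hT : ∀ a : ℝ, 0 < a →
      Tendsto (fun x => P.real {ω | x * a < Z ω} / b x) atTop (𝓝 (c * a ^ (-α))))
    {g : ℝ → ℝ → ℝ} {g' : ℝ → ℝ} {C η : ℝ} (hη : 0 < η) (hg : ∀ x, Measurable (g x))
    (hg' : Measurable g') (hgC : ∀ x u, |g x u| ≤ C) (hg0 : ∀ x u, u ≤ η → g x u = 0)
    (hlim : 0 < c → ∀ u, 0 < u →
      Tendsto (fun q : ℝ × ℝ => g q.1 q.2) (atTop ×ˢ 𝓝 u) (𝓝 (g' u))) :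
    Tendsto (fun x => (b x)⁻¹ * ∫ ω, g x (x⁻¹ * Z ω) ∂P) atTop
      (𝓝 (c * ∫ z, g' z ∂powMeasure α)) := by
  set T : ℝ → ℝ := fun y => P.real {ω | y < Z ω} with hTdef
  set q := upperQuantile T with hq
  have hqm := aemeasurable_upperQuantile P Z hZ
  have hqiff : ∀ s, 0 < s → s < 1 → ∀ y, y < q s ↔ s < T y := fun s h0 h1 y =>
    lt_upperQuantile_iff P Z hZ h0 h1 y
  set H : ℝ → ℝ → ℝ := fun x => (Set.Ioo (0 : ℝ) 1).indicator fun s => g x (x⁻¹ * q s) with hH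
  have hHm : ∀ x, AEStronglyMeasurable (H x) volume := fun x => by
    rw [hH, aestronglyMeasurable_indicator_iff measurableSet_Ioo]
    exact ((hg x).comp_aemeasurable (hqm.const_mul _)).aestronglyMeasurable
  have hHin : ∀ x s, s ∈ Set.Ioo (0 : ℝ) 1 → H x s = g x (x⁻¹ * q s) := fun x s hs =>
    Set.indicator_of_mem hs _
  have hHout : ∀ x s, s ∉ Set.Ioo (0 : ℝ) 1 → H x s = 0 := fun x s hs =>
    Set.indicator_of_notMem hs _
  -- Substituting `s = b x * r` in the quantile integral absorbs the normalization and leaves an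
  -- integrand that converges for each fixed `r`.
  have hrepr : ∀ x, (b x)⁻¹ * ∫ ω, g x (x⁻¹ * Z ω) ∂P = ∫ r, H x (b x * r) := by
    intro x
    have h1 : ∫ ω, g x (x⁻¹ * Z ω) ∂P = ∫ y, g x (x⁻¹ * y) ∂(P.map Z) := by
      rw [integral_map hZ.aemeasurable]
      exact ((hg x).comp (measurable_const_mul _)).aestronglyMeasurable
    rw [h1, ← map_upperQuantile P Z hZ, integral_map hqm
      (f := fun y => g x (x⁻¹ * y))
      ((hg x).comp (measurable_const_mul _)).aestronglyMeasurable, Measure.integral_comp_mul_left,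
      hH, integral_indicator measurableSet_Ioo, abs_of_pos (inv_pos.2 (hb x)), smul_eq_mul]
  simp_rw [hrepr]
  -- For `c = 0` the integrand is eventually zero at every `r > 0`, whereas the formula would return
  -- the uncontrolled value `g' 0`.
  set L : ℝ → ℝ := (Set.Ioi (0 : ℝ)).indicator fun r => if c = 0 then 0 else g' ((c / r) ^ α⁻¹)
    with hL
  have hLint : ∫ r, L r = c * ∫ z, g' z ∂powMeasure α := by
    rw [hL, integral_indicator measurableSet_Ioi]
    rcases eq_or_ne c 0 with h | h
    · simp [h]
    · simp only [h, if_false]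
      exact integral_rpow_volume hα (lt_of_le_of_ne hc h.symm) hg'
  rw [← hLint]
  -- Above `c η^{-α}` the rescaled quantile is eventually at most `η`, where `g` vanishes. The
  -- margin `1` lets a single bound on `x` serve all `r ≥ R`, which gives the dominating function.
  set R := c * η ^ (-α) + 1
  have hTη : ∀ r, c * η ^ (-α) < r → ∀ᶠ x in atTop, T (x * η) < b x * r := fun r hr => by
    filter_upwards [(hT η hη).eventually (gt_mem_nhds hr)] with x hx
    rwa [div_lt_iff₀ (hb x), mul_comm r] at hx
  have hzero : ∀ x, 0 < x → ∀ s, T (x * η) ≤ s → H x s = 0 := by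
    intro x hx s hs
    rw [hH]
    refine Set.indicator_apply_eq_zero.2 fun hmem => hg0 _ _ ?_
    by_contra! hlt
    have : x * η < q s := by
      rw [inv_mul_eq_div, lt_div_iff₀ hx] at hlt
      linarith
    exact absurd ((hqiff s hmem.1 hmem.2 _).1 this) (not_lt.2 hs)
  refine tendsto_integral_filter_of_dominated_convergence
    ((Set.Ioo (0 : ℝ) R).indicator fun _ => C) ?_ ?_ ?_ ?_
  · refine Eventually.of_forall fun x => (hHm x).comp_quasiMeasurePreserving ?_
    refine ⟨by fun_prop, ?_⟩
    rw [Real.map_volume_mul_left (hb x).ne']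
    exact Measure.smul_absolutelyContinuous
  · filter_upwards [hTη R (by simp [R]), eventually_gt_atTop 0] with x hx hx0
    refine Eventually.of_forall fun r => ?_
    by_cases hr : r ∈ Set.Ioo 0 R
    · rw [Set.indicator_of_mem hr, Real.norm_eq_abs]
      by_cases h : b x * r ∈ Set.Ioo (0 : ℝ) 1
      · rw [hHin x _ h]
        exact hgC _ _
      · rw [hHout x _ h, abs_zero]
        exact (abs_nonneg _).trans (hgC 0 0)
    · rw [Set.indicator_of_notMem hr]
      rcases le_or_gt r 0 with h | h
      · have : H x (b x * r) = 0 := Set.indicator_of_notMem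
          (fun hm => absurd hm.1 (not_lt.2 (mul_nonpos_of_nonneg_of_nonpos (hb x).le h))) _
        simp [this]
      · have hR : R ≤ r := by
          by_contra! hlt
          exact hr ⟨h, hlt⟩
        rw [hzero x hx0 _ (hx.le.trans (mul_le_mul_of_nonneg_left hR (hb x).le)), norm_zero]
  · exact (integrable_indicator_iff measurableSet_Ioo).2 (integrableOn_const (by simp))
  · refine Eventually.of_forall fun r => ?_
    rcases le_or_gt r 0 with hr | hr
    · have h1 : ∀ x, H x (b x * r) = 0 := fun x => Set.indicator_of_notMem
          (fun hm => absurd hm.1 (not_lt.2 (mul_nonpos_of_nonneg_of_nonpos (hb x).le hr))) _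
      have h2 : L r = 0 := Set.indicator_of_notMem (by simpa using hr) _
      simp only [h1, h2]
      exact tendsto_const_nhds
    · have hLr : L r = if c = 0 then 0 else g' ((c / r) ^ α⁻¹) := Set.indicator_of_mem hr _
      rw [hLr]
      rcases eq_or_ne c 0 with h | h
      · rw [if_pos h]
        refine tendsto_const_nhds.congr' ?_
        filter_upwards [hTη r (by simpa [h] using hr), eventually_gt_atTop 0] with x hx hx0
        exact (hzero x hx0 _ hx.le).symm
      · rw [if_neg h]
        have hc' : 0 < c := lt_of_le_of_ne hc h.symm
        set u := (c / r) ^ α⁻¹ with hu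
        have hu0 : 0 < u := by positivity
        have hlow : ∀ a, 0 < a → a < u → ∀ᶠ x in atTop, b x * r < T (x * a) := by
          intro a ha hau
          rw [hu, Real.lt_rpow_inv_iff_of_pos ha.le (by positivity) hα, lt_div_iff₀ hr] at hau
          have : r < c * a ^ (-α) := by
            rw [Real.rpow_neg ha.le, ← div_eq_mul_inv, lt_div_iff₀ (by positivity)]
            linarith
          filter_upwards [(hT a ha).eventually (lt_mem_nhds this)] with x hx
          rwa [lt_div_iff₀ (hb x), mul_comm r] at hx
        have hlt1 : ∀ᶠ x in atTop, b x * r < 1 := by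
          filter_upwards [hlow (u / 2) (by positivity) (by linarith)] with x hx
          exact lt_of_lt_of_le hx measureReal_le_one
        -- The limiting tail `c a^{-α}` is strictly decreasing in `a`, so tail convergence at levels
        -- just below and above `u` traps the quantile.
        have hqlim : Tendsto (fun x => x⁻¹ * q (b x * r)) atTop (𝓝 u) := by
          refine tendsto_order.2 ⟨fun a ha => ?_, fun a ha => ?_⟩
          · have : max a (u / 2) < u := max_lt ha (by linarith)
            filter_upwards [hlow (max a (u / 2)) (lt_max_of_lt_right (by positivity)) this,
              hlt1, eventually_gt_atTop 0] with x hx h1 hx0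
            have := (hqiff _ (mul_pos (hb x) hr) h1 _).2 hx
            rw [inv_mul_eq_div, lt_div_iff₀ hx0]
            refine lt_of_le_of_lt ?_ this
            rw [mul_comm]
            exact mul_le_mul_of_nonneg_left (le_max_left _ _) hx0.le
          · obtain ⟨a', hua', ha'a⟩ := exists_between ha
            have ha' : 0 < a' := hu0.trans hua'
            have hlt : c * a' ^ (-α) < r := by
              have := hua'
              rw [hu, Real.rpow_inv_lt_iff_of_pos (by positivity) ha'.le hα, div_lt_iff₀ hr] at this
              rw [Real.rpow_neg ha'.le, ← div_eq_mul_inv, div_lt_iff₀ (by positivity)]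
              linarith
            filter_upwards [(hT a' ha').eventually (gt_mem_nhds hlt), hlt1,
              eventually_gt_atTop 0] with x hx h1 hx0
            rw [div_lt_iff₀ (hb x), mul_comm r] at hx
            have := mt (hqiff _ (mul_pos (hb x) hr) h1 (x * a')).1 (not_lt.2 hx.le)
            rw [inv_mul_eq_div, div_lt_iff₀ hx0]
            refine lt_of_le_of_lt (not_lt.1 this) ?_
            rw [mul_comm]
            exact mul_lt_mul_of_pos_right ha'a hx0
        have := (hlim hc' u hu0).comp (tendsto_id.prodMk hqlim)
        refine this.congr' ?_
        filter_upwards [hlt1] with x h1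
        exact (hHin x _ ⟨mul_pos (hb x) hr, h1⟩).symm

/-! ### Two-sided regularly varying tails -/

theorem signProb_one (p : ℝ) : signProb p 1 = p := if_pos rfl

theorem signProb_neg_one (p : ℝ) : signProb p (-1) = 1 - p := if_neg (by norm_num)

section RegVar

variable {Ω : Type*} [MeasurableSpace Ω] {P : Measure Ω} [IsProbabilityMeasure P] {ξ : Ω → ℝ}
  {α p : ℝ}

/-- At `y = 1` the ratio tends to `1`, but a vanishing tail would make it `0`, since division by
zero gives `0`. So the tail is positive for large `x`, hence for all `x` by monotonicity. -/
theorem HasRegVarTails.tail_pos (h : HasRegVarTails P ξ α p) (x : ℝ) :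
    0 < P.real {ω | x < |ξ ω|} := by
  have h1 : ∀ᶠ x in atTop, 0 < P.real {ω | x < |ξ ω|} := by
    filter_upwards [(h.regVar 1 one_pos).eventually (lt_mem_nhds (a := 0) (by simp))] with x hx
    refine lt_of_le_of_ne measureReal_nonneg fun h0 => ?_
    rw [← h0, div_zero] at hx
    exact lt_irrefl _ hx
  obtain ⟨y, hy, hxy⟩ := (h1.and (eventually_ge_atTop x)).exists
  exact hy.trans_le (antitone_tail P (fun ω => |ξ ω|) hxy)

theorem HasRegVarTails.tail_pos_side (h : HasRegVarTails P ξ α p) {a : ℝ} (ha : 0 < a) :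
    Tendsto (fun x => P.real {ω | x * a < ξ ω} / P.real {ω | x < |ξ ω|}) atTop
      (𝓝 (p * a ^ (-α))) := by
  have h1 := (h.balance.comp (tendsto_id.atTop_mul_const ha)).mul (h.regVar a ha)
  refine h1.congr fun x => ?_
  simp only [Function.comp, id]
  rw [div_mul_div_cancel₀ (h.tail_pos _).ne']

/-- The left tail is the two-sided tail minus the right tail, the two events being disjoint at
nonnegative levels. -/
theorem HasRegVarTails.tail_neg_side (h : HasRegVarTails P ξ α p) (hξ : Measurable ξ) {a : ℝ}
    (ha : 0 < a) :
    Tendsto (fun x => P.real {ω | x * a < -ξ ω} / P.real {ω | x < |ξ ω|}) atTop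
      (𝓝 ((1 - p) * a ^ (-α))) := by
  have h1 := (h.regVar a ha).sub (h.tail_pos_side ha)
  rw [show a ^ (-α) - p * a ^ (-α) = (1 - p) * a ^ (-α) by ring] at h1
  refine h1.congr' ?_
  filter_upwards [eventually_ge_atTop 0] with x hx
  rw [← sub_div]
  congr 1
  have hU : {ω | x * a < |ξ ω|} = {ω | x * a < ξ ω} ∪ {ω | x * a < -ξ ω} := by
    ext ω
    exact lt_abs (a := x * a) (b := ξ ω)
  rw [hU, measureReal_union (s₁ := {ω | x * a < ξ ω}) (s₂ := {ω | x * a < -ξ ω}) ?_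
    (measurableSet_lt measurable_const hξ.neg)]
  · ring
  · rw [Set.disjoint_left]
    intro ω h1 h2
    have h1 : x * a < ξ ω := h1
    have h2 : x * a < -ξ ω := h2
    have : 0 ≤ x * a := by positivity
    linarith

/-- Convergence of two-sided tail expectations, for functions that converge continuously. -/
theorem HasRegVarTails.tendsto_integral (h : HasRegVarTails P ξ α p) (hξ : Measurable ξ)
    {g : ℝ → ℝ → ℝ} {g' : ℝ → ℝ} {C η : ℝ} (hη : 0 < η) (hg : ∀ x, Measurable (g x))
    (hg' : Measurable g') (hgC : ∀ x u, |g x u| ≤ C) (hg0 : ∀ x u, |u| ≤ η → g x u = 0)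
    (hlim : ∀ u, u ≠ 0 → 0 < signProb p (Real.sign u) →
      Tendsto (fun q : ℝ × ℝ => g q.1 q.2) (atTop ×ˢ 𝓝 u) (𝓝 (g' u))) :
    Tendsto (fun x => (P.real {ω | x < |ξ ω|})⁻¹ * ∫ ω, g x (x⁻¹ * ξ ω) ∂P) atTop
      (𝓝 (p * ∫ z, g' z ∂powMeasure α + (1 - p) * ∫ z, g' (-z) ∂powMeasure α)) := by
  have hC : 0 ≤ C := (abs_nonneg _).trans (hgC 0 0)
  -- The two half-lines are treated separately; nothing is lost at `0` because `g` vanishes on `[-η,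
  -- η]`.
  set g₁ : ℝ → ℝ → ℝ := fun x u => if 0 < u then g x u else 0 with hg₁
  set g₂ : ℝ → ℝ → ℝ := fun x u => if 0 < u then g x (-u) else 0 with hg₂
  have hm₁ : ∀ x, Measurable (g₁ x) := fun x =>
    Measurable.ite measurableSet_Ioi (hg x) measurable_const
  have hm₂ : ∀ x, Measurable (g₂ x) := fun x =>
    Measurable.ite measurableSet_Ioi ((hg x).comp measurable_neg) measurable_const
  have hb₁ : ∀ x u, |g₁ x u| ≤ C := fun x u => by
    simp only [hg₁]; split_ifs
    · exact hgC _ _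
    · simpa using hC
  have hb₂ : ∀ x u, |g₂ x u| ≤ C := fun x u => by
    simp only [hg₂]; split_ifs
    · exact hgC _ _
    · simpa using hC
  have hz₁ : ∀ x u, u ≤ η → g₁ x u = 0 := fun x u hu => by
    simp only [hg₁]; split_ifs with h0
    · exact hg0 _ _ (by rwa [abs_of_pos h0])
    · rfl
  have hz₂ : ∀ x u, u ≤ η → g₂ x u = 0 := fun x u hu => by
    simp only [hg₂]; split_ifs with h0
    · exact hg0 _ _ (by rwa [abs_neg, abs_of_pos h0])
    · rfl
  have hev : ∀ u : ℝ, 0 < u → ∀ᶠ q : ℝ × ℝ in atTop ×ˢ 𝓝 u, 0 < q.2 := fun u hu =>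
    tendsto_snd.eventually (lt_mem_nhds hu)
  have l₁ := tendsto_tail_integral P hξ h.tail_pos h.index_pos h.balance_nonneg
    (fun a ha => h.tail_pos_side ha) hη hm₁ hg' hb₁ hz₁ (fun hp u hu => by
      refine (hlim u hu.ne' (by rwa [Real.sign_of_pos hu, signProb_one])).congr' ?_
      filter_upwards [hev u hu] with q hq
      simp only [hg₁, if_pos hq])
  have l₂ := tendsto_tail_integral P hξ.neg h.tail_pos h.index_pos
    (sub_nonneg.2 h.balance_le_one)
    (fun a ha => h.tail_neg_side hξ ha) hη hm₂ (hg'.comp measurable_neg) hb₂ hz₂ (fun hp u hu => by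
      have := hlim (-u) (by linarith [hu] : -u < 0).ne
        (by rwa [Real.sign_of_neg (by linarith), signProb_neg_one])
      refine (this.comp (tendsto_fst.prodMk ((continuous_neg.tendsto u).comp
        tendsto_snd))).congr' ?_
      filter_upwards [hev u hu] with q hq
      simp only [hg₂, if_pos hq, Function.comp])
  refine (l₁.add l₂).congr fun x => ?_
  rw [← mul_add, ← integral_add]
  · congr 2
    ext ω
    simp only [hg₁, hg₂, mul_neg, neg_neg, Pi.neg_apply]
    rcases lt_trichotomy (x⁻¹ * ξ ω) 0 with h0 | h0 | h0
    · rw [if_neg (by linarith), if_pos (by linarith), zero_add]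
    · rw [h0, hg0 x 0 (by simpa using hη.le)]
      simp
    · rw [if_pos h0, if_neg (by linarith), add_zero]
  · exact Integrable.of_bound ((hm₁ x).comp (hξ.const_mul _)).aestronglyMeasurable C
      (Eventually.of_forall fun ω => hb₁ _ _)
  · exact Integrable.of_bound ((hm₂ x).comp (hξ.neg.const_mul _)).aestronglyMeasurable C
      (Eventually.of_forall fun ω => hb₂ _ _)

end RegVar

/-! ### A continuous truncated size on [-∞, ∞]^d -/

theorem coe_max (a b : ℝ) : ((max a b : ℝ) : EReal) = max (a : EReal) b :=
  EReal.coe_strictMono.monotone.map_max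

theorem coe_min (a b : ℝ) : ((min a b : ℝ) : EReal) = min (a : EReal) b :=
  EReal.coe_strictMono.monotone.map_min

/-- Truncation of the extended real line to `[-1, 1]`. -/
def eclamp (u : EReal) : ℝ := EReal.toReal (max ((-1 : ℝ) : EReal) (min u ((1 : ℝ) : EReal)))

theorem continuous_eclamp : Continuous eclamp := by
  refine EReal.continuousOn_toReal.comp_continuous (by fun_prop) fun u => ?_
  simp only [Set.mem_compl_iff, Set.mem_insert_iff, Set.mem_singleton_iff, not_or]
  constructor
  · exact (lt_of_lt_of_le (EReal.bot_lt_coe _) (le_max_left _ _)).ne'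
  · exact (max_lt (EReal.coe_lt_top _) (lt_of_le_of_lt (min_le_right _ _) (EReal.coe_lt_top _))).ne

theorem eclamp_coe (r : ℝ) : eclamp (r : EReal) = max (-1) (min r 1) := by
  rw [eclamp, ← coe_min, ← coe_max, EReal.toReal_coe]

/-- The distance to zero, truncated at one, on the extended real line. -/
def esize (u : EReal) : ℝ := |eclamp u|

theorem esize_coe (r : ℝ) : esize (r : EReal) = min |r| 1 := by
  rw [esize, eclamp_coe]
  rcases le_total |r| 1 with h | h
  · rw [min_eq_left h]
    rw [abs_le] at h
    rw [min_eq_left h.2, max_eq_right h.1]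
  · rw [min_eq_right h]
    rcases le_abs.1 h with h | h
    · rw [min_eq_right h]; norm_num
    · rw [min_eq_left (by linarith), max_eq_left (by linarith)]; norm_num

theorem continuous_esize : Continuous esize := continuous_eclamp.abs

theorem esize_nonneg (u : EReal) : 0 ≤ esize u := abs_nonneg _

theorem esize_top : esize ⊤ = 1 := by
  rw [esize, eclamp, min_eq_right le_top, ← coe_max]
  norm_num

theorem esize_bot : esize ⊥ = 1 := by
  rw [esize, eclamp, min_eq_left bot_le, max_eq_left bot_le]
  norm_num

theorem esize_zero : esize 0 = 0 := by
  have := esize_coe 0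
  simpa using this

theorem esize_eq_zero {u : EReal} : esize u = 0 ↔ u = 0 := by
  refine ⟨fun h => ?_, fun h => h ▸ esize_zero⟩
  induction u with
  | bot => rw [esize_bot] at h; norm_num at h
  | top => rw [esize_top] at h; norm_num at h
  | coe r =>
    rw [esize_coe] at h
    rcases min_choice |r| 1 with h' | h'
    · rw [h', abs_eq_zero] at h
      rw [h, EReal.coe_zero]
    · rw [h'] at h; norm_num at h

theorem esize_pos {u : EReal} : 0 < esize u ↔ u ≠ 0 := by
  rw [(esize_nonneg u).lt_iff_ne, ne_comm, Ne, esize_eq_zero]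

theorem lt_esize_coe {η r : ℝ} (hη : η < 1) : η < esize (r : EReal) ↔ η < |r| := by
  rw [esize_coe, lt_min_iff]
  exact ⟨fun h => h.1, fun h => ⟨h, hη⟩⟩

/-- The sum of the truncated sizes of the coordinates. -/
def vsize {d : ℕ} (x : Fin d → EReal) : ℝ := ∑ i, esize (x i)

theorem continuous_vsize {d : ℕ} : Continuous (vsize (d := d)) :=
  continuous_finsetSum _ fun i _ => continuous_esize.comp (continuous_apply i)

theorem vsize_nonneg {d : ℕ} (x : Fin d → EReal) : 0 ≤ vsize x :=
  Finset.sum_nonneg fun _ _ => esize_nonneg _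

theorem vsize_eq_zero {d : ℕ} {x : Fin d → EReal} : vsize x = 0 ↔ x = 0 := by
  rw [vsize, Finset.sum_eq_zero_iff_of_nonneg fun _ _ => esize_nonneg _]
  simp [esize_eq_zero, funext_iff]

theorem vsize_pos {d : ℕ} {x : Fin d → EReal} : 0 < vsize x ↔ x ≠ 0 := by
  rw [(vsize_nonneg x).lt_iff_ne, ne_comm, Ne, vsize_eq_zero]

theorem esize_le_vsize {d : ℕ} (x : Fin d → EReal) (i : Fin d) : esize (x i) ≤ vsize x :=
  Finset.single_le_sum (f := fun i => esize (x i)) (fun _ _ => esize_nonneg _) (Finset.mem_univ i)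

theorem exists_esize_gt {d : ℕ} {x : Fin d → EReal} {δ : ℝ} (hδ : 0 ≤ δ)
    (h : δ < vsize x) :
    ∃ i, δ / d < esize (x i) := by
  by_contra! hle
  have h1 : vsize x ≤ ∑ _i : Fin d, δ / d := Finset.sum_le_sum fun i _ => hle i
  rcases Nat.eq_zero_or_pos d with h0 | h0
  · subst h0
    simp only [vsize, Finset.univ_eq_empty, Finset.sum_empty] at h
    linarith
  · rw [Finset.sum_const, Finset.card_univ, Fintype.card_fin, nsmul_eq_mul,
      mul_div_cancel₀ _ (by positivity)] at h1
    linarith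

/-! ### Recursive paths, homogeneity and polar laws -/

/-- The path of the recursion `y ↦ Ψ y (e k)` started at `y`. -/
def chainPath {S : Type*} (Ψ : ℝ → S → ℝ) (y : ℝ) (e : ℕ → S) : ℕ → ℝ
  | 0 => y
  | k + 1 => Ψ (chainPath Ψ y e k) (e k)

/-- One step of the tail chain. -/
def tailStep {S : Type*} (φ : S → ℝ → ℝ) (u : ℝ) (v : S) : ℝ := u * φ v (Real.sign u)

theorem tailStep_zero {S : Type*} (φ : S → ℝ → ℝ) (v : S) : tailStep φ 0 v = 0 := by simp [tailStep]

theorem sign_mul_of_pos {c : ℝ} (hc : 0 < c) (u : ℝ) : Real.sign (c * u) = Real.sign u := by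
  rcases lt_trichotomy u 0 with h | h | h
  · rw [Real.sign_of_neg h, Real.sign_of_neg (mul_neg_of_pos_of_neg hc h)]
  · simp [h]
  · rw [Real.sign_of_pos h, Real.sign_of_pos (mul_pos hc h)]

theorem tailStep_mul {S : Type*} (φ : S → ℝ → ℝ) {c : ℝ} (hc : 0 < c) (u : ℝ) (v : S) :
    tailStep φ (c * u) v = c * tailStep φ u v := by
  rw [tailStep, tailStep, sign_mul_of_pos hc, mul_assoc]

theorem chainPath_tailStep_mul {S : Type*} (φ : S → ℝ → ℝ) {c : ℝ} (hc : 0 < c) (u : ℝ) (e : ℕ → S)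
    (k : ℕ) :
    chainPath (tailStep φ) (c * u) e k = c * chainPath (tailStep φ) u e k := by
  induction k with
  | zero => rfl
  | succ k ih => rw [chainPath, ih, tailStep_mul φ hc, chainPath]

section Paths

variable {S : Type*} [MeasurableSpace S]

theorem measurable_chainPath {Ψ : ℝ → S → ℝ} (hΨ : Measurable (Function.uncurry Ψ)) (k : ℕ) :
    Measurable fun q : ℝ × (ℕ → S) => chainPath Ψ q.1 q.2 k := by
  induction k with
  | zero => exact measurable_fst
  | succ k ih =>
    exact hΨ.comp (ih.prodMk ((measurable_pi_apply k).comp measurable_snd))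

theorem measurable_tailStep {φ : S → ℝ → ℝ} (hφ : ∀ σ, Measurable fun v => φ v σ) :
    Measurable (Function.uncurry (tailStep φ)) := by
  have : Function.uncurry (tailStep φ) = fun q : ℝ × S =>
      if 0 < q.1 then q.1 * φ q.2 1 else if q.1 < 0 then q.1 * φ q.2 (-1) else 0 := by
    ext ⟨u, v⟩
    simp only [Function.uncurry, tailStep]
    rcases lt_trichotomy u 0 with h | h | h
    · rw [if_neg (by linarith), if_pos h, Real.sign_of_neg h]
    · simp [h]
    · rw [if_pos h, Real.sign_of_pos h]
  rw [this]
  refine Measurable.ite (measurableSet_lt measurable_const measurable_fst)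
    (measurable_fst.mul ((hφ 1).comp measurable_snd)) ?_
  exact Measurable.ite (measurableSet_lt measurable_fst measurable_const)
    (measurable_fst.mul ((hφ (-1)).comp measurable_snd)) measurable_const

end Paths

theorem IsStationaryChain.eq_chainPath {Ω S : Type*} [MeasurableSpace Ω] [MeasurableSpace S]
    {P : Measure Ω} {Ψ : ℝ → S → ℝ} {ε : ℕ → Ω → S} {X : ℕ → Ω → ℝ}
    (hX : IsStationaryChain P Ψ ε X) (k : ℕ) (ω : Ω) :
    X k ω = chainPath Ψ (X 0 ω) (fun n => ε n ω) k := by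
  induction k with
  | zero => rfl
  | succ k ih => rw [hX.recursion, ih, chainPath]

/-- The law of `z N` for `z` distributed according to `d(-z^{-α})` and `N` a random vector. -/
def polarLaw {Ω' : Type*} [MeasurableSpace Ω'] (α : ℝ) (Q : Measure Ω') {d : ℕ}
    (N : Fin d → Ω' → ℝ) : Measure (Fin d → ℝ) :=
  ((powMeasure α).prod Q).map fun q i => q.1 * N i q.2

/-- The embedding of `ℝ^d` into `[-∞, ∞]^d`. -/
def coeVec {d : ℕ} (y : Fin d → ℝ) (i : Fin d) : EReal := (y i : EReal)

theorem continuous_coeVec {d : ℕ} : Continuous (coeVec (d := d)) :=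
  continuous_pi fun i => continuous_coe_real_ereal.comp (continuous_apply i)

theorem integral_signLaw {p : ℝ} (h0 : 0 ≤ p) (h1 : p ≤ 1) (f : ℝ → ℝ) :
    ∫ σ, f σ ∂signLaw p = p * f 1 + (1 - p) * f (-1) := by
  have hi : ∀ a : ℝ, Integrable f (Measure.dirac a) := fun a => integrable_dirac (by simp)
  rw [signLaw, integral_add_measure ((hi 1).smul_measure ENNReal.ofReal_ne_top)
    ((hi (-1)).smul_measure ENNReal.ofReal_ne_top), integral_smul_measure, integral_smul_measure,
    integral_dirac, integral_dirac, ENNReal.toReal_ofReal h0,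
    ENNReal.toReal_ofReal (sub_nonneg.2 h1), smul_eq_mul, smul_eq_mul]

theorem isProbabilityMeasure_signLaw {p : ℝ} (h0 : 0 ≤ p) (h1 : p ≤ 1) :
    IsProbabilityMeasure (signLaw p) := by
  constructor
  simp only [signLaw, Measure.add_apply, Measure.smul_apply, measure_univ, smul_eq_mul, mul_one]
  rw [← ENNReal.ofReal_add h0 (sub_nonneg.2 h1)]
  simp

theorem ae_signLaw (p : ℝ) : ∀ᵐ σ ∂signLaw p, σ = 1 ∨ σ = -1 := by
  rw [signLaw, ae_add_measure_iff]
  constructor <;> refine Measure.ae_smul_measure ?_ _ <;> rw [ae_dirac_eq] <;> simp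

/-- The scaled chain converges continuously along its first `t` steps. -/
def ConvergesAlong {S : Type*} (p : ℝ) (Ψ : ℝ → S → ℝ) (φ : S → ℝ → ℝ) (t : ℕ) (e : ℕ → S) :
    Prop :=
  ∀ k ≤ t, ∀ u, u ≠ 0 → 0 < signProb p (Real.sign u) →
    Tendsto (fun q : ℝ × ℝ => q.1⁻¹ * chainPath Ψ (q.1 * q.2) e k) (atTop ×ˢ 𝓝 u)
      (𝓝 (chainPath (tailStep φ) u e k))

/-- The tail chain built from the innovations, with the sign of the initial value as an additional
coordinate. -/
def innovChain {Ω S : Type*} (φ : S → ℝ → ℝ) (ε : ℕ → Ω → S) (k : ℕ) (q : ℝ × Ω) : ℝ :=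
  chainPath (tailStep φ) q.1 (fun n => ε n q.2) k

theorem measurable_innovChain {Ω S : Type*} [MeasurableSpace Ω] [MeasurableSpace S]
    {φ : S → ℝ → ℝ} (hφ : ∀ σ, Measurable fun v => φ v σ) {ε : ℕ → Ω → S}
    (hε : ∀ n, Measurable (ε n)) (k : ℕ) : Measurable (innovChain φ ε k) :=
  (measurable_chainPath (measurable_tailStep hφ) k).comp
    (measurable_fst.prodMk (measurable_pi_lambda _ fun n => (hε n).comp measurable_snd))

/-- Integrability for functions on a product with `powMeasure α` that vanish for small radius. -/
theorem integrable_polar {Θ : Type*} [MeasurableSpace Θ] {α : ℝ} (hα : 0 < α) (Q : Measure Θ)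
    [IsFiniteMeasure Q] {G : ℝ × Θ → ℝ} (hG : Measurable G) {C η : ℝ} (hη : 0 < η)
    (hC : ∀ q, |G q| ≤ C) (h0 : ∀ᵐ q ∂(powMeasure α).prod Q, q.1 ≤ η → G q = 0) :
    Integrable G ((powMeasure α).prod Q) := by
  have hfin : (powMeasure α).prod Q (Set.Ioi η ×ˢ Set.univ) ≠ ⊤ := by
    rw [Measure.prod_prod, powMeasure_Ioi hα hη]
    exact ENNReal.mul_ne_top ENNReal.ofReal_ne_top (measure_ne_top _ _)
  have h1 : IntegrableOn G (Set.Ioi η ×ˢ Set.univ) ((powMeasure α).prod Q) :=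
    IntegrableOn.of_bound hfin.lt_top hG.aestronglyMeasurable C
      (Eventually.of_forall fun q => hC q)
  have h2 : G =ᵐ[(powMeasure α).prod Q] (Set.Ioi η ×ˢ Set.univ).indicator G := by
    filter_upwards [h0] with q hq
    by_cases h : q ∈ Set.Ioi η ×ˢ (Set.univ : Set Θ)
    · rw [Set.indicator_of_mem h]
    · rw [Set.indicator_of_notMem h]
      exact hq (not_lt.1 fun hlt => h ⟨hlt, Set.mem_univ _⟩)
  exact (integrable_congr h2).2
    ((integrable_indicator_iff (measurableSet_Ioi.prod MeasurableSet.univ)).2 h1)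

theorem exists_abs_le_of_continuous {d : ℕ} {F : (Fin d → EReal) → ℝ} (hF : Continuous F) :
    ∃ C, ∀ x, |F x| ≤ C := by
  obtain ⟨C, hC⟩ := (isCompact_range hF.abs).bddAbove
  exact ⟨C, fun x => hC ⟨x, rfl⟩⟩

/-- Independence of `X 0` from the innovations and Fubini, with the innovations in the outer
integral, so that regular variation of `X 0` can be applied along each fixed innovation path. -/
theorem IsStationaryChain.integral_comp_eq {Ω S : Type*} [MeasurableSpace Ω] [MeasurableSpace S]
    {P : Measure Ω} [IsProbabilityMeasure P] {Ψ : ℝ → S → ℝ} {ε : ℕ → Ω → S} {X : ℕ → Ω → ℝ}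
    (hX : IsStationaryChain P Ψ ε X) {f : ℝ × (ℕ → S) → ℝ} (hf : Measurable f) {C : ℝ}
    (hC : ∀ q, |f q| ≤ C) :
    ∫ ω, f (X 0 ω, fun n => ε n ω) ∂P = ∫ ω', ∫ ω, f (X 0 ω, fun n => ε n ω') ∂P ∂P := by
  have hε : Measurable fun ω n => ε n ω := measurable_pi_lambda _ hX.measurable_innov
  have h1 := (indepFun_iff_map_prod_eq_prod_map_map hX.measurable_init.aemeasurable
    hε.aemeasurable).1 hX.indep_init
  rw [← integral_map (φ := fun ω => (X 0 ω, fun n => ε n ω)) (f := f)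
    (hX.measurable_init.prodMk hε).aemeasurable hf.aestronglyMeasurable, h1,
    Measure.map_prod_map _ _ hX.measurable_init hε,
    integral_map (hX.measurable_init.prodMap hε).aemeasurable hf.aestronglyMeasurable,
    integral_prod_symm]
  · rfl
  · exact Integrable.of_bound (hf.comp (hX.measurable_init.prodMap hε)).aestronglyMeasurable C
      (Eventually.of_forall fun q => hC _)

/-! ### Scaled limits for functions supported away from a zero initial value -/

section Forward

variable {Ω S : Type*} [MeasurableSpace Ω] [MeasurableSpace S]
  {P : Measure Ω} [IsProbabilityMeasure P] {Ψ : ℝ → S → ℝ} {ε : ℕ → Ω → S} {X : ℕ → Ω → ℝ}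
  {φ : S → ℝ → ℝ} {α p : ℝ}

/-- For frozen innovations the integrand is a function of `X 0 / x` alone. It vanishes near `0` and
converges continuously by `hconv`, so the inner expectation converges by regular variation;
dominated convergence then integrates over the innovations. -/
theorem tendsto_integral_scaled (hX : IsStationaryChain P Ψ ε X)
    (hRV : HasRegVarTails P (X 0) α p) (hφ : ∀ σ, Measurable fun v => φ v σ) {t : ℕ}
    (hconv : ∀ᵐ ω ∂P, ConvergesAlong p Ψ φ t fun n => ε n ω)
    {F : (Fin (t + 1) → EReal) → ℝ} (hF : Continuous F) {η : ℝ} (hη : 0 < η)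
    (hF0 : ∀ x, esize (x 0) ≤ η → F x = 0) :
    Tendsto (fun x => (P.real {ω | x < |X 0 ω|})⁻¹ *
        ∫ ω, F (coeVec fun i => x⁻¹ * X i ω) ∂P) atTop
      (𝓝 (∫ y, F (coeVec y) ∂polarLaw α ((signLaw p).prod P) fun i : Fin (t + 1) =>
        innovChain φ ε i)) := by
  have hps := isProbabilityMeasure_signLaw hRV.balance_nonneg hRV.balance_le_one
  obtain ⟨C, hC⟩ := exists_abs_le_of_continuous hF
  have hC0 : 0 ≤ C := (abs_nonneg _).trans (hC 0)
  set b : ℝ → ℝ := fun x => P.real {ω | x < |X 0 ω|}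
  have hb : ∀ x, 0 < b x := hRV.tail_pos
  set e : Ω → ℕ → S := fun ω n => ε n ω
  have he : Measurable e := measurable_pi_lambda _ hX.measurable_innov
  set G : Ω → ℝ → ℝ → ℝ := fun ω x u => F (coeVec fun i => x⁻¹ * chainPath Ψ (x * u) (e ω) i)
  set G' : Ω → ℝ → ℝ := fun ω u => F (coeVec fun i => chainPath (tailStep φ) u (e ω) i)
  have hFm : Measurable fun y : Fin (t + 1) → ℝ => F (coeVec y) :=
    (hF.comp continuous_coeVec).measurable
  have hGm : ∀ x, Measurable fun q : Ω × ℝ => G q.1 x q.2 := fun x => by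
    refine hFm.comp (measurable_pi_lambda _ fun i => Measurable.const_mul ?_ _)
    exact (measurable_chainPath hX.measurable_update i).comp
      ((measurable_snd.const_mul x).prodMk (he.comp measurable_fst))
  have hG'm : Measurable fun q : Ω × ℝ => G' q.1 q.2 := by
    refine hFm.comp (measurable_pi_lambda _ fun i => ?_)
    exact (measurable_chainPath (measurable_tailStep hφ) i).comp
      (measurable_snd.prodMk (he.comp measurable_fst))
  have hG0 : ∀ ω x u, |u| ≤ η → G ω x u = 0 := by
    intro ω x u hu
    refine hF0 _ ?_
    simp only [coeVec, Fin.val_zero, chainPath]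
    rw [esize_coe]
    refine (min_le_left _ _).trans (le_trans ?_ hu)
    rcases eq_or_ne x 0 with h | h
    · simp [h]
    · rw [inv_mul_cancel_left₀ h]
  have hinner : ∀ᵐ ω ∂P, Tendsto (fun x => (b x)⁻¹ * ∫ ω', G ω x (x⁻¹ * X 0 ω') ∂P) atTop
      (𝓝 (p * ∫ z, G' ω z ∂powMeasure α + (1 - p) * ∫ z, G' ω (-z) ∂powMeasure α)) := by
    filter_upwards [hconv] with ω hω
    refine hRV.tendsto_integral hX.measurable_init hη
      (fun x => (hGm x).comp (measurable_const.prodMk measurable_id))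
      (hG'm.comp (measurable_const.prodMk measurable_id)) (fun x u => hC _) (hG0 ω) ?_
    intro u hu hpu
    refine (hF.tendsto _).comp (tendsto_pi_nhds.2 fun i => ?_)
    exact (continuous_coe_real_ereal.tendsto _).comp (hω i (Nat.lt_succ_iff.1 i.2) u hu hpu)
  have houter : Tendsto (fun x => ∫ ω, (b x)⁻¹ * ∫ ω', G ω x (x⁻¹ * X 0 ω') ∂P ∂P) atTop
      (𝓝 (∫ ω, (p * ∫ z, G' ω z ∂powMeasure α + (1 - p) * ∫ z, G' ω (-z) ∂powMeasure α) ∂P)) := by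
    refine tendsto_integral_filter_of_dominated_convergence (fun _ => C * (η ^ (-α) + 1)) ?_ ?_
      (integrable_const _) hinner
    · refine Eventually.of_forall fun x => AEStronglyMeasurable.const_mul ?_ _
      refine AEStronglyMeasurable.integral_prod_right'
        (f := fun q : Ω × Ω => G q.1 x (x⁻¹ * X 0 q.2)) ?_
      exact ((hGm x).comp (measurable_fst.prodMk
        ((hX.measurable_init.comp measurable_snd).const_mul _))).aestronglyMeasurable
    · filter_upwards [(hRV.regVar η hη).eventually (gt_mem_nhds (lt_add_one _)),
        eventually_gt_atTop 0] with x hx hx0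
      refine Eventually.of_forall fun ω => ?_
      -- The integrand vanishes unless `|X 0| > x η`, so regular variation at `η` gives a bound that
      -- is uniform over the innovations.
      have hbd : ‖∫ ω', G ω x (x⁻¹ * X 0 ω') ∂P‖ ≤ C * P.real {ω' | x * η < |X 0 ω'|} := by
        have hs : MeasurableSet {ω' | x * η < |X 0 ω'|} :=
          measurableSet_lt measurable_const hX.measurable_init.abs
        rw [← setIntegral_eq_integral_of_forall_compl_eq_zero (s := {ω' | x * η < |X 0 ω'|})]
        · exact norm_setIntegral_le_of_norm_le_const (measure_lt_top _ _) fun _ _ => hC _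
        · intro ω' hω'
          refine hG0 _ _ _ ?_
          rw [abs_mul, abs_inv, abs_of_pos hx0, inv_mul_le_iff₀ hx0]
          exact not_lt.1 hω'
      rw [norm_mul, norm_inv, Real.norm_of_nonneg (hb x).le, inv_mul_le_iff₀ (hb x)]
      refine hbd.trans ?_
      rw [div_lt_iff₀ (hb x)] at hx
      calc C * P.real {ω' | x * η < |X 0 ω'|} ≤ C * ((η ^ (-α) + 1) * b x) :=
            mul_le_mul_of_nonneg_left hx.le hC0
        _ = b x * (C * (η ^ (-α) + 1)) := by ring
  have hval : ∫ ω, (p * ∫ z, G' ω z ∂powMeasure α + (1 - p) * ∫ z, G' ω (-z) ∂powMeasure α) ∂P =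
      ∫ y, F (coeVec y) ∂polarLaw α ((signLaw p).prod P) fun i : Fin (t + 1) =>
        innovChain φ ε i := by
    have hNm : Measurable fun (q : ℝ × (ℝ × Ω)) (i : Fin (t + 1)) =>
        q.1 * innovChain φ ε i q.2 := measurable_pi_lambda _ fun i => measurable_fst.mul
      ((measurable_innovChain hφ hX.measurable_innov i).comp measurable_snd)
    have hK0 : ∀ᵐ q : ℝ × (ℝ × Ω) ∂(powMeasure α).prod ((signLaw p).prod P),
        0 < q.1 ∧ (q.2.1 = 1 ∨ q.2.1 = -1) := by
      have h1 : ∀ᵐ q ∂(signLaw p).prod P, q.1 = 1 ∨ q.1 = -1 :=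
        Measure.quasiMeasurePreserving_fst.ae (ae_signLaw p)
      exact (Measure.quasiMeasurePreserving_fst.ae (ae_powMeasure_pos α)).and
        (Measure.quasiMeasurePreserving_snd.ae h1)
    have hzero : ∀ z : ℝ, z ≤ η → 0 < z → ∀ σ : ℝ, (σ = 1 ∨ σ = -1) → ∀ ω,
        F (coeVec fun i : Fin (t + 1) => z * innovChain φ ε i (σ, ω)) = 0 := by
      intro z hz hz0 σ hσ ω
      refine hF0 _ ?_
      simp only [coeVec, Fin.val_zero, innovChain, chainPath]
      rw [esize_coe]
      refine (min_le_left _ _).trans ?_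
      rw [abs_mul, abs_of_pos hz0]
      rcases hσ with h | h <;> simpa [h] using hz
    have hint : Integrable (fun q : ℝ × (ℝ × Ω) =>
        F (coeVec fun i : Fin (t + 1) => q.1 * innovChain φ ε i q.2))
        ((powMeasure α).prod ((signLaw p).prod P)) := by
      refine integrable_polar hRV.index_pos _ (hFm.comp hNm) hη (fun q => hC _) ?_
      filter_upwards [hK0] with q hq hle
      exact hzero q.1 hle hq.1 q.2.1 hq.2 q.2.2
    rw [polarLaw, integral_map hNm.aemeasurable hFm.aestronglyMeasurable,
      integral_prod_symm _ hint, integral_prod _ hint.integral_prod_right,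
      integral_signLaw hRV.balance_nonneg hRV.balance_le_one]
    -- Homogeneity of the tail recursion moves the radius into the starting value: `z` times the
    -- path from `σ` is the path from `z σ`.
    have hhom : ∀ ω, ∀ σ : ℝ, ∫ z, F (coeVec fun i : Fin (t + 1) =>
        z * innovChain φ ε i (σ, ω)) ∂powMeasure α = ∫ z, G' ω (z * σ) ∂powMeasure α := by
      intro ω σ
      refine integral_congr_ae ?_
      filter_upwards [ae_powMeasure_pos α] with z hz
      simp only [G', innovChain, chainPath_tailStep_mul φ hz]
      rfl
    simp only [hhom, mul_one, mul_neg]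
    have hint' : ∀ σ : ℝ, (σ = 1 ∨ σ = -1) →
        Integrable (fun ω => ∫ z, G' ω (z * σ) ∂powMeasure α) P := by
      intro σ hσ
      have : Integrable (fun q : ℝ × Ω =>
          F (coeVec fun i : Fin (t + 1) => q.1 * innovChain φ ε i (σ, q.2)))
          ((powMeasure α).prod P) := by
        refine integrable_polar hRV.index_pos _ (hFm.comp (hNm.comp
          (measurable_fst.prodMk (measurable_const.prodMk measurable_snd)))) hη (fun q => hC _) ?_
        filter_upwards [Measure.quasiMeasurePreserving_fst.ae (ae_powMeasure_pos α)] with q hq hle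
        exact hzero q.1 hle hq σ hσ q.2
      refine this.integral_prod_right.congr (Eventually.of_forall fun ω => hhom ω σ)
    have i1 := hint' 1 (Or.inl rfl)
    have i2 := hint' (-1) (Or.inr rfl)
    simp only [mul_one, mul_neg] at i1 i2
    rw [integral_add (i1.const_mul p) (i2.const_mul (1 - p)), integral_const_mul,
      integral_const_mul]
  rw [← hval]
  refine houter.congr' ?_
  filter_upwards [eventually_gt_atTop 0] with x hx
  rw [integral_const_mul]
  congr 1
  have hf : Measurable fun q : ℝ × (ℕ → S) =>
      F (coeVec fun i : Fin (t + 1) => x⁻¹ * chainPath Ψ q.1 q.2 i) :=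
    hFm.comp (measurable_pi_lambda _ fun i =>
      (measurable_chainPath hX.measurable_update i).const_mul _)
  have := hX.integral_comp_eq hf (fun q => hC _)
  simp only [← hX.eq_chainPath] at this
  rw [this]
  simp only [G, mul_inv_cancel_left₀ hx.ne']
  rfl

end Forward

/-! ### A measurable version of the limit function -/

theorem sign_eq_self {σ : ℝ} (h : σ = 1 ∨ σ = -1) : Real.sign σ = σ := by
  rcases h with h | h
  · rw [h, Real.sign_one]
  · rw [h, Real.sign_of_neg (by norm_num)]

theorem ae_signLaw_pos (p : ℝ) :
    ∀ᵐ σ ∂signLaw p, (σ = 1 ∨ σ = -1) ∧ 0 < signProb p σ := by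
  rw [signLaw, ae_add_measure_iff]
  constructor
  · rcases le_or_gt p 0 with h | h
    · simp [ENNReal.ofReal_of_nonpos h]
    · refine Measure.ae_smul_measure ?_ _
      rw [ae_dirac_eq]
      exact ⟨Or.inl rfl, by rwa [signProb_one]⟩
  · rcases le_or_gt (1 - p) 0 with h | h
    · simp [ENNReal.ofReal_of_nonpos h]
    · refine Measure.ae_smul_measure ?_ _
      rw [ae_dirac_eq]
      exact ⟨Or.inr rfl, by rwa [signProb_neg_one]⟩

section Modification

variable {Ω S : Type*} [MeasurableSpace Ω] [MeasurableSpace S]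
  {P : Measure Ω} [IsProbabilityMeasure P] {Ψ : ℝ → S → ℝ} {φ : S → ℝ → ℝ} {p : ℝ}

theorem ae_mem_of_prob_eq_one {e : Ω → S} (he : Measurable e) {V : Set S} (hV : MeasurableSet V)
    (h : P {ω | e ω ∈ V} = 1) : ∀ᵐ v ∂P.map e, v ∈ V := by
  refine (ae_map_iff he.aemeasurable hV).2 ?_
  exact (mem_ae_iff_prob_eq_one (he hV)).2 h

theorem prob_eq_one_of_ae_mem {e : Ω → S} (he : Measurable e) {V : Set S} (hV : MeasurableSet V)
    (h : ∀ᵐ v ∂P.map e, v ∈ V) : P {ω | e ω ∈ V} = 1 :=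
  (mem_ae_iff_prob_eq_one (he hV)).1 ((ae_map_iff he.aemeasurable hV).1 h)

/-- The limit function in `AsympLinear` may be taken to be measurable. -/
theorem AsympLinear.exists_measurable {e : Ω → S} (he : Measurable e)
    (hΨ : Measurable (Function.uncurry Ψ)) (h : AsympLinear P Ψ e p φ) :
    ∃ φ' : S → ℝ → ℝ, (∀ σ, Measurable fun v => φ' v σ) ∧ AsympLinear P Ψ e p φ' ∧
      tailStepLaw p (P.map e) φ = tailStepLaw p (P.map e) φ' := by
  classical
  obtain ⟨V, hV, hPV, hlim, hW⟩ := h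
  have hVae := ae_mem_of_prob_eq_one he hV hPV
  have haem : ∀ σ : ℝ, (σ = 1 ∨ σ = -1) ∧ 0 < signProb p σ →
      AEMeasurable (fun v => φ v σ) (P.map e) := by
    intro σ hσ
    refine aemeasurable_of_tendsto_metrizable_ae (atTop : Filter ℝ)
      (f := fun x v => (σ * x)⁻¹ * Ψ (σ * x) v) (fun x => ?_) ?_
    · exact (Measurable.const_mul (hΨ.comp (measurable_const.prodMk measurable_id)) _).aemeasurable
    · filter_upwards [hVae] with v hv
      exact hlim σ hσ.1 hσ.2 v hv
  -- As an almost sure limit of measurable functions, `φ` has a measurable version at signs of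
  -- positive probability; elsewhere it is unconstrained and is replaced by `0`.
  set φ' : S → ℝ → ℝ := fun v σ =>
    if h : (σ = 1 ∨ σ = -1) ∧ 0 < signProb p σ then (haem σ h).mk _ v else 0 with hφ'
  have hφ'm : ∀ σ, Measurable fun v => φ' v σ := by
    intro σ
    by_cases h : (σ = 1 ∨ σ = -1) ∧ 0 < signProb p σ
    · simp only [hφ', dif_pos h]
      exact (haem σ h).measurable_mk
    · simp only [hφ', dif_neg h]
      exact measurable_const
  have heq : ∀ σ : ℝ, (σ = 1 ∨ σ = -1) ∧ 0 < signProb p σ → ∀ᵐ v ∂P.map e, φ v σ = φ' v σ := by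
    intro σ h
    filter_upwards [(haem σ h).ae_eq_mk] with v hv
    simp only [hφ', dif_pos h]
    exact hv
  have hall : ∀ᵐ v ∂P.map e, v ∈ V ∧
      ∀ σ : ℝ, (σ = 1 ∨ σ = -1) → 0 < signProb p σ → φ v σ = φ' v σ := by
    have h1 : ∀ᵐ v ∂P.map e, 0 < signProb p 1 → φ v 1 = φ' v 1 := by
      by_cases h : 0 < signProb p 1
      · filter_upwards [heq 1 ⟨Or.inl rfl, h⟩] with v hv _ using hv
      · exact Eventually.of_forall fun v hv => absurd hv h
    have h2 : ∀ᵐ v ∂P.map e, 0 < signProb p (-1) → φ v (-1) = φ' v (-1) := by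
      by_cases h : 0 < signProb p (-1)
      · filter_upwards [heq (-1) ⟨Or.inr rfl, h⟩] with v hv _ using hv
      · exact Eventually.of_forall fun v hv => absurd hv h
    filter_upwards [hVae, h1, h2] with v hv h1 h2
    refine ⟨hv, ?_⟩
    rintro σ (rfl | rfl)
    exacts [h1, h2]
  -- Asymptotic linearity is a pointwise statement on a measurable set, so almost sure equality has
  -- to become equality off a measurable null set.
  obtain ⟨U, hUsub, hU, hUnull⟩ := exists_measurable_superset_of_null hall
  have hUae : ∀ᵐ v ∂P.map e, v ∈ Uᶜ := by
    rw [ae_iff]; simpa using hUnull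
  have hUgood : ∀ v ∈ Uᶜ, v ∈ V ∧
      ∀ σ : ℝ, (σ = 1 ∨ σ = -1) → 0 < signProb p σ → φ v σ = φ' v σ := by
    intro v hv
    by_contra hn
    exact hv (hUsub hn)
  refine ⟨φ', hφ'm, ⟨Uᶜ, hU.compl, prob_eq_one_of_ae_mem he hU.compl hUae, ?_, ?_⟩, ?_⟩
  · intro σ hσ hp v hv
    rw [← (hUgood v hv).2 σ hσ hp]
    exact hlim σ hσ hp v (hUgood v hv).1
  · rintro ⟨σ, hσ, hp, hpos⟩
    have hcongr : P {ω | φ (e ω) σ = 0} = P {ω | φ' (e ω) σ = 0} := by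
      refine measure_congr ?_
      filter_upwards [(ae_map_iff he.aemeasurable hU.compl).1 hUae] with ω hω
      change (φ (e ω) σ = 0) = (φ' (e ω) σ = 0)
      rw [(hUgood _ hω).2 σ hσ hp]
    obtain ⟨W, hWm, hWV, hWP, hWb⟩ := hW ⟨σ, hσ, hp, by rwa [hcongr]⟩
    refine ⟨W ∩ Uᶜ, hWm.inter hU.compl, Set.inter_subset_right,
      prob_eq_one_of_ae_mem he (hWm.inter hU.compl) ?_, fun v hv => hWb v hv.1⟩
    filter_upwards [ae_mem_of_prob_eq_one he hWm hWP, hUae] with v h1 h2 using ⟨h1, h2⟩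
  · refine Measure.map_congr ?_
    filter_upwards [Measure.quasiMeasurePreserving_fst.ae (ae_signLaw_pos p),
      Measure.quasiMeasurePreserving_snd.ae hUae] with q h1 h2
    rw [sign_eq_self h1.1, (hUgood _ h2).2 _ h1.1 h1.2]

end Modification

/-! ### Pathwise convergence of the scaled recursion -/

section Pathwise

variable {S : Type*} {Ψ : ℝ → S → ℝ} {φ : S → ℝ → ℝ} {p : ℝ}

theorem sign_eq_one_or {u : ℝ} (hu : u ≠ 0) : Real.sign u = 1 ∨ Real.sign u = -1 := by
  rcases hu.lt_or_gt with h | h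
  · exact Or.inr (Real.sign_of_neg h)
  · exact Or.inl (Real.sign_of_pos h)

theorem sign_mul_self_eq_abs (u : ℝ) : Real.sign u * u = |u| := by
  rcases lt_trichotomy u 0 with h | h | h
  · rw [Real.sign_of_neg h, abs_of_neg h]; ring
  · simp [h]
  · rw [Real.sign_of_pos h, abs_of_pos h]; ring

/-- Write `Ψ(y)/x = (y/x) · (Ψ(y)/y)`. As `u ≠ 0`, `y` diverges in the direction of `sign u`, so the
second factor tends to `φ(v, sign u)`. -/
theorem tendsto_step_of_ne_zero {v : S}
    (hlim : ∀ σ : ℝ, (σ = 1 ∨ σ = -1) → 0 < signProb p σ →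
      Tendsto (fun x : ℝ => (σ * x)⁻¹ * Ψ (σ * x) v) atTop (𝓝 (φ v σ)))
    {ι : Type*} {l : Filter ι} {x y : ι → ℝ} {u : ℝ} (hx : Tendsto x l atTop)
    (hy : Tendsto (fun i => (x i)⁻¹ * y i) l (𝓝 u)) (hu : u ≠ 0)
    (hpu : 0 < signProb p (Real.sign u)) :
    Tendsto (fun i => (x i)⁻¹ * Ψ (y i) v) l (𝓝 (tailStep φ u v)) := by
  set σ := Real.sign u with hσ
  have hσ1 : σ = 1 ∨ σ = -1 := sign_eq_one_or hu
  have hσσ : σ * σ = 1 := by rcases hσ1 with h | h <;> rw [h] <;> norm_num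
  have h1 : Tendsto (fun i => σ * y i) l atTop := by
    have h2 : Tendsto (fun i => σ * ((x i)⁻¹ * y i)) l (𝓝 |u|) := by
      rw [← sign_mul_self_eq_abs u]
      exact hy.const_mul σ
    refine (hx.atTop_mul_pos (abs_pos.2 hu) h2).congr' ?_
    filter_upwards [hx.eventually_gt_atTop 0] with i hi
    field_simp
  have h3 := (hlim σ hσ1 hpu).comp h1
  refine (hy.mul h3).congr' ?_
  filter_upwards [h1.eventually_gt_atTop 0] with i hi
  have hy0 : y i ≠ 0 := by
    rintro h
    rw [h, mul_zero] at hi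
    exact lt_irrefl _ hi
  simp only [Function.comp]
  rw [← mul_assoc σ, hσσ, one_mul]
  field_simp

/-- When `y/x → 0`, the sign of `y` is not controlled and `y` need not diverge, so the limits of
`Ψ(y)/y` are of no use. The linear bound on `sup |Ψ|` over `|y| ≤ δ x` replaces them, with `δ = r /
(|C| + 1)`. -/
theorem tendsto_step_zero {v : S}
    (hbd : ∃ C x₀ : ℝ, ∀ x : ℝ, x₀ ≤ x → ∀ y : ℝ, |y| ≤ x → |Ψ y v| ≤ C * x)
    {ι : Type*} {l : Filter ι} {x y : ι → ℝ} (hx : Tendsto x l atTop)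
    (hy : Tendsto (fun i => (x i)⁻¹ * y i) l (𝓝 0)) :
    Tendsto (fun i => (x i)⁻¹ * Ψ (y i) v) l (𝓝 0) := by
  obtain ⟨C, x₀, h⟩ := hbd
  rw [Metric.tendsto_nhds]
  intro r hr
  have hδ : 0 < r / (|C| + 1) := by positivity
  filter_upwards [(hx.const_mul_atTop hδ).eventually_ge_atTop x₀, hx.eventually_gt_atTop 0,
    (Metric.tendsto_nhds.1 hy) _ hδ] with i h1 h2 h3
  rw [Real.dist_eq, sub_zero, abs_mul, abs_inv, abs_of_pos h2] at h3 ⊢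
  rw [inv_mul_lt_iff₀ h2] at h3 ⊢
  rw [mul_comm (x i)] at h3
  refine (h _ h1 _ h3.le).trans_lt ?_
  have h4 : C * (r / (|C| + 1) * x i) ≤ |C| * (r / (|C| + 1) * x i) :=
    mul_le_mul_of_nonneg_right (le_abs_self C) (by positivity)
  refine h4.trans_lt ?_
  have h5 : |C| * (r / (|C| + 1) * x i) = (|C| / (|C| + 1)) * (x i * r) := by ring
  rw [h5]
  have h6 : |C| / (|C| + 1) < 1 := by
    rw [div_lt_one (by positivity)]
    linarith
  have h7 : 0 < x i * r := by positivity
  nlinarith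

theorem convergesAlong_one {e : ℕ → S}
    (hlim : ∀ σ : ℝ, (σ = 1 ∨ σ = -1) → 0 < signProb p σ →
      Tendsto (fun x : ℝ => (σ * x)⁻¹ * Ψ (σ * x) (e 0)) atTop (𝓝 (φ (e 0) σ))) :
    ConvergesAlong p Ψ φ 1 e := by
  intro k hk u hu hpu
  have h0 : Tendsto (fun q : ℝ × ℝ => q.1⁻¹ * (q.1 * q.2)) (atTop ×ˢ 𝓝 u) (𝓝 u) := by
    refine tendsto_snd.congr' ?_
    filter_upwards [tendsto_fst.eventually (eventually_gt_atTop (0 : ℝ))] with q hq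
    rw [inv_mul_cancel_left₀ hq.ne']
  interval_cases k
  · exact h0
  · exact tendsto_step_of_ne_zero hlim tendsto_fst h0 hu hpu

theorem tailStep_eq_abs_mul (φ : S → ℝ → ℝ) {u : ℝ} (hu : u ≠ 0) (v : S) :
    tailStep φ u v = |u| * tailStep φ (Real.sign u) v := by
  rw [← tailStep_mul φ (abs_pos.2 hu)]
  congr 1
  rcases hu.lt_or_gt with h | h
  · rw [Real.sign_of_neg h, abs_of_neg h]; ring
  · rw [Real.sign_of_pos h, abs_of_pos h]; ring

/-- Induction with a dichotomy: either the limit is nonzero with a sign of positive probability, so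
that asymptotic linearity drives the next step, or it is zero and the linear bound keeps it at zero.
The alternative in `hzero` says that either this bound is available or zero is never reached. -/
theorem convergesAlong_of_good {e : ℕ → S}
    (hlim : ∀ n, ∀ σ : ℝ, (σ = 1 ∨ σ = -1) → 0 < signProb p σ →
      Tendsto (fun x : ℝ => (σ * x)⁻¹ * Ψ (σ * x) (e n)) atTop (𝓝 (φ (e n) σ)))
    (hsign : ∀ n, ∀ σ : ℝ, (σ = 1 ∨ σ = -1) → 0 < signProb p σ → tailStep φ σ (e n) ≠ 0 →
      0 < signProb p (Real.sign (tailStep φ σ (e n))))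
    (hzero : (∀ n, ∃ C x₀ : ℝ, ∀ x : ℝ, x₀ ≤ x → ∀ y : ℝ, |y| ≤ x → |Ψ y (e n)| ≤ C * x) ∨
      ∀ n, ∀ σ : ℝ, (σ = 1 ∨ σ = -1) → 0 < signProb p σ → tailStep φ σ (e n) ≠ 0) (t : ℕ) :
    ConvergesAlong p Ψ φ t e := by
  intro k hk u hu hpu
  clear hk
  suffices h : Tendsto (fun q : ℝ × ℝ => q.1⁻¹ * chainPath Ψ (q.1 * q.2) e k) (atTop ×ˢ 𝓝 u)
      (𝓝 (chainPath (tailStep φ) u e k)) ∧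
      ((chainPath (tailStep φ) u e k ≠ 0 ∧
        0 < signProb p (Real.sign (chainPath (tailStep φ) u e k))) ∨
      (chainPath (tailStep φ) u e k = 0 ∧
        ∀ n, ∃ C x₀ : ℝ, ∀ x : ℝ, x₀ ≤ x → ∀ y : ℝ, |y| ≤ x → |Ψ y (e n)| ≤ C * x)) from h.1
  induction k with
  | zero =>
    refine ⟨?_, Or.inl ⟨hu, hpu⟩⟩
    refine tendsto_snd.congr' ?_
    filter_upwards [tendsto_fst.eventually (eventually_gt_atTop (0 : ℝ))] with q hq
    simp only [chainPath]
    rw [inv_mul_cancel_left₀ hq.ne']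
  | succ k ih =>
    obtain ⟨ih1, ih2⟩ := ih
    set w := chainPath (tailStep φ) u e k with hw
    have hsucc : chainPath (tailStep φ) u e (k + 1) = tailStep φ w (e k) := rfl
    rw [hsucc]
    rcases ih2 with ⟨hw0, hpw⟩ | ⟨hw0, hb⟩
    · refine ⟨tendsto_step_of_ne_zero (hlim k) tendsto_fst ih1 hw0 hpw, ?_⟩
      have hσ := sign_eq_one_or hw0
      rw [tailStep_eq_abs_mul φ hw0, sign_mul_of_pos (abs_pos.2 hw0)]
      by_cases h0 : tailStep φ (Real.sign w) (e k) = 0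
      · right
        refine ⟨by rw [h0, mul_zero], ?_⟩
        rcases hzero with h | h
        · exact h
        · exact absurd h0 (h k _ hσ hpw)
      · exact Or.inl ⟨mul_ne_zero (abs_pos.2 hw0).ne' h0, hsign k _ hσ hpw h0⟩
    · rw [hw0] at ih1 ⊢
      rw [tailStep_zero]
      exact ⟨tendsto_step_zero (hb k) tendsto_fst ih1, Or.inr ⟨rfl, hb⟩⟩

end Pathwise

/-! ### The moment condition for the one-step law -/

theorem measurableSet_fst_eq (σ : ℝ) : MeasurableSet {q : ℝ × ℝ | q.1 = σ} :=
  measurable_fst (measurableSet_singleton σ)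

theorem posPow_of_nonpos {α : ℝ} (hα : 0 < α) {w : ℝ} (hw : w ≤ 0) : posPow α w = 0 := by
  rw [posPow, max_eq_right hw, Real.zero_rpow hα.ne', ENNReal.ofReal_zero]

theorem measurable_posPow (α : ℝ) : Measurable (posPow α) := by
  unfold posPow
  fun_prop

/-- The dictionary between polar measures and moments: integrated over a random `w`, the mass of `{z
w > a}` is `a^{-α} E[w_+^α]`. -/
theorem powMeasure_lt_mul {α : ℝ} (hα : 0 < α) {a : ℝ} (ha : 0 < a) (w : ℝ) :
    powMeasure α {z | a < z * w} = ENNReal.ofReal (a ^ (-α)) * posPow α w := by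
  rcases le_or_gt w 0 with hw | hw
  · rw [posPow_of_nonpos hα hw, mul_zero]
    refine measure_mono_null (fun z hz => ?_) (powMeasure_Iic α)
    by_contra! hlt
    have hlt : 0 < z := not_le.1 hlt
    have hz : a < z * w := hz
    nlinarith [mul_nonneg hlt.le (neg_nonneg.2 hw)]
  · have : {z | a < z * w} = Set.Ioi (a / w) := by
      ext z
      exact (div_lt_iff₀ hw).symm
    rw [this, powMeasure_Ioi hα (div_pos ha hw), posPow, max_eq_left hw.le,
      ← ENNReal.ofReal_mul (by positivity), Real.div_rpow ha.le hw.le, Real.rpow_neg hw.le,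
      div_inv_eq_mul]

theorem HasRegVarTails.tail_side {Ω : Type*} [MeasurableSpace Ω] {P : Measure Ω}
    [IsProbabilityMeasure P] {ξ : Ω → ℝ} {α p : ℝ} (h : HasRegVarTails P ξ α p)
    (hξ : Measurable ξ) {a : ℝ} (ha : 0 < a) {τ : ℝ} (hτ : τ = 1 ∨ τ = -1) :
    Tendsto (fun x => P.real {ω | x * a < τ * ξ ω} / P.real {ω | x < |ξ ω|}) atTop
      (𝓝 (signProb p τ * a ^ (-α))) := by
  rcases hτ with rfl | rfl
  · simpa only [one_mul, signProb_one] using h.tail_pos_side ha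
  · simpa only [neg_mul, one_mul, signProb_neg_one] using h.tail_neg_side hξ ha

theorem IsStationaryChain.identDistrib_one {Ω S : Type*} [MeasurableSpace Ω] [MeasurableSpace S]
    {P : Measure Ω} {Ψ : ℝ → S → ℝ} {ε : ℕ → Ω → S} {X : ℕ → Ω → ℝ}
    (hX : IsStationaryChain P Ψ ε X) : IdentDistrib (X 1) (X 0) P P := by
  have : X 1 = fun ω => Ψ (X 0 ω) (ε 0 ω) := funext fun ω => hX.recursion 0 ω
  rw [this]
  exact hX.stationary

theorem integrable_polarLaw {Ω' : Type*} [MeasurableSpace Ω'] {α : ℝ} (hα : 0 < α)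
    (Q : Measure Ω') [IsFiniteMeasure Q] {t : ℕ} {N : Fin (t + 1) → Ω' → ℝ}
    (hN : ∀ i, Measurable (N i)) (hN0 : ∀ᵐ ω ∂Q, |N 0 ω| = 1) {F : (Fin (t + 1) → EReal) → ℝ}
    (hF : Continuous F) {η : ℝ} (hη : 0 < η) (hF0 : ∀ x, esize (x 0) ≤ η → F x = 0) :
    Integrable (fun y => F (coeVec y)) (polarLaw α Q N) := by
  obtain ⟨C, hC⟩ := exists_abs_le_of_continuous hF
  have hFm : Measurable fun y : Fin (t + 1) → ℝ => F (coeVec y) :=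
    (hF.comp continuous_coeVec).measurable
  have hm : Measurable fun (q : ℝ × Ω') (i : Fin (t + 1)) => q.1 * N i q.2 :=
    measurable_pi_lambda _ fun i => measurable_fst.mul ((hN i).comp measurable_snd)
  rw [polarLaw, integrable_map_measure hFm.aestronglyMeasurable hm.aemeasurable]
  refine integrable_polar hα Q (hFm.comp hm) hη (fun q => hC _) ?_
  filter_upwards [Measure.quasiMeasurePreserving_fst.ae (ae_powMeasure_pos α),
    Measure.quasiMeasurePreserving_snd.ae hN0] with q h1 h2 hle
  refine hF0 _ ?_
  simp only [coeVec]
  rw [esize_coe, abs_mul, h2, mul_one, abs_of_pos h1]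
  exact (min_le_left _ _).trans hle

section Moment

variable {Ω S : Type*} [MeasurableSpace Ω] [MeasurableSpace S]
  {P : Measure Ω} [IsProbabilityMeasure P] {Ψ : ℝ → S → ℝ} {ε : ℕ → Ω → S} {X : ℕ → Ω → ℝ}
  {φ : S → ℝ → ℝ} {α p : ℝ}

theorem tailStepLaw_eq_map (hφ : ∀ σ, Measurable fun v => φ v σ) (hε : ∀ n, Measurable (ε n))
    (hp0 : 0 ≤ p) (hp1 : p ≤ 1) :
    tailStepLaw p (P.map (ε 0)) φ =
      ((signLaw p).prod P).map fun q => (innovChain φ ε 0 q, innovChain φ ε 1 q) := by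
  have hps := isProbabilityMeasure_signLaw hp0 hp1
  have h1 : (signLaw p).prod (P.map (ε 0)) = ((signLaw p).prod P).map (Prod.map id (ε 0)) := by
    rw [← Measure.map_prod_map _ _ measurable_id (hε 0), Measure.map_id]
  have hm : Measurable fun q : ℝ × S => (q.1, q.1 * φ q.2 (Real.sign q.1)) :=
    measurable_fst.prodMk (measurable_tailStep hφ)
  rw [tailStepLaw, h1, Measure.map_map hm (measurable_id.prodMap (hε 0))]
  rfl

theorem lt_mul_eclamp_coe {τ : ℝ} (hτ : τ = 1 ∨ τ = -1) {a : ℝ} (ha0 : 0 < a) (ha : a < 1)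
    (r : ℝ) : a < τ * eclamp (r : EReal) ↔ a < τ * r := by
  rw [eclamp_coe]
  rcases hτ with rfl | rfl
  · rw [one_mul, one_mul, lt_max_iff, lt_min_iff]
    constructor
    · rintro (h | h)
      · linarith
      · exact h.1
    · exact fun h => Or.inr ⟨h, ha⟩
  · rw [neg_one_mul, neg_one_mul, lt_neg, max_lt_iff, min_lt_iff, lt_neg (a := a)]
    constructor
    · rintro ⟨_, h | h⟩
      · exact h
      · linarith
    · exact fun h => ⟨by linarith, Or.inl h⟩

/-- Stationarity bounds the prelimit: `P(τ X_1 > x/2) = P(τ X_0 > x/2)`, whose normalized limit is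
known. The limit of scaled paths is only available for functions vanishing near `x_0 = 0`, hence an
approximation from below. The level `1/2` lies below the truncation level `1` of `eclamp`. -/
theorem polarLaw_tail_le (hX : IsStationaryChain P Ψ ε X)
    (hRV : HasRegVarTails P (X 0) α p) (hφ : ∀ σ, Measurable fun v => φ v σ)
    (hconv : ∀ᵐ ω ∂P, ConvergesAlong p Ψ φ 1 fun n => ε n ω) {τ : ℝ} (hτ : τ = 1 ∨ τ = -1) :
    polarLaw α ((signLaw p).prod P) (fun i : Fin (1 + 1) => innovChain φ ε i)
      {y | 1 / 2 < τ * y 1} ≤ ENNReal.ofReal (signProb p τ * (1 / 2) ^ (-α)) := by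
  have hps := isProbabilityMeasure_signLaw hRV.balance_nonneg hRV.balance_le_one
  set L := polarLaw α ((signLaw p).prod P) (fun i : Fin (1 + 1) => innovChain φ ε i) with hL
  have hNm : ∀ i : Fin (1 + 1), Measurable (innovChain φ ε i) := fun i =>
    measurable_innovChain hφ hX.measurable_innov i
  have hN0 : ∀ᵐ q ∂(signLaw p).prod P, |innovChain φ ε ((0 : Fin (1 + 1)) : ℕ) q| = 1 := by
    filter_upwards [Measure.quasiMeasurePreserving_fst.ae (ae_signLaw p)] with q hq
    rcases hq with h | h <;> simp [innovChain, chainPath, h]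
  set F : ℕ → (Fin (1 + 1) → EReal) → ℝ := fun n x =>
    min 1 (max 0 ((n + 1) * esize (x 0) - 1)) *
      min 1 (max 0 ((n + 1) * (τ * eclamp (x 1) - 1 / 2))) with hF
  have hFc : ∀ n, Continuous (F n) := by
    intro n
    have h1 := continuous_esize.comp (continuous_apply (0 : Fin (1 + 1)) (A := fun _ => EReal))
    have h2 := continuous_eclamp.comp (continuous_apply (1 : Fin (1 + 1)) (A := fun _ => EReal))
    simp only [Function.comp_def] at h1 h2
    simp only [hF]
    fun_prop
  have hF0 : ∀ n x, 0 ≤ F n x := fun n x => by simp only [hF]; positivity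
  have hFz : ∀ (n : ℕ) x, esize (x 0) ≤ 1 / ((n : ℝ) + 1) → F n x = 0 := by
    intro n x hx
    rw [le_div_iff₀ (by positivity)] at hx
    simp only [hF]
    rw [max_eq_left (by linarith)]
    simp
  have hint : ∀ n, Integrable (fun y => F n (coeVec y)) L := fun n =>
    integrable_polarLaw hRV.index_pos _ hNm hN0 (hFc n) (by positivity) (hFz n)
  have hFle : ∀ n, ∫ y, F n (coeVec y) ∂L ≤ signProb p τ * (1 / 2) ^ (-α) := by
    intro n
    have h1 := tendsto_integral_scaled hX hRV hφ hconv (hFc n) (by positivity) (hFz n)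
    have h2 := hRV.tail_side hX.measurable_init (by norm_num : (0 : ℝ) < 1 / 2) hτ
    refine le_of_tendsto_of_tendsto h1 h2 ?_
    filter_upwards [eventually_gt_atTop 0] with x hx
    rw [div_eq_inv_mul]
    refine mul_le_mul_of_nonneg_left ?_ (inv_nonneg.2 measureReal_nonneg)
    have h3 : P.real {ω | x * (1 / 2) < τ * X 0 ω} = P.real {ω | x * (1 / 2) < τ * X 1 ω} := by
      have := hX.identDistrib_one.measure_mem_eq (s := {r | x * (1 / 2) < τ * r})
        (measurableSet_lt measurable_const (measurable_const_mul _))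
      simp only [Measure.real]
      exact congrArg _ this.symm
    have hX1 : Measurable (X 1) := by
      have : X 1 = fun ω => Ψ (X 0 ω) (ε 0 ω) := funext fun ω => hX.recursion 0 ω
      rw [this]
      exact hX.measurable_update.comp (hX.measurable_init.prodMk (hX.measurable_innov 0))
    rw [h3, ← integral_indicator_one (measurableSet_lt measurable_const (hX1.const_mul τ))]
    refine integral_mono_of_nonneg (Eventually.of_forall fun ω => hF0 _ _) ?_ ?_
    · exact (integrable_const (1 : ℝ)).indicator (measurableSet_lt measurable_const (hX1.const_mul
      τ))
    · refine Eventually.of_forall fun ω => ?_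
      by_cases hω : x * (1 / 2) < τ * X 1 ω
      · rw [Set.indicator_of_mem (by exact hω)]
        simp only [hF, Pi.one_apply]
        exact mul_le_one₀ (min_le_left _ _) (by positivity) (min_le_left _ _)
      · rw [Set.indicator_of_notMem (by exact hω)]
        have h4 : ¬ 1 / 2 < τ * eclamp ((x⁻¹ * X 1 ω : ℝ) : EReal) := by
          rw [lt_mul_eclamp_coe hτ (by norm_num) (by norm_num), mul_left_comm, inv_mul_eq_div,
            lt_div_iff₀ hx]
          rwa [mul_comm]
        have h5 : ((n : ℝ) + 1) * (τ * eclamp ((x⁻¹ * X 1 ω : ℝ) : EReal) - 1 / 2) ≤ 0 :=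
          mul_nonpos_of_nonneg_of_nonpos (by positivity) (by linarith [not_lt.1 h4])
        simp only [hF, coeVec]
        change _ * min 1 (max 0 (((n : ℝ) + 1) *
          (τ * eclamp ((x⁻¹ * X 1 ω : ℝ) : EReal) - 1 / 2))) ≤ 0
        rw [max_eq_left h5]
        simp
  have hA : ∀ n, L {y | 1 ≤ F n (coeVec y)} ≤
      ENNReal.ofReal (signProb p τ * (1 / 2) ^ (-α)) := by
    intro n
    have h1 := mul_meas_ge_le_lintegral₀ (μ := L)
      (f := fun y => ENNReal.ofReal (F n (coeVec y)))
      ((hFc n).comp continuous_coeVec).measurable.ennreal_ofReal.aemeasurable 1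
    rw [one_mul, ← ofReal_integral_eq_lintegral_ofReal (hint n)
      (Eventually.of_forall fun y => hF0 _ _)] at h1
    refine le_trans (measure_mono fun y hy => ?_) (h1.trans (ENNReal.ofReal_le_ofReal (hFle n)))
    exact ENNReal.one_le_ofReal.2 hy
  have hmono : Monotone fun n : ℕ => {y : Fin (1 + 1) → ℝ | 1 ≤ F n (coeVec y)} := by
    intro m n hmn y hy
    refine le_trans (show 1 ≤ F m (coeVec y) from hy) ?_
    have hmn' : (m : ℝ) ≤ n := by exact_mod_cast hmn
    simp only [hF]
    have e0 := esize_nonneg (coeVec y 0)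
    refine mul_le_mul ?_ ?_ (by positivity) (by positivity)
    · refine min_le_min_left _ (max_le_max_left _ ?_)
      nlinarith
    · rcases le_or_gt (τ * eclamp (coeVec y 1) - 1 / 2) 0 with h | h
      · rw [max_eq_left (mul_nonpos_of_nonneg_of_nonpos (by positivity) h),
          min_eq_right zero_le_one]
        exact le_min zero_le_one (le_max_left _ _)
      · refine min_le_min_left _ (max_le_max_left _ ?_)
        nlinarith
  -- The union misses only `y 0 = 0`, which is null because the chain starts at `±1` and the radius
  -- is positive.
  have hU : L {y | 1 / 2 < τ * y 1} ≤ L (⋃ n : ℕ, {y : Fin (1 + 1) → ℝ | 1 ≤ F n (coeVec y)}) := by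
    have h0 : ∀ᵐ y ∂L, y 0 ≠ 0 := by
      have hm : Measurable fun (q : ℝ × (ℝ × Ω)) (i : Fin (1 + 1)) =>
        q.1 * innovChain φ ε i q.2 :=
        measurable_pi_lambda _ fun i => measurable_fst.mul ((hNm i).comp measurable_snd)
      have hs : MeasurableSet {y : Fin (1 + 1) → ℝ | y 0 ≠ 0} :=
        (measurableSet_eq_fun (measurable_pi_apply 0) measurable_const).compl
      rw [hL, polarLaw, ae_map_iff hm.aemeasurable hs]
      filter_upwards [Measure.quasiMeasurePreserving_fst.ae (ae_powMeasure_pos α),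
        Measure.quasiMeasurePreserving_snd.ae hN0] with q h1 h2
      refine mul_ne_zero h1.ne' fun h => ?_
      rw [h, abs_zero] at h2
      exact zero_ne_one h2
    refine measure_mono_ae ?_
    filter_upwards [h0] with y hy0 hy
    have hy1 : 1 / 2 < τ * eclamp (coeVec y 1) :=
      (lt_mul_eclamp_coe hτ (by norm_num) (by norm_num) _).2 hy
    have hy2 : 0 < esize (coeVec y 0) := esize_pos.2 (EReal.coe_ne_zero.2 hy0)
    obtain ⟨m, hm⟩ := exists_nat_gt (2 / esize (coeVec y 0))
    obtain ⟨n, hn⟩ := exists_nat_gt (1 / (τ * eclamp (coeVec y 1) - 1 / 2))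
    refine Set.mem_iUnion.2 ⟨max m n, ?_⟩
    change 1 ≤ F _ _
    rw [div_lt_iff₀ hy2] at hm
    rw [div_lt_iff₀ (by linarith)] at hn
    have hmm : (m : ℝ) ≤ (max m n : ℕ) := by exact_mod_cast le_max_left m n
    have hnn : (n : ℝ) ≤ (max m n : ℕ) := by exact_mod_cast le_max_right m n
    simp only [hF]
    rw [min_eq_left, min_eq_left, one_mul]
    · refine le_max_of_le_right ?_
      nlinarith
    · refine le_max_of_le_right ?_
      nlinarith
  refine hU.trans ?_
  exact le_of_tendsto' (tendsto_measure_iUnion_atTop hmono) hA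

/-- Integrating out the radius in `polarLaw_tail_le` turns its left side into `(1/2)^{-α}` times the
moment; the same factor stands on the right and cancels. -/
theorem tailStepLaw_mem (hX : IsStationaryChain P Ψ ε X)
    (hRV : HasRegVarTails P (X 0) α p) (hφ : ∀ σ, Measurable fun v => φ v σ)
    (hconv : ∀ᵐ ω ∂P, ConvergesAlong p Ψ φ 1 fun n => ε n ω) :
    MemClass p α (tailStepLaw p (P.map (ε 0)) φ) := by
  have hps := isProbabilityMeasure_signLaw hRV.balance_nonneg hRV.balance_le_one
  have hα := hRV.index_pos
  have hNm : ∀ k, Measurable (innovChain φ ε k) := fun k =>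
    measurable_innovChain hφ hX.measurable_innov k
  have hpair : Measurable fun q => (innovChain φ ε 0 q, innovChain φ ε 1 q) :=
    (hNm 0).prodMk (hNm 1)
  have heq := tailStepLaw_eq_map (P := P) hφ hX.measurable_innov hRV.balance_nonneg
    hRV.balance_le_one
  have hfst : ∀ σ : ℝ, (tailStepLaw p (P.map (ε 0)) φ) {q | q.1 = σ} = signLaw p {σ} := by
    intro σ
    rw [heq, Measure.map_apply hpair (measurableSet_fst_eq σ)]
    have : (fun q => (innovChain φ ε 0 q, innovChain φ ε 1 q)) ⁻¹' {q | q.1 = σ} =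
        ({σ} : Set ℝ) ×ˢ (Set.univ : Set Ω) := by
      ext q
      simp [innovChain, chainPath]
    rw [this, Measure.prod_prod, measure_univ, mul_one]
  have h1 : signLaw p {1} = ENNReal.ofReal p := by
    simp [signLaw, show (-1 : ℝ) ≠ 1 by norm_num]
  have h2 : signLaw p {-1} = ENNReal.ofReal (1 - p) := by
    simp [signLaw, show (1 : ℝ) ≠ -1 by norm_num]
  refine ⟨?_, by rw [hfst, h1], by rw [hfst, h2], ?_, ?_⟩
  · rw [heq]
    exact Measure.isProbabilityMeasure_map hpair.aemeasurable
  · have hs : MeasurableSet {q : ℝ × ℝ | q.1 = 1 ∨ q.1 = -1} :=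
      (measurableSet_fst_eq 1).union (measurableSet_fst_eq (-1))
    rw [heq, ae_map_iff hpair.aemeasurable hs]
    filter_upwards [Measure.quasiMeasurePreserving_fst.ae (ae_signLaw p)] with q hq using hq
  · intro τ hτ
    have hs : (tailStepLaw p (P.map (ε 0)) φ) {q | q.1 = τ} = ENNReal.ofReal (signProb p τ) := by
      rw [hfst]
      rcases hτ with rfl | rfl
      · rw [h1, signProb_one]
      · rw [h2, signProb_neg_one]
    have hle := polarLaw_tail_le hX hRV hφ hconv hτ
    have hm : Measurable fun (q : ℝ × (ℝ × Ω)) (i : Fin (1 + 1)) =>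
        q.1 * innovChain φ ε i q.2 :=
      measurable_pi_lambda _ fun i => measurable_fst.mul ((hNm i).comp measurable_snd)
    have hset : MeasurableSet {y : Fin (1 + 1) → ℝ | 1 / 2 < τ * y 1} :=
      have h1 : Measurable fun y : Fin (1 + 1) → ℝ => y 1 := measurable_pi_apply 1
      measurableSet_lt measurable_const (h1.const_mul τ)
    rw [polarLaw, Measure.map_apply hm hset, Measure.prod_apply_symm (hm hset)] at hle
    have hin : ∀ q : ℝ × Ω, powMeasure α ((fun z => (z, q)) ⁻¹'
        ((fun (q : ℝ × (ℝ × Ω)) (i : Fin (1 + 1)) => q.1 * innovChain φ ε i q.2) ⁻¹'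
          {y : Fin (1 + 1) → ℝ | 1 / 2 < τ * y 1})) =
        ENNReal.ofReal ((1 / 2) ^ (-α)) * posPow α (τ * innovChain φ ε 1 q) := by
      intro q
      rw [← powMeasure_lt_mul hα (by norm_num)]
      congr 1
      ext z
      change 1 / 2 < τ * (z * innovChain φ ε 1 q) ↔ 1 / 2 < z * (τ * innovChain φ ε 1 q)
      rw [mul_left_comm]
    simp only [hin] at hle
    have hc : (0 : ℝ) < (1 / 2) ^ (-α) := by positivity
    have hpm : Measurable fun q => posPow α (τ * innovChain φ ε 1 q) :=
      (measurable_posPow α).comp ((hNm 1).const_mul τ)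
    have hpm' : Measurable fun q : ℝ × ℝ => posPow α (τ * q.2) :=
      (measurable_posPow α).comp (measurable_snd.const_mul τ)
    rw [lintegral_const_mul _ hpm, mul_comm (signProb p τ),
      ENNReal.ofReal_mul hc.le, ENNReal.mul_le_mul_iff_right (ENNReal.ofReal_pos.2 hc).ne'
        ENNReal.ofReal_ne_top] at hle
    rw [hs, heq, lintegral_map hpm' hpair]
    exact hle

end Moment

/-! ### Laws of the class as recursions, and convergence along whole paths -/

theorem signLaw_singleton {p σ : ℝ} (hσ : σ = 1 ∨ σ = -1) :
    signLaw p {σ} = ENNReal.ofReal (signProb p σ) := by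
  rcases hσ with rfl | rfl
  · simp [signLaw, signProb_one, show (-1 : ℝ) ≠ 1 by norm_num]
  · simp [signLaw, signProb_neg_one, show (1 : ℝ) ≠ -1 by norm_num]

theorem of_ae_signLaw {p : ℝ} {R : ℝ → Prop} (h : ∀ᵐ σ ∂signLaw p, R σ) {σ : ℝ}
    (hσ : σ = 1 ∨ σ = -1) (hp : 0 < signProb p σ) : R σ := by
  by_contra hn
  have h1 : signLaw p {σ} = 0 := measure_mono_null (by simpa using hn) h
  rw [signLaw_singleton hσ, ENNReal.ofReal_eq_zero] at h1
  linarith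

theorem MemClass.measure_fst {p α : ℝ} {μ : Measure (ℝ × ℝ)} (h : MemClass p α μ) {σ : ℝ}
    (hσ : σ = 1 ∨ σ = -1) : μ {q | q.1 = σ} = ENNReal.ofReal (signProb p σ) := by
  rcases hσ with rfl | rfl
  · rw [h.prob_one, signProb_one]
  · rw [h.prob_neg_one, signProb_neg_one]

theorem posPow_pos {α w : ℝ} (hw : 0 < w) : 0 < posPow α w := by
  rw [posPow, max_eq_left hw.le]
  exact ENNReal.ofReal_pos.2 (Real.rpow_pos_of_pos hw _)

/-- The second coordinate only takes signs that have positive probability. -/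
theorem MemClass.ae_sign {p α : ℝ} {μ : Measure (ℝ × ℝ)} (h : MemClass p α μ) :
    ∀ᵐ q ∂μ, q.2 ≠ 0 → 0 < signProb p (Real.sign q.2) := by
  have h1 : ∀ τ : ℝ, (τ = 1 ∨ τ = -1) → signProb p τ ≤ 0 → ∀ᵐ q ∂μ, τ * q.2 ≤ 0 := by
    intro τ hτ hp
    have h2 := h.moment τ hτ
    have hm : Measurable fun q : ℝ × ℝ => posPow α (τ * q.2) :=
      (measurable_posPow α).comp (measurable_snd.const_mul τ)
    rw [h.measure_fst hτ, ENNReal.ofReal_of_nonpos hp, nonpos_iff_eq_zero,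
      lintegral_eq_zero_iff hm] at h2
    filter_upwards [h2] with q hq
    by_contra! hlt
    exact (posPow_pos (α := α) hlt).ne' hq
  have h2 : ∀ τ : ℝ, (τ = 1 ∨ τ = -1) → ∀ᵐ q ∂μ, 0 < τ * q.2 → 0 < signProb p τ := by
    intro τ hτ
    rcases le_or_gt (signProb p τ) 0 with hp | hp
    · filter_upwards [h1 τ hτ hp] with q hq hlt
      linarith
    · exact Eventually.of_forall fun _ _ => hp
  filter_upwards [h2 1 (Or.inl rfl), h2 (-1) (Or.inr rfl)] with q ha hb hq
  rcases hq.lt_or_gt with h0 | h0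
  · rw [Real.sign_of_neg h0]
    exact hb (by linarith)
  · rw [Real.sign_of_pos h0]
    exact ha (by linarith)

section Law

variable {T : Type*} [MeasurableSpace T] {κ : Measure T} [IsProbabilityMeasure κ]
  {a : T → ℝ → ℝ} {p α : ℝ}

theorem measurable_tailStepLaw_map (ha : ∀ σ, Measurable fun v => a v σ) :
    Measurable fun q : ℝ × T => (q.1, q.1 * a q.2 (Real.sign q.1)) :=
  measurable_fst.prodMk (measurable_tailStep ha)

theorem ae_tailStep_sign (ha : ∀ σ, Measurable fun v => a v σ)
    (hmem : MemClass p α (tailStepLaw p κ a)) :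
    ∀ᵐ v ∂κ, ∀ σ : ℝ, (σ = 1 ∨ σ = -1) → 0 < signProb p σ → tailStep a σ v ≠ 0 →
      0 < signProb p (Real.sign (tailStep a σ v)) := by
  have h1 := ae_of_ae_map (measurable_tailStepLaw_map ha).aemeasurable hmem.ae_sign
  have h2 := Measure.ae_ae_of_ae_prod h1
  have h3 : ∀ σ : ℝ, (σ = 1 ∨ σ = -1) → ∀ᵐ v ∂κ, 0 < signProb p σ → tailStep a σ v ≠ 0 →
      0 < signProb p (Real.sign (tailStep a σ v)) := by
    intro σ hσ
    by_cases hp : 0 < signProb p σ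
    · filter_upwards [of_ae_signLaw h2 hσ hp] with v hv _ using hv
    · exact Eventually.of_forall fun v h => absurd h hp
  filter_upwards [h3 1 (Or.inl rfl), h3 (-1) (Or.inr rfl)] with v hv1 hv2
  rintro σ (rfl | rfl)
  exacts [hv1, hv2]

/-- Conditioning on the sign removes the factor `p(σ)` from the product law. The restriction on `x`
is needed because conditioning on a null sign yields the zero measure. -/
theorem stepKernel_tailStepLaw (ha : ∀ σ, Measurable fun v => a v σ) {x : ℝ}
    (hx : x = 0 ∨ 0 < signProb p (Real.sign x)) :
    stepKernel (tailStepLaw p κ a) x = κ.map (tailStep a x) := by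
  have hsm : Measurable (tailStep a x) :=
    (measurable_tailStep ha).comp (measurable_const.prodMk measurable_id)
  rcases eq_or_ne x 0 with h0 | h0
  · rw [stepKernel, if_pos h0]
    have : tailStep a x = fun _ => 0 := funext fun v => by rw [h0, tailStep_zero]
    rw [this, Measure.map_const, measure_univ, one_smul]
  · have hpx := hx.resolve_left h0
    have hσ := sign_eq_one_or h0
    rw [stepKernel, if_neg h0]
    set σ := Real.sign x with hσdef
    have hm := measurable_tailStepLaw_map ha
    have hms := measurableSet_fst_eq σ
    have hσ0 : σ ≠ 0 := by rcases hσ with h | h <;> rw [h] <;> norm_num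
    have hq : Measurable fun q : ℝ × ℝ => x * (q.2 / q.1) :=
      (measurable_snd.div measurable_fst).const_mul x
    have hfst : (tailStepLaw p κ a) {q | q.1 = σ} = ENNReal.ofReal (signProb p σ) := by
      rw [tailStepLaw, Measure.map_apply hm hms]
      have : (fun q : ℝ × T => (q.1, q.1 * a q.2 (Real.sign q.1))) ⁻¹' {q | q.1 = σ} =
          {σ} ×ˢ Set.univ := by
        ext q
        simp
      rw [this, Measure.prod_prod, measure_univ, mul_one, signLaw_singleton hσ]
    ext B hB
    rw [Measure.map_apply hq hB, cond_apply hms, hfst, Measure.map_apply hsm hB, tailStepLaw,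
      Measure.map_apply hm (hms.inter (hq hB))]
    have : (fun q : ℝ × T => (q.1, q.1 * a q.2 (Real.sign q.1))) ⁻¹'
        ({q | q.1 = σ} ∩ (fun q : ℝ × ℝ => x * (q.2 / q.1)) ⁻¹' B) =
        {σ} ×ˢ (tailStep a x ⁻¹' B) := by
      ext ⟨u, v⟩
      simp only [Set.mem_preimage, Set.mem_inter_iff, Set.mem_ofPred_eq, Set.mem_prod,
        Set.mem_singleton_iff, tailStep]
      refine and_congr_right fun hu => ?_
      rw [hu, sign_eq_self hσ, mul_div_cancel_left₀ _ hσ0]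
    rw [this, Measure.prod_prod, signLaw_singleton hσ, ← mul_assoc,
      ENNReal.inv_mul_cancel (ENNReal.ofReal_pos.2 hpx).ne' ENNReal.ofReal_ne_top, one_mul]

end Law

/-- The coefficient selected by a sign from a pair. -/
def pairCoef (v : ℝ × ℝ) (σ : ℝ) : ℝ := if σ = 1 then v.1 else v.2

theorem measurable_pairCoef (σ : ℝ) : Measurable fun v => pairCoef v σ := by
  unfold pairCoef
  split_ifs
  · exact measurable_fst
  · exact measurable_snd

/-- Every law in `MemClass` is the law of the first two steps of a recursive tail chain. -/
theorem MemClass.exists_tailStepLaw {p α : ℝ} {μ : Measure (ℝ × ℝ)} (h : MemClass p α μ) :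
    ∃ κ : Measure (ℝ × ℝ), IsProbabilityMeasure κ ∧ μ = tailStepLaw p κ pairCoef := by
  classical
  have hpr := h.isProbability
  have hr : Measurable fun q : ℝ × ℝ => q.2 / q.1 := measurable_snd.div measurable_fst
  -- The law of the multiplier `M / I` given `I = σ`; the point mass is a dummy that keeps this a
  -- probability measure at signs that do not occur.
  set ν : ℝ → Measure ℝ := fun σ =>
    if 0 < signProb p σ then (cond μ {q | q.1 = σ}).map (fun q => q.2 / q.1)
    else Measure.dirac 0 with hν
  have hνp : ∀ σ : ℝ, (σ = 1 ∨ σ = -1) → IsProbabilityMeasure (ν σ) := by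
    intro σ hσ
    by_cases hp : 0 < signProb p σ
    · simp only [hν, if_pos hp]
      have : IsProbabilityMeasure (cond μ {q | q.1 = σ}) := by
        refine cond_isProbabilityMeasure ?_
        rw [h.measure_fst hσ]
        exact (ENNReal.ofReal_pos.2 hp).ne'
      exact Measure.isProbabilityMeasure_map hr.aemeasurable
    · simp only [hν, if_neg hp]
      infer_instance
  have i1 := hνp 1 (Or.inl rfl)
  have i2 := hνp (-1) (Or.inr rfl)
  have hνval : ∀ σ : ℝ, (σ = 1 ∨ σ = -1) → ∀ E : Set (ℝ × ℝ), MeasurableSet E →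
      ENNReal.ofReal (signProb p σ) * ν σ {r | (σ, σ * r) ∈ E} = μ ({q | q.1 = σ} ∩ E) := by
    intro σ hσ E hE
    have hσ0 : σ ≠ 0 := by rcases hσ with h | h <;> rw [h] <;> norm_num
    have hEr : MeasurableSet {r : ℝ | (σ, σ * r) ∈ E} :=
      (measurable_const.prodMk (measurable_const_mul σ)) hE
    by_cases hp : 0 < signProb p σ
    · simp only [hν, if_pos hp]
      rw [Measure.map_apply hr hEr, cond_apply (measurableSet_fst_eq σ), h.measure_fst hσ,
        ← mul_assoc, ENNReal.mul_inv_cancel (ENNReal.ofReal_pos.2 hp).ne' ENNReal.ofReal_ne_top,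
        one_mul]
      congr 1
      ext ⟨u, w⟩
      simp only [Set.mem_inter_iff, Set.mem_ofPred_eq, Set.mem_preimage]
      refine and_congr_right fun hu => ?_
      rw [hu, mul_div_cancel₀ _ hσ0]
    · rw [ENNReal.ofReal_of_nonpos (not_lt.1 hp), zero_mul]
      refine (measure_mono_null Set.inter_subset_left ?_).symm
      rw [h.measure_fst hσ, ENNReal.ofReal_of_nonpos (not_lt.1 hp)]
  -- A step reads only the coordinate selected by the current sign, so the coupling of the two
  -- multipliers is immaterial and independence serves.
  refine ⟨(ν 1).prod (ν (-1)), inferInstance, ?_⟩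
  ext E hE
  have hm := measurable_tailStepLaw_map measurable_pairCoef
  rw [tailStepLaw, Measure.map_apply hm hE, signLaw, Measure.add_prod, Measure.add_apply,
    Measure.prod_smul_left, Measure.prod_smul_left, Measure.smul_apply, Measure.smul_apply,
    Measure.dirac_prod, Measure.dirac_prod,
    Measure.map_apply measurable_prodMk_left (hm hE),
    Measure.map_apply measurable_prodMk_left (hm hE)]
  have e1 : Prod.mk (1 : ℝ) ⁻¹' ((fun q : ℝ × (ℝ × ℝ) =>
      (q.1, q.1 * pairCoef q.2 (Real.sign q.1))) ⁻¹' E) = {r | (1, 1 * r) ∈ E} ×ˢ Set.univ := by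
    ext v
    simp [pairCoef, Real.sign_one]
  have e2 : Prod.mk (-1 : ℝ) ⁻¹' ((fun q : ℝ × (ℝ × ℝ) =>
      (q.1, q.1 * pairCoef q.2 (Real.sign q.1))) ⁻¹' E) = Set.univ ×ˢ {r | (-1, -1 * r) ∈ E} := by
    ext v
    have : Real.sign (-1) = -1 := sign_eq_self (Or.inr rfl)
    simp [pairCoef, this, show (-1 : ℝ) ≠ 1 by norm_num]
  rw [e1, e2, Measure.prod_prod, Measure.prod_prod, measure_univ, measure_univ, mul_one, one_mul,
    smul_eq_mul, smul_eq_mul]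
  have v1 := hνval 1 (Or.inl rfl) E hE
  have v2 := hνval (-1) (Or.inr rfl) E hE
  rw [signProb_one] at v1
  rw [signProb_neg_one] at v2
  rw [v1, v2, ← measure_union _ ((measurableSet_fst_eq _).inter hE)]
  · refine measure_congr ?_
    filter_upwards [h.support] with q hq
    refine propext ⟨fun hqE => ?_, fun hqE => ?_⟩
    · rcases hq with h1 | h1
      · exact Or.inl ⟨h1, hqE⟩
      · exact Or.inr ⟨h1, hqE⟩
    · rcases hqE with h1 | h1 <;> exact h1.2
  · rw [Set.disjoint_left]
    rintro q ⟨h1, _⟩ ⟨h2, _⟩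
    have h1 : q.1 = 1 := h1
    have h2 : q.1 = -1 := h2
    rw [h1] at h2
    norm_num at h2

/-- A bootstrap: one-step convergence holds outright and yields the moment condition; that condition
excludes steps into signs of probability zero, where nothing is known about `Ψ`; this in turn gives
convergence along paths of any length. -/
theorem ae_convergesAlong {Ω S : Type*} [MeasurableSpace Ω] [MeasurableSpace S]
    {P : Measure Ω} [IsProbabilityMeasure P] {Ψ : ℝ → S → ℝ} {ε : ℕ → Ω → S} {X : ℕ → Ω → ℝ}
    {φ : S → ℝ → ℝ} {α p : ℝ} (hX : IsStationaryChain P Ψ ε X)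
    (hRV : HasRegVarTails P (X 0) α p) (hφ : ∀ σ, Measurable fun v => φ v σ)
    (hA : AsympLinear P Ψ (ε 0) p φ) :
    MemClass p α (tailStepLaw p (P.map (ε 0)) φ) ∧
      ∀ᵐ ω ∂P, ∀ t, ConvergesAlong p Ψ φ t fun n => ε n ω := by
  obtain ⟨V, hV, hPV, hlim, hW⟩ := hA
  have hm0 := hX.measurable_innov 0
  have : IsProbabilityMeasure (P.map (ε 0)) := Measure.isProbabilityMeasure_map hm0.aemeasurable
  have htransfer : ∀ R : S → Prop, (∀ᵐ v ∂P.map (ε 0), R v) → ∀ᵐ ω ∂P, ∀ n, R (ε n ω) := by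
    intro R hR
    rw [ae_all_iff]
    intro n
    rw [← (hX.ident_innov n).map_eq] at hR
    exact ae_of_ae_map (hX.measurable_innov n).aemeasurable hR
  have hVae := htransfer _ (ae_mem_of_prob_eq_one hm0 hV hPV)
  have hmem : MemClass p α (tailStepLaw p (P.map (ε 0)) φ) := by
    refine tailStepLaw_mem hX hRV hφ ?_
    filter_upwards [hVae] with ω hω
    exact convergesAlong_one fun σ hσ hp => hlim σ hσ hp _ (hω 0)
  refine ⟨hmem, ?_⟩
  have hsign := htransfer _ (ae_tailStep_sign hφ hmem)
  by_cases hz : ∃ σ : ℝ, (σ = 1 ∨ σ = -1) ∧ 0 < signProb p σ ∧ 0 < P {ω | φ (ε 0 ω) σ = 0}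
  · obtain ⟨W, hWm, hWV, hPW, hWb⟩ := hW hz
    have hWae := htransfer _ (ae_mem_of_prob_eq_one hm0 hWm hPW)
    filter_upwards [hVae, hsign, hWae] with ω h1 h2 h3 t
    exact convergesAlong_of_good (fun n σ hσ hp => hlim σ hσ hp _ (h1 n)) h2
      (Or.inl fun n => hWb _ (h3 n)) t
  · push Not at hz
    have hne : ∀ᵐ v ∂P.map (ε 0), ∀ σ : ℝ, (σ = 1 ∨ σ = -1) → 0 < signProb p σ →
        tailStep φ σ v ≠ 0 := by
      have h3 : ∀ σ : ℝ, (σ = 1 ∨ σ = -1) → ∀ᵐ v ∂P.map (ε 0), 0 < signProb p σ →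
          tailStep φ σ v ≠ 0 := by
        intro σ hσ
        by_cases hp : 0 < signProb p σ
        · have h4 : ∀ᵐ v ∂P.map (ε 0), φ v σ ≠ 0 := by
            have hs : MeasurableSet {v | φ v σ ≠ 0} :=
              (measurableSet_eq_fun (hφ σ) measurable_const).compl
            rw [ae_map_iff hm0.aemeasurable hs, ae_iff]
            simpa using hz σ hσ hp
          filter_upwards [h4] with v hv _
          rw [tailStep, sign_eq_self hσ]
          refine mul_ne_zero ?_ hv
          rcases hσ with h | h <;> rw [h] <;> norm_num
        · exact Eventually.of_forall fun v h => absurd h hp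
      filter_upwards [h3 1 (Or.inl rfl), h3 (-1) (Or.inr rfl)] with v hv1 hv2
      rintro σ (rfl | rfl)
      exacts [hv1, hv2]
    filter_upwards [hVae, hsign, htransfer _ hne] with ω h1 h2 h3 t
    exact convergesAlong_of_good (fun n σ hσ hp => hlim σ hσ hp _ (h1 n)) h2 (Or.inr h3) t

/-! ### Construction of the adjoint law -/

theorem posPow_mul_left {α c : ℝ} (hc : 0 ≤ c) (w : ℝ) :
    posPow α (c * w) = ENNReal.ofReal (c ^ α) * posPow α w := by
  have h1 : max (c * w) 0 = c * max w 0 := by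
    rw [mul_max_of_nonneg _ _ hc, mul_zero]
  rw [posPow, posPow, h1, Real.mul_rpow hc (le_max_right _ _),
    ENNReal.ofReal_mul (Real.rpow_nonneg hc _)]

theorem posPow_zero {α : ℝ} (hα : 0 < α) : posPow α 0 = 0 := posPow_of_nonpos hα le_rfl

theorem measurable_sign : Measurable Real.sign := by
  unfold Real.sign
  exact Measurable.ite measurableSet_Iio measurable_const
    (Measurable.ite measurableSet_Ioi measurable_const measurable_const)

/-- The absolutely continuous part of the adjoint law. -/
def adjointPart (α : ℝ) (μ : Measure (ℝ × ℝ)) : Measure (ℝ × ℝ) :=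
  (μ.withDensity fun q => ENNReal.ofReal (|q.2| ^ α)).map fun q => (Real.sign q.2, q.1 / |q.2|)

/-- The adjoint of a law in `MemClass`. -/
def adjointLaw (p α : ℝ) (μ : Measure (ℝ × ℝ)) : Measure (ℝ × ℝ) :=
  adjointPart α μ +
    ((ENNReal.ofReal (signProb p 1) - ∫⁻ q, posPow α (1 * q.2) ∂μ) • Measure.dirac (1, 0) +
      (ENNReal.ofReal (signProb p (-1)) - ∫⁻ q, posPow α (-1 * q.2) ∂μ) • Measure.dirac (-1, 0))

theorem measurable_adjointMap : Measurable fun q : ℝ × ℝ => (Real.sign q.2, q.1 / |q.2|) :=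
  (measurable_sign.comp measurable_snd).prodMk (measurable_fst.div measurable_snd.abs)

theorem lintegral_adjointPart (α : ℝ) (μ : Measure (ℝ × ℝ)) {f : ℝ × ℝ → ENNReal}
    (hf : Measurable f) :
    ∫⁻ q, f q ∂adjointPart α μ =
      ∫⁻ q, ENNReal.ofReal (|q.2| ^ α) * f (Real.sign q.2, q.1 / |q.2|) ∂μ := by
  have hw : Measurable fun q : ℝ × ℝ => ENNReal.ofReal (|q.2| ^ α) := by fun_prop
  rw [adjointPart, lintegral_map hf measurable_adjointMap]
  exact lintegral_withDensity_eq_lintegral_mul _ hw (hf.comp measurable_adjointMap)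

theorem lintegral_adjointLaw (p α : ℝ) (μ : Measure (ℝ × ℝ)) {f : ℝ × ℝ → ENNReal}
    (hf : Measurable f) (h1 : f (1, 0) = 0) (h2 : f (-1, 0) = 0) :
    ∫⁻ q, f q ∂adjointLaw p α μ =
      ∫⁻ q, ENNReal.ofReal (|q.2| ^ α) * f (Real.sign q.2, q.1 / |q.2|) ∂μ := by
  rw [adjointLaw, lintegral_add_measure, lintegral_add_measure, lintegral_smul_measure,
    lintegral_smul_measure, lintegral_dirac' _ hf, lintegral_dirac' _ hf, h1, h2, smul_zero,
    smul_zero, add_zero, add_zero, lintegral_adjointPart _ _ hf]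

/-- Homogeneity: weighting by `|M|^α` and dividing `(M, I)` by `|M|` leaves expectations of
functions homogeneous of order `α` unchanged where `M ≠ 0`. The moment condition says that the
weighted mass of each sign does not exceed `p(σ)`. The atoms at `(±1, 0)` fill the deficit, and they
contribute nothing to the adjoint relation because one term of the minimum vanishes there. -/
theorem MemClass.isAdjoint_adjointLaw {p α : ℝ} (hα : 0 < α) (hp0 : 0 ≤ p) (hp1 : p ≤ 1)
    {μ : Measure (ℝ × ℝ)} (h : MemClass p α μ) : IsAdjoint p α μ (adjointLaw p α μ) := by
  have hpm : ∀ x : ℝ, Measurable fun q : ℝ × ℝ => posPow α (x * q.2) := fun x =>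
    (measurable_posPow α).comp (measurable_snd.const_mul x)
  have hpm1 : ∀ x : ℝ, Measurable fun q : ℝ × ℝ => posPow α (x * q.1) := fun x =>
    (measurable_posPow α).comp (measurable_fst.const_mul x)
  have hw1 : ∀ (q : ℝ × ℝ) (x : ℝ), q.2 ≠ 0 →
      ENNReal.ofReal (|q.2| ^ α) * posPow α (x * (q.1 / |q.2|)) = posPow α (x * q.1) := by
    intro q x hq
    rw [← posPow_mul_left (abs_nonneg _)]
    congr 1
    have := abs_ne_zero.2 hq
    field_simp
  have hw2 : ∀ (q : ℝ × ℝ) (y : ℝ), q.2 ≠ 0 →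
      ENNReal.ofReal (|q.2| ^ α) * posPow α (y * Real.sign q.2) = posPow α (y * q.2) := by
    intro q x hq
    rw [← posPow_mul_left (abs_nonneg _)]
    congr 1
    rw [mul_left_comm, mul_comm |q.2|]
    congr 1
    rw [← sign_mul_self_eq_abs, ← mul_assoc]
    rcases sign_eq_one_or hq with h | h <;> rw [h] <;> ring
  have hw0 : ∀ q : ℝ × ℝ, q.2 = 0 → ENNReal.ofReal (|q.2| ^ α) = 0 := by
    intro q hq
    rw [hq, abs_zero, Real.zero_rpow hα.ne', ENNReal.ofReal_zero]
  have hfst : ∀ σ : ℝ, (σ = 1 ∨ σ = -1) →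
      adjointLaw p α μ {q | q.1 = σ} = ENNReal.ofReal (signProb p σ) := by
    intro σ hσ
    have hm := measurableSet_fst_eq σ
    have h1 : adjointPart α μ {q | q.1 = σ} = ∫⁻ q, posPow α (σ * q.2) ∂μ := by
      rw [← lintegral_indicator_one hm, lintegral_adjointPart _ _ (measurable_one.indicator hm)]
      refine lintegral_congr fun q => ?_
      rcases eq_or_ne q.2 0 with h0 | h0
      · rw [hw0 q h0, zero_mul, h0, mul_zero, posPow_zero hα]
      · rw [← hw2 q σ h0]
        congr 1
        by_cases hs : Real.sign q.2 = σ
        · rw [Set.indicator_of_mem (by exact hs), hs]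
          have : σ * σ = 1 := by rcases hσ with h | h <;> rw [h] <;> norm_num
          rw [this, posPow]
          simp
        · rw [Set.indicator_of_notMem (by exact hs), posPow_of_nonpos hα]
          rcases hσ with h | h <;> rcases sign_eq_one_or h0 with h' | h' <;> rw [h, h'] at hs ⊢ <;>
            first | exact absurd rfl hs | norm_num
    have h2 := h.moment σ hσ
    rw [h.measure_fst hσ] at h2
    rw [adjointLaw, Measure.add_apply, h1, Measure.add_apply, Measure.smul_apply,
      Measure.smul_apply, Measure.dirac_apply' _ hm, Measure.dirac_apply' _ hm]
    rcases hσ with rfl | rfl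
    · rw [Set.indicator_of_mem (by simp), Set.indicator_of_notMem (by norm_num)]
      simp only [Pi.one_apply, smul_eq_mul, mul_one, mul_zero, add_zero]
      exact add_tsub_cancel_of_le h2
    · rw [Set.indicator_of_notMem (by norm_num), Set.indicator_of_mem (by simp)]
      simp only [Pi.one_apply, smul_eq_mul, mul_one, mul_zero, zero_add]
      exact add_tsub_cancel_of_le h2
  have hsupp : ∀ᵐ q ∂adjointLaw p α μ, q.1 = 1 ∨ q.1 = -1 := by
    have hs : MeasurableSet {q : ℝ × ℝ | q.1 = 1 ∨ q.1 = -1} :=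
      (measurableSet_fst_eq 1).union (measurableSet_fst_eq (-1))
    rw [adjointLaw, ae_add_measure_iff, ae_add_measure_iff]
    refine ⟨?_, Measure.ae_smul_measure ?_ _, Measure.ae_smul_measure ?_ _⟩
    · rw [adjointPart, ae_map_iff measurable_adjointMap.aemeasurable hs,
        ae_withDensity_iff (by fun_prop)]
      refine Eventually.of_forall fun q hq => sign_eq_one_or fun h0 => hq (hw0 q h0)
    · rw [ae_dirac_iff hs]; exact Or.inl rfl
    · rw [ae_dirac_iff hs]; exact Or.inr rfl
  have hmem : MemClass p α (adjointLaw p α μ) := by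
    refine ⟨⟨?_⟩, ?_, ?_, hsupp, ?_⟩
    · have hU : adjointLaw p α μ Set.univ =
          adjointLaw p α μ ({q | q.1 = 1} ∪ {q | q.1 = -1}) := by
        refine measure_congr ?_
        filter_upwards [hsupp] with q hq
        exact propext ⟨fun _ => hq, fun _ => trivial⟩
      rw [hU, measure_union _ (measurableSet_fst_eq _), hfst 1 (Or.inl rfl), hfst _ (Or.inr rfl),
        signProb_one, signProb_neg_one, ← ENNReal.ofReal_add hp0 (sub_nonneg.2 hp1)]
      · simp
      · rw [Set.disjoint_left]
        intro q h1 h2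
        have h1 : q.1 = 1 := h1
        have h2 : q.1 = -1 := h2
        rw [h1] at h2
        norm_num at h2
    · rw [hfst 1 (Or.inl rfl), signProb_one]
    · rw [hfst _ (Or.inr rfl), signProb_neg_one]
    · intro σ hσ
      rw [hfst σ hσ, ← h.measure_fst hσ, ← lintegral_indicator_one (measurableSet_fst_eq σ),
        lintegral_adjointLaw _ _ _ (hpm σ) (by simp [posPow_zero hα]) (by simp [posPow_zero hα])]
      refine lintegral_mono_ae ?_
      filter_upwards [h.support] with q hq
      rcases eq_or_ne q.2 0 with h0 | h0
      · rw [hw0 q h0, zero_mul]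
        exact zero_le
      · rw [hw1 q σ h0]
        by_cases hs : q.1 = σ
        · rw [Set.indicator_of_mem (by exact hs), hs]
          have : σ * σ = 1 := by rcases hσ with h | h <;> rw [h] <;> norm_num
          rw [this, posPow]
          simp
        · rw [Set.indicator_of_notMem (by exact hs), posPow_of_nonpos hα]
          rcases hσ with h | h <;> rcases hq with h' | h' <;> rw [h, h'] at hs ⊢ <;>
            first | exact absurd rfl hs | norm_num
  refine ⟨h, hmem, fun x y => ?_⟩
  rw [lintegral_adjointLaw _ _ _ ((hpm x).min (hpm1 y)) (by simp [posPow_zero hα])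
    (by simp [posPow_zero hα])]
  refine lintegral_congr fun q => ?_
  rcases eq_or_ne q.2 0 with h0 | h0
  · rw [hw0 q h0, zero_mul, h0, mul_zero, posPow_zero hα, min_eq_right zero_le]
  · have hmin := (mul_right_mono (a := ENNReal.ofReal (|q.2| ^ α))).map_min
      (a := posPow α (x * (q.1 / |q.2|))) (b := posPow α (y * Real.sign q.2))
    rw [hmin, hw1 q x h0, hw2 q y h0]

/-! ### Resampling an innovation and the Markov property -/

section Resample

variable {T ι : Type*} [MeasurableSpace T] [DecidableEq ι]

/-- Replacing one coordinate of an independent family by an independent copy does not change the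
law. -/
theorem measurePreserving_update (κ : ι → Measure T) [∀ i, IsProbabilityMeasure (κ i)] (i : ι) :
    MeasurePreserving (fun q : (ι → T) × T => Function.update q.1 i q.2)
      ((Measure.infinitePi κ).prod (κ i)) (Measure.infinitePi κ) := by
  have hm : Measurable fun q : (ι → T) × T => Function.update q.1 i q.2 := by
    refine measurable_pi_lambda _ fun j => ?_
    by_cases h : j = i
    · subst h
      simpa using measurable_snd
    · simp only [Function.update_of_ne h]
      exact (measurable_pi_apply j).comp measurable_fst
  refine ⟨hm, Measure.eq_infinitePi κ fun s t ht => ?_⟩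
  rw [Measure.map_apply hm (MeasurableSet.pi s.countable_toSet fun i _ => ht i)]
  by_cases hi : i ∈ s
  · have : (fun q : (ι → T) × T => Function.update q.1 i q.2) ⁻¹' (s : Set ι).pi t =
        ((s.erase i : Finset ι) : Set ι).pi t ×ˢ t i := by
      ext ⟨e, v⟩
      simp only [Set.mem_preimage, Set.mem_pi, Set.mem_prod, Finset.coe_erase, Set.mem_sdiff,
        Finset.mem_coe, Set.mem_singleton_iff]
      constructor
      · intro h
        refine ⟨fun j hj => ?_, ?_⟩
        · simpa [Function.update_of_ne hj.2] using h j hj.1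
        · simpa using h i hi
      · rintro ⟨h1, h2⟩ j hj
        by_cases hji : j = i
        · subst hji
          simpa using h2
        · simpa [Function.update_of_ne hji] using h1 j ⟨hj, hji⟩
    rw [this, Measure.prod_prod, Measure.infinitePi_pi κ fun i _ => ht i, mul_comm,
      Finset.mul_prod_erase s (fun i => κ i (t i)) hi]
  · have : (fun q : (ι → T) × T => Function.update q.1 i q.2) ⁻¹' (s : Set ι).pi t =
        (s : Set ι).pi t ×ˢ Set.univ := by
      ext ⟨e, v⟩
      simp only [Set.mem_preimage, Set.mem_pi, Set.mem_prod, Finset.mem_coe, Set.mem_univ,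
        and_true]
      refine forall₂_congr fun j hj => ?_
      have hji : j ≠ i := fun h => hi (h ▸ hj)
      rw [Function.update_of_ne hji]
    rw [this, Measure.prod_prod, Measure.infinitePi_pi κ fun i _ => ht i, measure_univ, mul_one]

end Resample

/-- The states that a tail chain can visit. -/
def Admissible (p x : ℝ) : Prop := x = 0 ∨ 0 < signProb p (Real.sign x)

theorem measurableSet_admissible (p : ℝ) : MeasurableSet {x | Admissible p x} := by
  have h : Measurable fun x => signProb p (Real.sign x) := by
    unfold signProb
    exact Measurable.ite (measurable_sign (measurableSet_singleton 1)) measurable_const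
      measurable_const
  exact (measurableSet_singleton 0).union (measurableSet_lt measurable_const h)

theorem chainPath_congr {S : Type*} (Ψ : ℝ → S → ℝ) (y : ℝ) {e e' : ℕ → S} {n : ℕ}
    (h : ∀ k < n, e k = e' k) : chainPath Ψ y e n = chainPath Ψ y e' n := by
  induction n with
  | zero => rfl
  | succ n ih =>
    rw [chainPath, chainPath, ih fun k hk => h k (hk.trans n.lt_succ_self), h n n.lt_succ_self]

/-- The `σ`-algebra of the sets that are invariant under all maps `ω ↦ upd (ω, v)`. -/
@[reducible] def invariantSets {Ω T : Type*} (upd : Ω × T → Ω) : MeasurableSpace Ω where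
  MeasurableSet' A := ∀ ω v, upd (ω, v) ∈ A ↔ ω ∈ A
  measurableSet_empty _ _ := Iff.rfl
  measurableSet_compl _ hA ω v := not_congr (hA ω v)
  measurableSet_iUnion f hf ω v := by
    simp only [Set.mem_iUnion]
    exact exists_congr fun i => hf i ω v

section Resample

variable {Ω T : Type*} [MeasurableSpace Ω] [MeasurableSpace T] {Q : Measure Ω}
  {κ : Measure T} [IsProbabilityMeasure κ] {a : T → ℝ → ℝ} {p α : ℝ}

/-- Resampling preserves `Q`, so the event may be evaluated after inserting a fresh innovation `v`.
The past event `A` does not see `v`, and the new state is one step from `Y` driven by `v`; Fubini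
gives the transition formula. -/
theorem transition_of_resample (ha : ∀ σ, Measurable fun v => a v σ) {upd : Ω × T → Ω}
    (hupd : MeasurePreserving upd (Q.prod κ) Q) {Y Y' : Ω → ℝ} (hY' : Measurable Y')
    (hstep : ∀ ω v, Y' (upd (ω, v)) = tailStep a (Y ω) v) (hD : ∀ᵐ ω ∂Q, Admissible p (Y ω))
    {A : Set Ω} (hA : MeasurableSet A) (hinv : ∀ ω v, upd (ω, v) ∈ A ↔ ω ∈ A) {B : Set ℝ}
    (hB : MeasurableSet B) :
    Q (A ∩ Y' ⁻¹' B) = ∫⁻ ω in A, stepKernel (tailStepLaw p κ a) (Y ω) B ∂Q := by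
  have hAB : MeasurableSet (A ∩ Y' ⁻¹' B) := hA.inter (hY' hB)
  rw [← hupd.measure_preimage hAB.nullMeasurableSet,
    Measure.prod_apply (hupd.measurable hAB), ← lintegral_indicator hA]
  refine lintegral_congr_ae ?_
  filter_upwards [hD] with ω hω
  have hpre : Prod.mk ω ⁻¹' (upd ⁻¹' (A ∩ Y' ⁻¹' B)) = {v | ω ∈ A ∧ tailStep a (Y ω) v ∈ B} := by
    ext v
    simp only [Set.mem_preimage, Set.mem_inter_iff, Set.mem_ofPred_eq, hinv, hstep]
  rw [hpre]
  by_cases h : ω ∈ A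
  · have hsm : Measurable (tailStep a (Y ω)) :=
      (measurable_tailStep ha).comp (measurable_const.prodMk measurable_id)
    rw [Set.indicator_of_mem h, stepKernel_tailStepLaw ha hω, Measure.map_apply hsm hB]
    simp only [h, true_and]
    rfl
  · rw [Set.indicator_of_notMem h]
    simp [h]

theorem admissible_of_resample (ha : ∀ σ, Measurable fun v => a v σ) {upd : Ω × T → Ω}
    (hupd : MeasurePreserving upd (Q.prod κ) Q) {Y Y' : Ω → ℝ} (hY' : Measurable Y')
    (hstep : ∀ ω v, Y' (upd (ω, v)) = tailStep a (Y ω) v)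
    (hmem : MemClass p α (tailStepLaw p κ a)) (hD : ∀ᵐ ω ∂Q, Admissible p (Y ω)) :
    ∀ᵐ ω ∂Q, Admissible p (Y' ω) := by
  have hs : MeasurableSet {ω | Admissible p (Y' ω)} := hY' (measurableSet_admissible p)
  rw [← hupd.map_eq, ae_map_iff hupd.measurable.aemeasurable hs]
  filter_upwards [Measure.quasiMeasurePreserving_fst.ae hD,
    Measure.quasiMeasurePreserving_snd.ae (ae_tailStep_sign ha hmem)] with q h1 h2
  rw [show q = (q.1, q.2) from rfl, hstep]
  rcases eq_or_ne (Y q.1) 0 with h0 | h0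
  · left
    rw [h0, tailStep_zero]
  · have hp := h1.resolve_left h0
    rw [tailStep_eq_abs_mul a h0, Admissible, sign_mul_of_pos (abs_pos.2 h0)]
    by_cases h3 : tailStep a (Real.sign (Y q.1)) q.2 = 0
    · left
      rw [h3, mul_zero]
    · exact Or.inr (h2 _ (sign_eq_one_or h0) hp h3)

/-- A chain driven by innovations: `upd n` replaces the innovation of step `n` by an independent
copy. -/
structure IsInnovDriven (Q : Measure Ω) (p : ℝ) (κ : Measure T) (a : T → ℝ → ℝ) (N : ℕ → Ω → ℝ)
    (upd : ℕ → Ω × T → Ω) : Prop where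
  measurable_coef : ∀ σ, Measurable fun v => a v σ
  measurable : ∀ n, Measurable (N n)
  law_zero : Q.map (N 0) = signLaw p
  preserving : ∀ n, MeasurePreserving (upd n) (Q.prod κ) Q
  invariant : ∀ n, ∀ k ≤ n, ∀ ω v, N k (upd n (ω, v)) = N k ω
  step : ∀ n ω v, N (n + 1) (upd n (ω, v)) = tailStep a (N n ω) v

variable {N : ℕ → Ω → ℝ} {upd : ℕ → Ω × T → Ω}

theorem IsInnovDriven.law [SFinite Q] (h : IsInnovDriven Q p κ a N upd) :
    Q.map (fun ω => (N 0 ω, N 1 ω)) = tailStepLaw p κ a := by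
  have hm : Measurable fun ω => (N 0 ω, N 1 ω) := (h.measurable 0).prodMk (h.measurable 1)
  have h1 : (signLaw p).prod κ = (Q.prod κ).map (Prod.map (N 0) id) := by
    rw [← Measure.map_prod_map _ _ (h.measurable 0) measurable_id, Measure.map_id, h.law_zero]
  rw [← (h.preserving 0).map_eq, Measure.map_map hm (h.preserving 0).measurable, tailStepLaw, h1,
    Measure.map_map (measurable_tailStepLaw_map h.measurable_coef)
      ((h.measurable 0).prodMap measurable_id)]
  congr 1
  ext q
  · exact h.invariant 0 0 le_rfl q.1 q.2
  · exact h.step 0 q.1 q.2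

theorem IsInnovDriven.admissible (h : IsInnovDriven Q p κ a N upd)
    (hmem : MemClass p α (tailStepLaw p κ a)) (n : ℕ) : ∀ᵐ ω ∂Q, Admissible p (N n ω) := by
  induction n with
  | zero =>
    have h1 := ae_signLaw_pos p
    rw [← h.law_zero] at h1
    filter_upwards [ae_of_ae_map (h.measurable 0).aemeasurable h1] with ω hω
    right
    rw [sign_eq_self hω.1]
    exact hω.2
  | succ n ih =>
    exact admissible_of_resample h.measurable_coef (h.preserving n) (h.measurable _) (h.step n)
      hmem ih

theorem IsInnovDriven.transition (h : IsInnovDriven Q p κ a N upd)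
    (hmem : MemClass p α (tailStepLaw p κ a)) (n : ℕ) {A : Set Ω} (hA : MeasurableSet A)
    (hinv : ∀ ω v, upd n (ω, v) ∈ A ↔ ω ∈ A) {B : Set ℝ} (hB : MeasurableSet B) :
    Q (A ∩ N (n + 1) ⁻¹' B) = ∫⁻ ω in A, stepKernel (tailStepLaw p κ a) (N n ω) B ∂Q :=
  transition_of_resample h.measurable_coef (h.preserving n) (h.measurable _) (h.step n)
    (h.admissible hmem n) hA hinv hB

theorem IsInnovDriven.hasForwardTransitions [SFinite Q] {Z : ℤ → Ω → ℝ} (hZ : ∀ t, Measurable (Z t))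
    (h : IsInnovDriven Q p κ a (fun n => Z n) upd) (hmem : MemClass p α (tailStepLaw p κ a))
    (hinv : ∀ n : ℕ, ∀ s : ℤ, s ≤ n → ∀ ω v, Z s (upd n (ω, v)) = Z s ω) :
    HasForwardTransitions Q Z := by
  intro t ht A hA B hB
  obtain ⟨n, rfl⟩ : ∃ n : ℕ, t = n + 1 := ⟨(t - 1).toNat, by omega⟩
  have hlaw : Q.map (fun ω => (Z 0 ω, Z 1 ω)) = tailStepLaw p κ a := h.law
  have hle : (⨆ s ∈ Set.Iio ((n : ℤ) + 1), MeasurableSpace.comap (Z s) inferInstance) ≤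
      (inferInstance : MeasurableSpace Ω) := iSup₂_le fun s _ => (hZ s).comap_le
  -- Since invariant sets form a σ-algebra, invariance of each past coordinate extends to all events
  -- of the past, negative times included.
  have hleI : (⨆ s ∈ Set.Iio ((n : ℤ) + 1), MeasurableSpace.comap (Z s) inferInstance) ≤
      invariantSets (upd n) := by
    refine iSup₂_le fun s hs => ?_
    intro A' hA'
    obtain ⟨C, hC⟩ := hA'
    intro ω v
    rw [← hC.2, Set.mem_preimage, Set.mem_preimage, hinv n s (Int.lt_add_one_iff.1 hs)]
  have := h.transition hmem n (hle A hA) (hleI A hA) hB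
  rw [hlaw, add_sub_cancel_right]
  exact_mod_cast this

end Resample

theorem measurable_lintegral_stepKernel (μ : Measure (ℝ × ℝ)) [IsFiniteMeasure μ]
    {f : ℝ → ENNReal} (hf : Measurable f) :
    Measurable fun x => ∫⁻ y, f y ∂stepKernel μ x := by
  have hq : Measurable fun r : ℝ × (ℝ × ℝ) => r.1 * (r.2.2 / r.2.1) := by fun_prop
  have hq' : ∀ x : ℝ, Measurable fun q : ℝ × ℝ => x * (q.2 / q.1) := fun x =>
    hq.comp (measurable_const.prodMk measurable_id)
  have h1 : ∀ σ : ℝ, Measurable fun x : ℝ =>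
      ∫⁻ q, f (x * (q.2 / q.1)) ∂cond μ {q | q.1 = σ} := fun σ =>
    (hf.comp hq).lintegral_prod_right'
  have h2 : (fun x => ∫⁻ y, f y ∂stepKernel μ x) = fun x => if x = 0 then f 0 else
      if 0 < x then ∫⁻ q, f (x * (q.2 / q.1)) ∂cond μ {q | q.1 = 1}
      else ∫⁻ q, f (x * (q.2 / q.1)) ∂cond μ {q | q.1 = -1} := by
    ext x
    by_cases h0 : x = 0
    · rw [stepKernel, if_pos h0, if_pos h0, lintegral_dirac' _ hf]
    · rw [stepKernel, if_neg h0, if_neg h0, lintegral_map hf (hq' x)]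
      rcases lt_or_gt_of_ne h0 with h | h
      · rw [if_neg (not_lt.2 h.le), Real.sign_of_neg h]
      · rw [if_pos h, Real.sign_of_pos h]
  rw [h2]
  exact Measurable.ite (measurableSet_singleton 0) measurable_const
    (Measurable.ite measurableSet_Ioi (h1 1) (h1 (-1)))

theorem measurable_stepKernel (μ : Measure (ℝ × ℝ)) [IsFiniteMeasure μ] {B : Set ℝ}
    (hB : MeasurableSet B) : Measurable fun x => stepKernel μ x B := by
  have := measurable_lintegral_stepKernel μ (measurable_one.indicator hB)
  simpa only [lintegral_indicator_one hB] using this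

/-- Past events on path space pull back to past events of the process. The reindexing `s` allows the
identity and the reflection of time to be treated at once. -/
theorem HasForwardTransitions.of_map {Ω : Type*} [MeasurableSpace Ω] {Q : Measure Ω}
    [IsFiniteMeasure Q] {Z : ℤ → Ω → ℝ} (hZ : ∀ t, Measurable (Z t)) {s : ℤ → ℤ}
    (h : HasForwardTransitions Q fun t => Z (s t)) :
    HasForwardTransitions (Q.map fun ω t => Z t ω) fun t x => x (s t) := by
  have hm : Measurable fun ω t => Z t ω := measurable_pi_lambda _ hZ
  have hm2 : ∀ i j : ℤ, Measurable fun x : ℤ → ℝ => (x i, x j) := fun i j =>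
    (measurable_pi_apply i).prodMk (measurable_pi_apply j)
  intro t ht A hA B hB
  have hle : (⨆ r ∈ Set.Iio t, MeasurableSpace.comap (fun x : ℤ → ℝ => x (s r)) inferInstance) ≤
      MeasurableSpace.pi := iSup₂_le fun r _ => (measurable_pi_apply (s r)).comap_le
  have hA' : MeasurableSet[⨆ r ∈ Set.Iio t, MeasurableSpace.comap (Z (s r)) inferInstance]
      ((fun ω t => Z t ω) ⁻¹' A) := by
    have h1 : MeasurableSet[(⨆ r ∈ Set.Iio t, MeasurableSpace.comap (fun x : ℤ → ℝ => x (s r))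
        inferInstance).comap fun ω t => Z t ω] ((fun ω t => Z t ω) ⁻¹' A) := ⟨A, hA, rfl⟩
    have h2 : (⨆ r ∈ Set.Iio t, MeasurableSpace.comap (fun x : ℤ → ℝ => x (s r))
        inferInstance).comap (fun ω t => Z t ω) =
        ⨆ r ∈ Set.Iio t, MeasurableSpace.comap (Z (s r)) inferInstance := by
      rw [MeasurableSpace.comap_iSup]
      refine iSup_congr fun r => ?_
      rw [MeasurableSpace.comap_iSup]
      refine iSup_congr fun hr => ?_
      rw [MeasurableSpace.comap_comp]
      rfl
    rwa [h2] at h1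
  rw [Measure.map_apply hm ((hle A hA).inter (measurable_pi_apply (s t) hB)),
    Measure.map_map (hm2 _ _) hm, Measure.restrict_map hm (hle A hA)]
  have := h t ht _ hA' B hB
  rw [Set.preimage_inter]
  refine this.trans ?_
  exact (lintegral_map (f := fun x : ℤ → ℝ => stepKernel _ (x (s (t - 1))) B)
    ((measurable_stepKernel _ hB).comp (measurable_pi_apply _)) hm).symm

/-! ### Existence of back-and-forth tail chains -/

/-- The two-sided chain that is driven forward by the innovations with nonnegative index and
backward by those with negative index. -/
def twoSidedChain {T : Type*} (a : T → ℝ → ℝ) : ℤ → ℝ × (ℤ → T) → ℝ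
  | Int.ofNat n, q => chainPath (tailStep a) q.1 (fun k => q.2 (Int.ofNat k)) n
  -- `Int.negSucc n` is `-(n + 1)`, hence `n + 1` steps, driven by the innovations `-1, …, -(n +
  -- 1)`.
  | Int.negSucc n, q => chainPath (tailStep a) q.1 (fun k => q.2 (Int.negSucc k)) (n + 1)

theorem twoSidedChain_neg {T : Type*} (a : T → ℝ → ℝ) (n : ℕ) (q : ℝ × (ℤ → T)) :
    twoSidedChain a (-(n : ℤ)) q =
      chainPath (tailStep a) q.1 (fun k => q.2 (Int.negSucc k)) n := by
  cases n with
  | zero => rfl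
  | succ n => rfl

/-- The innovation with index `c n` enters first at step `n + 1`; injectivity of `c` rules out
earlier use. -/
theorem chainPath_update {T ι : Type*} [DecidableEq ι] (Ψ : ℝ → T → ℝ) (y : ℝ) (e : ι → T)
    {c : ℕ → ι} (hc : Function.Injective c) (n : ℕ) (v : T) :
    (∀ k ≤ n, chainPath Ψ y (fun k => Function.update e (c n) v (c k)) k =
      chainPath Ψ y (fun k => e (c k)) k) ∧
    chainPath Ψ y (fun k => Function.update e (c n) v (c k)) (n + 1) =
      Ψ (chainPath Ψ y (fun k => e (c k)) n) v := by
  have h : ∀ k ≤ n, chainPath Ψ y (fun k => Function.update e (c n) v (c k)) k =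
      chainPath Ψ y (fun k => e (c k)) k := fun k hk =>
    chainPath_congr Ψ y fun j hj =>
      Function.update_of_ne (fun hcj => (hj.trans_le hk).ne (hc hcj)) _ _
  refine ⟨h, ?_⟩
  rw [chainPath, h n le_rfl, Function.update_self]

section TwoSided

variable {T : Type*} [MeasurableSpace T]

theorem measurable_twoSidedChain {a : T → ℝ → ℝ} (ha : ∀ σ, Measurable fun v => a v σ) (t : ℤ) :
    Measurable (twoSidedChain a t) := by
  cases t with
  | ofNat n =>
    exact (measurable_chainPath (measurable_tailStep ha) n).comp
      (measurable_fst.prodMk (measurable_pi_lambda _ fun k =>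
        (measurable_pi_apply _).comp measurable_snd))
  | negSucc n =>
    exact (measurable_chainPath (measurable_tailStep ha) (n + 1)).comp
      (measurable_fst.prodMk (measurable_pi_lambda _ fun k =>
        (measurable_pi_apply _).comp measurable_snd))

theorem measurePreserving_update_snd {ι : Type*} [DecidableEq ι] (κ : ι → Measure T)
    [∀ i, IsProbabilityMeasure (κ i)] (ρ : Measure ℝ) [SFinite ρ] (i : ι) :
    MeasurePreserving (fun q : (ℝ × (ι → T)) × T => (q.1.1, Function.update q.1.2 i q.2))
      ((ρ.prod (Measure.infinitePi κ)).prod (κ i)) (ρ.prod (Measure.infinitePi κ)) :=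
  ((MeasurePreserving.id ρ).prod (measurePreserving_update κ i)).comp
    (measurePreserving_prodAssoc ρ (Measure.infinitePi κ) (κ i))

theorem isInnovDriven_chainPath {ι : Type*} [DecidableEq ι] {κ : ι → Measure T}
    [∀ i, IsProbabilityMeasure (κ i)] {κ₀ : Measure T} {a : T → ℝ → ℝ} {p : ℝ}
    (hp0 : 0 ≤ p) (hp1 : p ≤ 1)
    (ha : ∀ σ, Measurable fun v => a v σ) {c : ℕ → ι} (hc : Function.Injective c)
    (hκ : ∀ n, κ (c n) = κ₀) :
    IsInnovDriven ((signLaw p).prod (Measure.infinitePi κ)) p κ₀ a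
      (fun n q => chainPath (tailStep a) q.1 (fun k => q.2 (c k)) n)
      (fun n q => (q.1.1, Function.update q.1.2 (c n) q.2)) := by
  have hps := isProbabilityMeasure_signLaw hp0 hp1
  refine ⟨ha, fun n => ?_, ?_, fun n => ?_, fun n k hk ω v => ?_, fun n ω v => ?_⟩
  · exact (measurable_chainPath (measurable_tailStep ha) n).comp
      (measurable_fst.prodMk (measurable_pi_lambda _ fun k =>
        (measurable_pi_apply _).comp measurable_snd))
  · simp only [chainPath]
    exact Measure.fst_prod
  · rw [← hκ n]
    exact measurePreserving_update_snd κ (signLaw p) (c n)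
  · exact (chainPath_update (tailStep a) ω.1 ω.2 hc n v).1 k hk
  · exact (chainPath_update (tailStep a) ω.1 ω.2 hc n v).2

end TwoSided

/-- Back-and-forth tail chains exist. -/
theorem MemClass.exists_isBFTC {p α : ℝ} (hα : 0 < α) (hp0 : 0 ≤ p) (hp1 : p ≤ 1)
    {μ : Measure (ℝ × ℝ)} (h : MemClass p α μ) :
    ∃ Q : Measure (ℤ → ℝ), IsBFTC Q p α μ fun t x => x t := by
  have hadj := h.isAdjoint_adjointLaw hα hp0 hp1
  have hps := isProbabilityMeasure_signLaw hp0 hp1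
  obtain ⟨κ, hκ, hκμ⟩ := h.exists_tailStepLaw
  obtain ⟨κ', hκ', hκμ'⟩ := hadj.mem_right.exists_tailStepLaw
  have hmem := h
  have hmem' := hadj.mem_right
  rw [hκμ] at hmem
  rw [hκμ'] at hmem'
  -- Forward innovations represent `μ`, backward ones its adjoint.
  set K : ℤ → Measure (ℝ × ℝ) := fun i => if 0 ≤ i then κ else κ'
  have hK : ∀ i, IsProbabilityMeasure (K i) := fun i => by
    simp only [K]; split_ifs <;> assumption
  set Q₀ := (signLaw p).prod (Measure.infinitePi K) with hQ₀
  set Z := twoSidedChain pairCoef with hZdef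
  have hZ : ∀ t, Measurable (Z t) := measurable_twoSidedChain measurable_pairCoef
  have hZ' : ∀ t, Measurable (Z (-t)) := fun t => hZ _
  have hfw : IsInnovDriven Q₀ p κ pairCoef (fun n => Z (n : ℤ))
      (fun n q => (q.1.1, Function.update q.1.2 (Int.ofNat n) q.2)) :=
    isInnovDriven_chainPath hp0 hp1 measurable_pairCoef (c := Int.ofNat)
      (fun _ _ h => Int.ofNat.inj h) (fun n => if_pos (Int.natCast_nonneg n))
  have hbw : IsInnovDriven Q₀ p κ' pairCoef (fun n => Z (-(n : ℤ)))
      (fun n q => (q.1.1, Function.update q.1.2 (Int.negSucc n) q.2)) := by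
    have := isInnovDriven_chainPath hp0 hp1 measurable_pairCoef (κ := K) (κ₀ := κ')
      (c := Int.negSucc) (fun _ _ h => Int.negSucc.inj h)
      (fun n => if_neg (not_le.2 (Int.negSucc_lt_zero n)))
    have e : (fun (n : ℕ) (q : ℝ × (ℤ → ℝ × ℝ)) =>
        chainPath (tailStep pairCoef) q.1 (fun k => q.2 (Int.negSucc k)) n) =
        fun n : ℕ => Z (-(n : ℤ)) := by
      ext n q
      exact (twoSidedChain_neg _ _ _).symm
    rwa [e] at this
  -- The two half-lines share only the starting sign, so resampling on one side does not affect the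
  -- other. This gives the Markov property with respect to the whole two-sided past.
  have hcross1 : ∀ (n k : ℕ) (ω : ℝ × (ℤ → ℝ × ℝ)) (v : ℝ × ℝ),
      Z (Int.negSucc k) (ω.1, Function.update ω.2 (Int.ofNat n) v) = Z (Int.negSucc k) ω := by
    intro n k ω v
    refine chainPath_congr _ _ fun j _ => ?_
    have hne : Int.negSucc j ≠ Int.ofNat n := fun h => by cases h
    exact Function.update_of_ne hne v ω.2
  have hcross2 : ∀ (n k : ℕ) (ω : ℝ × (ℤ → ℝ × ℝ)) (v : ℝ × ℝ),
      Z (Int.ofNat k) (ω.1, Function.update ω.2 (Int.negSucc n) v) = Z (Int.ofNat k) ω := by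
    intro n k ω v
    refine chainPath_congr _ _ fun j _ => ?_
    have hne : Int.ofNat j ≠ Int.negSucc n := fun h => by cases h
    exact Function.update_of_ne hne v ω.2
  have hF : HasForwardTransitions Q₀ fun t => Z (id t) := by
    refine hfw.hasForwardTransitions hZ hmem fun n s hs ω v => ?_
    cases s with
    | ofNat k => exact hfw.invariant n k (by simpa using hs) ω v
    | negSucc k => exact hcross1 n k ω v
  have hB : HasForwardTransitions Q₀ fun t => Z (-t) := by
    refine hbw.hasForwardTransitions hZ' hmem' fun n s hs ω v => ?_
    cases s with
    | ofNat k => exact hbw.invariant n k (by simpa using hs) ω v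
    | negSucc k => exact hcross2 n (k + 1) ω v
  have hm : Measurable fun ω t => Z t ω := measurable_pi_lambda _ hZ
  have hpair : ∀ i j : ℤ, Measurable fun x : ℤ → ℝ => (x i, x j) := fun i j =>
    (measurable_pi_apply i).prodMk (measurable_pi_apply j)
  refine ⟨Q₀.map fun ω t => Z t ω, ⟨Measure.isProbabilityMeasure_map hm.aemeasurable,
    fun t => measurable_pi_apply t, ?_, ?_, hF.of_map hZ, hB.of_map hZ⟩⟩
  · rw [Measure.map_map (hpair 0 1) hm, hκμ]
    exact hfw.law
  · rw [Measure.map_map (hpair 0 (-1)) hm]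
    have : Q₀.map ((fun x : ℤ → ℝ => (x 0, x (-1))) ∘ fun ω t => Z t ω) = adjointLaw p α μ := by
      rw [hκμ']
      exact hbw.law
    rw [this]
    exact hadj

/-! ### Transition operator and rectangle probabilities -/

/-- The transition operator of the tail chain with two-step law `μ`. -/
def tailOp (μ : Measure (ℝ × ℝ)) (f : ℝ → ENNReal) (x : ℝ) : ENNReal := ∫⁻ y, f y ∂stepKernel μ x

theorem measurable_tailOp (μ : Measure (ℝ × ℝ)) [IsFiniteMeasure μ] {f : ℝ → ENNReal}
    (hf : Measurable f) : Measurable (tailOp μ f) := measurable_lintegral_stepKernel μ hf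

/-- Positive scaling keeps the sign that selects the conditional law. This lets the radius `z` pass
through the transitions of the chain. -/
theorem stepKernel_mul (μ : Measure (ℝ × ℝ)) {c : ℝ} (hc : 0 < c) (x : ℝ) :
    stepKernel μ (c * x) = (stepKernel μ x).map (c * ·) := by
  rcases eq_or_ne x 0 with h | h
  · rw [h, mul_zero, stepKernel, if_pos rfl, Measure.map_dirac' (measurable_const_mul c), mul_zero]
  · have hq : Measurable fun q : ℝ × ℝ => x * (q.2 / q.1) :=
      (measurable_snd.div measurable_fst).const_mul x
    rw [stepKernel, stepKernel, if_neg h, if_neg (mul_ne_zero hc.ne' h), sign_mul_of_pos hc,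
      Measure.map_map (measurable_const_mul c) hq]
    congr 1
    ext q
    simp only [Function.comp, mul_assoc]

theorem tailOp_comp_mul (μ : Measure (ℝ × ℝ)) {c : ℝ} (hc : 0 < c) {f : ℝ → ENNReal}
    (hf : Measurable f) (x : ℝ) : tailOp μ (fun y => f (c * y)) x = tailOp μ f (c * x) := by
  rw [tailOp, tailOp, stepKernel_mul μ hc, lintegral_map hf (measurable_const_mul c)]

/-- The probability of staying in `B n, …, B (n + k)` for the tail chain at time `n`. -/
def rectFun (μ : Measure (ℝ × ℝ)) (B : ℕ → Set ℝ) : ℕ → ℕ → ℝ → ENNReal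
  | 0, n => (B n).indicator 1
  | k + 1, n => (B n).indicator (tailOp μ (rectFun μ B k (n + 1)))

theorem measurable_rectFun (μ : Measure (ℝ × ℝ)) [IsFiniteMeasure μ] {B : ℕ → Set ℝ}
    (hB : ∀ n, MeasurableSet (B n)) (k : ℕ) : ∀ n, Measurable (rectFun μ B k n) := by
  induction k with
  | zero => exact fun n => measurable_one.indicator (hB n)
  | succ k ih => exact fun n => (measurable_tailOp μ (ih (n + 1))).indicator (hB n)

/-- A Markov chain with the transitions of a tail chain; the Markov property is stated for
rectangles in the past. -/
structure IsTailMarkov {Ω : Type*} [MeasurableSpace Ω] (Q : Measure Ω) (p : ℝ)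
    (μ : Measure (ℝ × ℝ)) (N : ℕ → Ω → ℝ) : Prop where
  measurable : ∀ n, Measurable (N n)
  law_zero : Q.map (N 0) = signLaw p
  transition : ∀ (n : ℕ) (B : ℕ → Set ℝ), (∀ i, MeasurableSet (B i)) → ∀ C, MeasurableSet C →
    Q ({ω | ∀ i < n + 1, N i ω ∈ B i} ∩ N (n + 1) ⁻¹' C) =
      ∫⁻ ω in {ω | ∀ i < n + 1, N i ω ∈ B i}, stepKernel μ (N n ω) C ∂Q

section Markov

variable {Ω : Type*} [MeasurableSpace Ω] {Q : Measure Ω} {p α : ℝ} {μ : Measure (ℝ × ℝ)}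
  {N : ℕ → Ω → ℝ}

theorem measurableSet_rect (hN : ∀ n, Measurable (N n)) {B : ℕ → Set ℝ}
    (hB : ∀ i, MeasurableSet (B i)) (n : ℕ) : MeasurableSet {ω | ∀ i < n, N i ω ∈ B i} := by
  have : {ω | ∀ i < n, N i ω ∈ B i} = ⋂ i, ⋂ (_ : i < n), N i ⁻¹' B i := by
    ext ω
    simp
  rw [this]
  exact MeasurableSet.iInter fun i => MeasurableSet.iInter fun _ => hN i (hB i)

theorem IsTailMarkov.lintegral_transition [IsFiniteMeasure μ] (h : IsTailMarkov Q p μ N) (n : ℕ)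
    {B : ℕ → Set ℝ} (hB : ∀ i, MeasurableSet (B i)) {f : ℝ → ENNReal} (hf : Measurable f) :
    ∫⁻ ω in {ω | ∀ i < n + 1, N i ω ∈ B i}, f (N (n + 1) ω) ∂Q =
      ∫⁻ ω in {ω | ∀ i < n + 1, N i ω ∈ B i}, tailOp μ f (N n ω) ∂Q := by
  set A := {ω | ∀ i < n + 1, N i ω ∈ B i}
  have hk : Measurable fun ω => stepKernel μ (N n ω) :=
    (Measure.measurable_of_measurable_coe _ fun C hC => measurable_stepKernel μ hC).comp
      (h.measurable n)
  have heq : (Q.restrict A).map (N (n + 1)) = (Q.restrict A).bind fun ω => stepKernel μ (N n ω) :=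
    by
    ext C hC
    rw [Measure.map_apply (h.measurable _) hC, Measure.bind_apply hC hk.aemeasurable,
      Measure.restrict_apply (h.measurable _ hC), Set.inter_comm, h.transition n B hB C hC]
  rw [← lintegral_map hf (h.measurable (n + 1)), heq,
    Measure.lintegral_bind hk.aemeasurable hf.aemeasurable]
  rfl

/-- Each use of the Markov property exchanges one application of the transition operator for one
more coordinate of the path; homogeneity makes the same operator serve for the scaled chain `z N`.
-/
theorem IsTailMarkov.lintegral_rectFun [IsFiniteMeasure μ] (h : IsTailMarkov Q p μ N)
    {B : ℕ → Set ℝ} (hB : ∀ i, MeasurableSet (B i)) {z : ℝ} (hz : 0 < z) (k : ℕ) : ∀ n,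
    ∫⁻ ω in {ω | ∀ i < n, z * N i ω ∈ B i}, rectFun μ B k n (z * N n ω) ∂Q =
      Q {ω | ∀ i < n + k + 1, z * N i ω ∈ B i} := by
  have hBz : ∀ i, MeasurableSet ((z * ·) ⁻¹' B i) := fun i => measurable_const_mul z (hB i)
  have hsucc : ∀ n, {ω | ∀ i < n, z * N i ω ∈ B i} ∩ {ω | z * N n ω ∈ B n} =
      {ω | ∀ i < n + 1, z * N i ω ∈ B i} := by
    intro n
    ext ω
    simp only [Set.mem_inter_iff, Set.mem_ofPred_eq, Nat.lt_succ_iff_lt_or_eq]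
    constructor
    · rintro ⟨h1, h2⟩ i (hi | rfl)
      exacts [h1 i hi, h2]
    · exact fun h => ⟨fun i hi => h i (Or.inl hi), h n (Or.inr rfl)⟩
  have hm : ∀ n, MeasurableSet {ω | z * N n ω ∈ B n} := fun n => h.measurable n (hBz n)
  have hind : ∀ n (g : ℝ → ENNReal), ∫⁻ ω in {ω | ∀ i < n, z * N i ω ∈ B i},
      (B n).indicator g (z * N n ω) ∂Q =
      ∫⁻ ω in {ω | ∀ i < n + 1, z * N i ω ∈ B i}, g (z * N n ω) ∂Q := by
    intro n g
    rw [← hsucc n, Set.inter_comm, ← Measure.restrict_restrict (hm n), ← lintegral_indicator (hm n)]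
    rfl
  induction k with
  | zero =>
    intro n
    rw [rectFun, hind n]
    simp
  | succ k ih =>
    intro n
    rw [rectFun, hind n]
    have h1 : ∀ ω, tailOp μ (rectFun μ B k (n + 1)) (z * N n ω) =
        tailOp μ (fun y => rectFun μ B k (n + 1) (z * y)) (N n ω) := fun ω =>
      (tailOp_comp_mul μ hz (measurable_rectFun μ hB k _) _).symm
    simp only [h1]
    have h2 := h.lintegral_transition n (B := fun i => (z * ·) ⁻¹' B i) hBz
      (f := fun y => rectFun μ B k (n + 1) (z * y))
      ((measurable_rectFun μ hB k _).comp (measurable_const_mul z))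
    refine h2.symm.trans ((ih (n + 1)).trans ?_)
    rw [show n + 1 + k + 1 = n + (k + 1) + 1 by ring]

theorem IsTailMarkov.measure_rect [IsFiniteMeasure μ] (h : IsTailMarkov Q p μ N)
    {B : ℕ → Set ℝ} (hB : ∀ i, MeasurableSet (B i)) {z : ℝ} (hz : 0 < z) (k : ℕ) :
    Q {ω | ∀ i < k + 1, z * N i ω ∈ B i} = ∫⁻ σ, rectFun μ B k 0 (z * σ) ∂signLaw p := by
  have h1 := h.lintegral_rectFun hB hz k 0
  simp only [Nat.not_lt_zero, IsEmpty.forall_iff, implies_true, Set.ofPred_true,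
    Measure.restrict_univ, zero_add] at h1
  have hm : Measurable fun σ => rectFun μ B k 0 (z * σ) :=
    (measurable_rectFun μ hB k 0).comp (measurable_const_mul z)
  rw [← h1, ← h.law_zero, lintegral_map hm (h.measurable 0)]

/-- Extension of a finite family of sets to a sequence of sets. -/
def extendSets {t : ℕ} (s : Fin (t + 1) → Set ℝ) (i : ℕ) : Set ℝ :=
  if h : i < t + 1 then s ⟨i, h⟩ else Set.univ

theorem extendSets_val {t : ℕ} (s : Fin (t + 1) → Set ℝ) (i : Fin (t + 1)) :
    extendSets s i = s i := by rw [extendSets, dif_pos i.2]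

theorem measurableSet_extendSets {t : ℕ} {s : Fin (t + 1) → Set ℝ}
    (hs : ∀ i, MeasurableSet (s i)) (i : ℕ) : MeasurableSet (extendSets s i) := by
  unfold extendSets
  split_ifs
  exacts [hs _, MeasurableSet.univ]

theorem forall_lt_extendSets {t : ℕ} (s : Fin (t + 1) → Set ℝ) (x : ℕ → ℝ) :
    (∀ i < t + 1, x i ∈ extendSets s i) ↔ ∀ i : Fin (t + 1), x i ∈ s i := by
  constructor
  · intro h i
    rw [← extendSets_val s i]
    exact h i i.2
  · intro h i hi
    rw [extendSets, dif_pos hi]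
    exact h ⟨i, hi⟩

/-- By `IsTailMarkov.measure_rect` the probabilities of rectangles depend on `p` and `μ` only, and
rectangles determine the law. -/
theorem IsTailMarkov.map_eq [IsFiniteMeasure μ] {Ω' : Type*} [MeasurableSpace Ω']
    {Q' : Measure Ω'} {N' : ℕ → Ω' → ℝ} [IsFiniteMeasure Q] (h : IsTailMarkov Q p μ N)
    (h' : IsTailMarkov Q' p μ N') (t : ℕ) :
    Q.map (fun ω (i : Fin (t + 1)) => N i ω) = Q'.map fun ω (i : Fin (t + 1)) => N' i ω := by
  have hm : Measurable fun ω (i : Fin (t + 1)) => N i ω :=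
    measurable_pi_lambda _ fun i => h.measurable i
  have hm' : Measurable fun ω (i : Fin (t + 1)) => N' i ω :=
    measurable_pi_lambda _ fun i => h'.measurable i
  have hrect : ∀ s : Fin (t + 1) → Set ℝ, (∀ i, MeasurableSet (s i)) →
      Q.map (fun ω (i : Fin (t + 1)) => N i ω) (Set.univ.pi s) =
      Q'.map (fun ω (i : Fin (t + 1)) => N' i ω) (Set.univ.pi s) := by
    intro s hs
    rw [Measure.map_apply hm (MeasurableSet.univ_pi hs),
      Measure.map_apply hm' (MeasurableSet.univ_pi hs)]
    have e1 := h.measure_rect (measurableSet_extendSets hs) one_pos t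
    have e2 := h'.measure_rect (measurableSet_extendSets hs) one_pos t
    simp only [one_mul] at e1 e2
    simp only [forall_lt_extendSets s (fun i => N i _)] at e1
    simp only [forall_lt_extendSets s (fun i => N' i _)] at e2
    have f1 : (fun ω (i : Fin (t + 1)) => N i ω) ⁻¹' Set.univ.pi s =
        {ω | ∀ i : Fin (t + 1), N i ω ∈ s i} := by ext ω; simp
    have f2 : (fun ω (i : Fin (t + 1)) => N' i ω) ⁻¹' Set.univ.pi s =
        {ω | ∀ i : Fin (t + 1), N' i ω ∈ s i} := by ext ω; simp
    rw [f1, f2, e1, e2]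
  refine ext_of_generate_finite _ generateFrom_pi.symm isPiSystem_pi ?_ ?_
  · rintro _ ⟨s, hs, rfl⟩
    exact hrect s fun i => hs i (Set.mem_univ i)
  · rw [← Set.pi_univ Set.univ]
    exact hrect _ fun i => MeasurableSet.univ

theorem polarLaw_eq_map [SFinite Q] {d : ℕ} {V : Fin d → Ω → ℝ} (hV : ∀ i, Measurable (V i)) :
    polarLaw α Q V = ((powMeasure α).prod (Q.map fun ω i => V i ω)).map
      fun q i => q.1 * q.2 i := by
  have hm : Measurable fun ω i => V i ω := measurable_pi_lambda _ hV
  have hm2 : Measurable fun (q : ℝ × (Fin d → ℝ)) (i : Fin d) => q.1 * q.2 i := by fun_prop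
  have h1 : (powMeasure α).prod (Q.map fun ω i => V i ω) =
      ((powMeasure α).prod Q).map (Prod.map id fun ω i => V i ω) := by
    rw [← Measure.map_prod_map _ _ measurable_id hm, Measure.map_id]
  rw [h1, Measure.map_map hm2 (measurable_id.prodMap hm), polarLaw]
  rfl

theorem IsTailMarkov.polarLaw_eq [IsFiniteMeasure μ] {Ω' : Type*} [MeasurableSpace Ω']
    {Q' : Measure Ω'} {N' : ℕ → Ω' → ℝ} [IsFiniteMeasure Q] [IsFiniteMeasure Q']
    (h : IsTailMarkov Q p μ N) (h' : IsTailMarkov Q' p μ N') (α : ℝ) (t : ℕ) :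
    polarLaw α Q (fun i : Fin (t + 1) => N i) = polarLaw α Q' fun i : Fin (t + 1) => N' i := by
  rw [polarLaw_eq_map fun i => h.measurable _, polarLaw_eq_map fun i => h'.measurable _,
    h.map_eq h' t]

theorem MemClass.map_fst (h : MemClass p α μ) : μ.map Prod.fst = signLaw p := by
  have := h.isProbability
  ext B hB
  rw [Measure.map_apply measurable_fst hB, signLaw, Measure.add_apply, Measure.smul_apply,
    Measure.smul_apply, Measure.dirac_apply' _ hB, Measure.dirac_apply' _ hB]
  have h1 : μ (Prod.fst ⁻¹' B) = μ ({q | q.1 = 1} ∩ Prod.fst ⁻¹' B) +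
      μ ({q | q.1 = -1} ∩ Prod.fst ⁻¹' B) := by
    rw [← measure_union _ ((measurableSet_fst_eq _).inter (measurable_fst hB))]
    · refine measure_congr ?_
      filter_upwards [h.support] with q hq
      refine propext ⟨fun hqE => ?_, fun hqE => ?_⟩
      · rcases hq with h1 | h1
        · exact Or.inl ⟨h1, hqE⟩
        · exact Or.inr ⟨h1, hqE⟩
      · rcases hqE with h1 | h1 <;> exact h1.2
    · rw [Set.disjoint_left]
      rintro q ⟨h1, _⟩ ⟨h2, _⟩
      have h1 : q.1 = 1 := h1
      have h2 : q.1 = -1 := h2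
      rw [h1] at h2
      norm_num at h2
  have h2 : ∀ σ : ℝ, μ ({q | q.1 = σ} ∩ Prod.fst ⁻¹' B) = μ {q | q.1 = σ} * B.indicator 1 σ := by
    intro σ
    by_cases hσ : σ ∈ B
    · rw [Set.indicator_of_mem hσ, Pi.one_apply, mul_one]
      congr 1
      ext q
      simp only [Set.mem_inter_iff, Set.mem_ofPred_eq, Set.mem_preimage, and_iff_left_iff_imp]
      rintro rfl
      exact hσ
    · rw [Set.indicator_of_notMem hσ, mul_zero]
      convert measure_empty (μ := μ)
      ext q
      simp only [Set.mem_inter_iff, Set.mem_ofPred_eq, Set.mem_preimage, Set.mem_empty_iff_false,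
        iff_false, not_and]
      rintro rfl
      exact hσ
  rw [h1, h2, h2, h.prob_one, h.prob_neg_one]
  rfl

theorem HasForwardTransitions.isTailMarkov {Z : ℤ → Ω → ℝ} (hZ : ∀ t, Measurable (Z t))
    (h : HasForwardTransitions Q Z)
    (hmem : MemClass p α (Q.map fun ω => (Z 0 ω, Z 1 ω))) :
    IsTailMarkov Q p (Q.map fun ω => (Z 0 ω, Z 1 ω)) fun n => Z n := by
  refine ⟨fun n => hZ n, ?_, fun n B hB C hC => ?_⟩
  · rw [← hmem.map_fst, Measure.map_map measurable_fst ((hZ 0).prodMk (hZ 1))]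
    rfl
  · have hA : MeasurableSet[⨆ s ∈ Set.Iio ((n : ℤ) + 1),
        MeasurableSpace.comap (Z s) inferInstance] {ω | ∀ i < n + 1, Z (i : ℤ) ω ∈ B i} := by
      have : {ω | ∀ i < n + 1, Z (i : ℤ) ω ∈ B i} =
          ⋂ i : ℕ, ⋂ (_ : i < n + 1), Z (i : ℤ) ⁻¹' B i := by
        ext ω
        simp
      rw [this]
      refine MeasurableSet.iInter fun i => MeasurableSet.iInter fun hi => ?_
      have hle : MeasurableSpace.comap (Z (i : ℤ)) inferInstance ≤
          ⨆ s ∈ Set.Iio ((n : ℤ) + 1), MeasurableSpace.comap (Z s) inferInstance :=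
        le_iSup₂_of_le (i : ℤ) (by simp only [Set.mem_Iio]; omega) le_rfl
      exact hle _ ⟨B i, hB i, rfl⟩
    have := h (n + 1) (by omega) _ hA C hC
    simpa only [Nat.cast_add, Nat.cast_one, add_sub_cancel_right] using this

theorem IsInnovDriven.isTailMarkov {T : Type*} [MeasurableSpace T] {κ : Measure T}
    [IsProbabilityMeasure κ] {a : T → ℝ → ℝ} {upd : ℕ → Ω × T → Ω}
    (h : IsInnovDriven Q p κ a N upd) (hmem : MemClass p α (tailStepLaw p κ a)) :
    IsTailMarkov Q p (tailStepLaw p κ a) N := by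
  refine ⟨h.measurable, h.law_zero, fun n B hB C hC => ?_⟩
  refine h.transition hmem n (measurableSet_rect h.measurable hB _) (fun ω v => ?_) hC
  refine forall₂_congr fun i hi => ?_
  rw [h.invariant n i (Nat.lt_succ_iff.1 hi)]

end Markov

/-! ### Adjointness as an identity of measures off the axes -/

/-- The ray of the `u` with `1 < s u`. -/
def ray (s : ℝ) : Set ℝ := {u | 1 < s * u}

theorem measurableSet_ray (s : ℝ) : MeasurableSet (ray s) :=
  measurableSet_lt measurable_const (measurable_const_mul s)

theorem ray_inter (s r : ℝ) : ∃ c, ray s ∩ ray r = ray c := by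
  have hz : ray 0 = ∅ := by
    ext u
    simp [ray]
  have key : ∀ a b : ℝ, 0 < a → 0 < b → ∀ σ : ℝ, ray (σ * a) ∩ ray (σ * b) = ray (σ * min a b) := by
    intro a b ha hb σ
    ext u
    simp only [ray, Set.mem_inter_iff, Set.mem_ofPred_eq]
    constructor
    · rintro ⟨h1, h2⟩
      rcases min_choice a b with h | h <;> rw [h] <;> assumption
    · intro h
      have hm : 0 < min a b := lt_min ha hb
      have hu : 0 < σ * u := by
        have : 0 < min a b * (σ * u) := by nlinarith
        exact (pos_iff_pos_of_mul_pos this).1 hm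
      constructor
      · nlinarith [min_le_left a b, mul_le_mul_of_nonneg_right (min_le_left a b) hu.le]
      · nlinarith [min_le_right a b, mul_le_mul_of_nonneg_right (min_le_right a b) hu.le]
  have hdisj : ∀ a b : ℝ, 0 < a → b < 0 → ray a ∩ ray b = ray 0 := by
    intro a b ha hb
    rw [hz]
    ext u
    simp only [ray, Set.mem_inter_iff, Set.mem_ofPred_eq, Set.mem_empty_iff_false, iff_false,
      not_and, not_lt]
    intro h
    have : 0 < u := by
      by_contra! hn
      nlinarith
    nlinarith
  rcases lt_trichotomy s 0 with hs | rfl | hs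
  · rcases lt_trichotomy r 0 with hr | rfl | hr
    · have := key (-s) (-r) (by linarith) (by linarith) (-1)
      rw [neg_one_mul, neg_one_mul, neg_neg, neg_neg] at this
      exact ⟨_, this⟩
    · exact ⟨0, by rw [hz, Set.inter_empty]⟩
    · exact ⟨0, by rw [Set.inter_comm, hdisj r s hr hs]⟩
  · exact ⟨0, by rw [hz, Set.empty_inter]⟩
  · rcases lt_trichotomy r 0 with hr | rfl | hr
    · exact ⟨0, hdisj s r hs hr⟩
    · exact ⟨0, by rw [hz, Set.inter_empty]⟩
    · have := key s r hs hr 1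
      rw [one_mul, one_mul] at this
      exact ⟨_, this⟩

theorem generateFrom_ray :
    MeasurableSpace.generateFrom (insert Set.univ (Set.range ray)) = (inferInstance :
      MeasurableSpace ℝ) := by
  refine le_antisymm (MeasurableSpace.generateFrom_le ?_) ?_
  · rintro _ (rfl | ⟨s, rfl⟩)
    exacts [MeasurableSet.univ, measurableSet_ray s]
  · have hR : ∀ s, MeasurableSet[MeasurableSpace.generateFrom (insert Set.univ (Set.range ray))]
        (ray s) := fun s => MeasurableSpace.measurableSet_generateFrom (Or.inr ⟨s, rfl⟩)
    rw [BorelSpace.measurable_eq (α := ℝ), borel_eq_generateFrom_Ioi]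
    refine MeasurableSpace.generateFrom_le ?_
    rintro _ ⟨a, rfl⟩
    rcases le_or_gt 0 a with ha | ha
    · have : Set.Ioi a = ⋃ (q : ℚ) (_ : a < q), ray (q : ℝ)⁻¹ := by
        ext u
        simp only [Set.mem_Ioi, Set.mem_iUnion, exists_prop, ray, Set.mem_ofPred_eq]
        constructor
        · intro h
          obtain ⟨q, h1, h2⟩ := exists_rat_btwn h
          refine ⟨q, h1, ?_⟩
          rw [inv_mul_eq_div, one_lt_div (ha.trans_lt h1)]
          exact h2
        · rintro ⟨q, h1, h2⟩
          rw [inv_mul_eq_div, one_lt_div (ha.trans_lt h1)] at h2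
          exact h1.trans h2
      rw [this]
      exact MeasurableSet.iUnion fun q => MeasurableSet.iUnion fun _ => hR _
    · have : Set.Ioi a = ⋃ (q : ℚ) (_ : a < q ∧ (q : ℝ) < 0), (ray (q : ℝ)⁻¹)ᶜ := by
        have aux : ∀ q : ℚ, (q : ℝ) < 0 → ∀ u : ℝ, 1 < (q : ℝ)⁻¹ * u ↔ u < q := by
          intro q hq u
          rw [inv_mul_eq_div, lt_div_iff_of_neg hq, one_mul]
        ext u
        simp only [Set.mem_Ioi, Set.mem_iUnion, exists_prop, ray, Set.mem_ofPred_eq,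
          Set.mem_compl_iff]
        constructor
        · intro h
          obtain ⟨q, h1, h2⟩ := exists_rat_btwn (lt_min h ha)
          have hq : (q : ℝ) < 0 := h2.trans_le (min_le_right _ _)
          refine ⟨q, ⟨h1, hq⟩, ?_⟩
          rw [aux q hq, not_lt]
          exact h2.le.trans (min_le_left _ _)
        · rintro ⟨q, ⟨h1, h2⟩, h3⟩
          rw [aux q h2, not_lt] at h3
          exact h1.trans_le h3
      rw [this]
      exact MeasurableSet.iUnion fun q => MeasurableSet.iUnion fun _ => (hR _).compl

theorem exists_mem_ray {u : ℝ} (hu : u ≠ 0) : ∃ n : ℤ, u ∈ ray n := by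
  obtain ⟨n, hn⟩ := exists_nat_gt |u|⁻¹
  have h1 : 1 < n * |u| := by
    rwa [inv_lt_iff_one_lt_mul₀ (abs_pos.2 hu)] at hn
  rcases abs_choice u with h | h
  · exact ⟨n, by simpa [ray, h] using h1⟩
  · exact ⟨-n, by simpa [ray, h] using h1⟩

/-- The pairs with nonzero coordinates. -/
def offAxes : Set (ℝ × ℝ) := {u | u.1 ≠ 0 ∧ u.2 ≠ 0}

theorem measurableSet_offAxes : MeasurableSet offAxes :=
  (measurable_fst (measurableSet_singleton 0).compl).inter
    (measurable_snd (measurableSet_singleton 0).compl)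

theorem ray_prod_subset (s r : ℝ) : ray s ×ˢ ray r ⊆ offAxes := by
  rintro ⟨u, v⟩ ⟨h1, h2⟩
  have h1 : 1 < s * u := h1
  have h2 : 1 < r * v := h2
  constructor <;> rintro (rfl : _ = (0 : ℝ))
  · norm_num at h1
  · norm_num at h2

/-- Products of rays are stable under intersection and generate the σ-algebra once `univ` is
adjoined; products with integer slopes have finite mass and cover the plane off the axes. The axes
join the cover as a null set of the restricted measures. -/
theorem restrict_offAxes_eq {ν₁ ν₂ : Measure (ℝ × ℝ)}
    (h : ∀ s r, ν₁ (ray s ×ˢ ray r) = ν₂ (ray s ×ˢ ray r))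
    (hfin : ∀ s r, ν₁ (ray s ×ˢ ray r) ≠ ⊤) : ν₁.restrict offAxes = ν₂.restrict offAxes := by
  set D : Set (Set ℝ) := insert Set.univ (Set.range ray)
  have hspan : IsCountablySpanning D :=
    ⟨fun _ => Set.univ, fun _ => Set.mem_insert _ _, Set.iUnion_const _⟩
  have hgen := generateFrom_eq_prod generateFrom_ray generateFrom_ray hspan hspan
  have hD : IsPiSystem D := by
    rintro _ (rfl | ⟨s, rfl⟩) _ (rfl | ⟨r, rfl⟩) _
    · rw [Set.univ_inter]; exact Set.mem_insert _ _
    · rw [Set.univ_inter]; exact Or.inr ⟨r, rfl⟩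
    · rw [Set.inter_univ]; exact Or.inr ⟨s, rfl⟩
    · obtain ⟨c, hc⟩ := ray_inter s r
      exact Or.inr ⟨c, hc.symm⟩
  have hmr : ∀ s r, MeasurableSet (ray s ×ˢ ray r) := fun s r =>
    (measurableSet_ray s).prod (measurableSet_ray r)
  have hres : ∀ (ν : Measure (ℝ × ℝ)) s r,
      ν.restrict offAxes (ray s ×ˢ ray r) = ν (ray s ×ˢ ray r) := fun ν s r => by
    rw [Measure.restrict_apply (hmr s r), Set.inter_eq_left.2 (ray_prod_subset s r)]
  have hz : ∀ (ν : Measure (ℝ × ℝ)) (A : Set (ℝ × ℝ)), A ⊆ offAxesᶜ → ν.restrict offAxes A = 0 := by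
    intro ν A hA
    refine measure_mono_null hA ?_
    rw [Measure.restrict_apply measurableSet_offAxes.compl, Set.compl_inter_self, measure_empty]
  set T : Set (Set (ℝ × ℝ)) :=
    insert offAxesᶜ (Set.range fun n : ℤ × ℤ => ray n.1 ×ˢ ray n.2) with hT
  refine Measure.ext_of_generateFrom_of_cover (T := T) hgen.symm
    ((Set.countable_range _).insert _) (hD.prod hD) ?_ ?_ ?_ ?_
  · refine Set.eq_univ_of_forall fun u => ?_
    by_cases hu : u ∈ offAxes
    · obtain ⟨n, hn⟩ := exists_mem_ray hu.1
      obtain ⟨m, hm⟩ := exists_mem_ray hu.2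
      exact ⟨_, Or.inr ⟨(n, m), rfl⟩, hn, hm⟩
    · exact ⟨_, Or.inl rfl, hu⟩
  · rintro _ (rfl | ⟨n, rfl⟩)
    · rw [hz _ _ subset_rfl]
      exact ENNReal.zero_ne_top
    · simp only [hres]
      exact hfin _ _
  · rintro _ (rfl | ⟨n, rfl⟩) _ ⟨E, hE, F, hF, rfl⟩
    · rw [hz _ _ Set.inter_subset_right, hz _ _ Set.inter_subset_right]
    · have hint : ∀ E ∈ D, ∀ s, ∃ c, E ∩ ray s = ray c := by
        rintro _ (rfl | ⟨r, rfl⟩) s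
        · exact ⟨s, Set.univ_inter _⟩
        · exact ray_inter r s
      obtain ⟨c, hc⟩ := hint E hE n.1
      obtain ⟨d, hd⟩ := hint F hF n.2
      simp only [Set.prod_inter_prod, hc, hd, hres, h]
  · rintro _ (rfl | ⟨n, rfl⟩)
    · rw [hz _ _ subset_rfl, hz _ _ subset_rfl]
    · simp only [hres, h]

/-- The law of `(z I, z M)` for `z` distributed according to `d(-z^{-α})` and `(I, M)` according to
`μ`. -/
def polarPair (α : ℝ) (μ : Measure (ℝ × ℝ)) : Measure (ℝ × ℝ) :=
  ((powMeasure α).prod μ).map fun q => (q.1 * q.2.1, q.1 * q.2.2)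

theorem measurable_polarPair_map :
    Measurable fun q : ℝ × (ℝ × ℝ) => (q.1 * q.2.1, q.1 * q.2.2) := by fun_prop

theorem posPow_min {α : ℝ} (hα : 0 < α) (a b : ℝ) :
    posPow α (min a b) = min (posPow α a) (posPow α b) := by
  have hm : Monotone (posPow α) := fun x y hxy => ENNReal.ofReal_le_ofReal
    (Real.rpow_le_rpow (le_max_right _ _) (max_le_max_right 0 hxy) hα.le)
  exact hm.map_min

theorem powMeasure_lt_mul_and {α : ℝ} (hα : 0 < α) (a b : ℝ) :
    powMeasure α {z | 1 < z * a ∧ 1 < z * b} = min (posPow α a) (posPow α b) := by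
  rw [← posPow_min hα]
  have h := powMeasure_lt_mul hα one_pos (min a b)
  rw [Real.one_rpow, ENNReal.ofReal_one, one_mul] at h
  rw [← h]
  refine measure_congr ?_
  filter_upwards [ae_powMeasure_pos α] with z hz
  refine propext ?_
  change (1 < z * a ∧ 1 < z * b) ↔ 1 < z * min a b
  rw [mul_min_of_nonneg _ _ hz.le, lt_min_iff]

/-- For a fixed pair, both inequalities on the radius combine into one with the smaller coefficient,
so the mass is the minimum of the two powers. This is the quantity that occurs in the definition of
adjointness. -/
theorem polarPair_ray {α : ℝ} (hα : 0 < α) (μ : Measure (ℝ × ℝ)) [SFinite μ] (s r : ℝ) :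
    polarPair α μ (ray s ×ˢ ray r) = ∫⁻ q, min (posPow α (s * q.1)) (posPow α (r * q.2)) ∂μ := by
  have hm : MeasurableSet (ray s ×ˢ ray r) := (measurableSet_ray s).prod (measurableSet_ray r)
  rw [polarPair, Measure.map_apply measurable_polarPair_map hm,
    Measure.prod_apply_symm (measurable_polarPair_map hm)]
  refine lintegral_congr fun q => ?_
  rw [← powMeasure_lt_mul_and hα]
  congr 1
  ext z
  simp only [ray, Set.mem_preimage, Set.mem_prod, Set.mem_ofPred_eq]
  rw [mul_left_comm, mul_left_comm r]

theorem polarPair_ray_ne_top {p α : ℝ} (hα : 0 < α) {μ : Measure (ℝ × ℝ)} (h : MemClass p α μ)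
    (s r : ℝ) : polarPair α μ (ray s ×ˢ ray r) ≠ ⊤ := by
  have := h.isProbability
  rw [polarPair_ray hα]
  refine ne_top_of_le_ne_top (b := ENNReal.ofReal (|s| ^ α)) ENNReal.ofReal_ne_top ?_
  calc ∫⁻ q, min (posPow α (s * q.1)) (posPow α (r * q.2)) ∂μ
      ≤ ∫⁻ _, ENNReal.ofReal (|s| ^ α) ∂μ := by
        refine lintegral_mono_ae ?_
        filter_upwards [h.support] with q hq
        refine (min_le_left _ _).trans (ENNReal.ofReal_le_ofReal
          (Real.rpow_le_rpow (le_max_right _ _) (max_le ?_ (abs_nonneg s)) hα.le))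
        rcases hq with h | h <;> rw [h]
        · rw [mul_one]; exact le_abs_self s
        · rw [mul_neg_one]; exact neg_le_abs s
    _ = ENNReal.ofReal (|s| ^ α) := by simp

theorem IsAdjoint.symm {p α : ℝ} {μ μ' : Measure (ℝ × ℝ)} (h : IsAdjoint p α μ μ') :
    IsAdjoint p α μ' μ := by
  refine ⟨h.mem_right, h.mem_left, fun x y => ?_⟩
  have := h.adjoint y x
  simp only [min_comm (posPow α (x * _))]
  exact this.symm

/-- The adjoint relation is this identity evaluated on products of rays, which determine measures
off the axes. -/
theorem IsAdjoint.restrict_polarPair {p α : ℝ} (hα : 0 < α) {μ μ' : Measure (ℝ × ℝ)}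
    (h : IsAdjoint p α μ μ') :
    (polarPair α μ).restrict offAxes = ((polarPair α μ').map Prod.swap).restrict offAxes := by
  have := h.mem_left.isProbability
  have := h.mem_right.isProbability
  refine restrict_offAxes_eq (fun s r => ?_) (polarPair_ray_ne_top hα h.mem_left)
  rw [Measure.map_apply measurable_swap ((measurableSet_ray s).prod (measurableSet_ray r)),
    Set.preimage_swap_prod, polarPair_ray hα, polarPair_ray hα, h.adjoint]
  simp only [min_comm (posPow α (s * _))]

theorem IsAdjoint.lintegral_polarPair {p α : ℝ} (hα : 0 < α) {μ μ' : Measure (ℝ × ℝ)}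
    (h : IsAdjoint p α μ μ') {g k : ℝ → ENNReal} (hg : Measurable g) (hk : Measurable k)
    (hg0 : g 0 = 0) (hk0 : k 0 = 0) :
    ∫⁻ u, g u.1 * k u.2 ∂polarPair α μ = ∫⁻ u, k u.1 * g u.2 ∂polarPair α μ' := by
  have hm : ∀ {g k : ℝ → ENNReal}, Measurable g → Measurable k →
      Measurable fun u : ℝ × ℝ => g u.1 * k u.2 := fun hg hk =>
    (hg.comp measurable_fst).mul (hk.comp measurable_snd)
  have hrest : ∀ ν : Measure (ℝ × ℝ), ∫⁻ u, g u.1 * k u.2 ∂ν =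
      ∫⁻ u, g u.1 * k u.2 ∂ν.restrict offAxes := by
    intro ν
    rw [← lintegral_indicator measurableSet_offAxes]
    refine lintegral_congr fun u => ?_
    by_cases hu : u ∈ offAxes
    · rw [Set.indicator_of_mem hu]
    · rw [Set.indicator_of_notMem hu]
      by_cases h1 : u.1 = 0
      · rw [h1, hg0, zero_mul]
      · have h2 : u.2 = 0 := by
          by_contra h2
          exact hu ⟨h1, h2⟩
        rw [h2, hk0, mul_zero]
  rw [hrest, h.restrict_polarPair hα, ← hrest, lintegral_map (hm hg hk) measurable_swap]
  simp only [Prod.fst_swap, Prod.snd_swap, mul_comm]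

/-- Integration of a function of the first two steps of the tail chain. -/
theorem MemClass.lintegral_polarPair {p α : ℝ} {μ : Measure (ℝ × ℝ)} (h : MemClass p α μ)
    {g k : ℝ → ENNReal} (hg : Measurable g) (hk : Measurable k) :
    ∫⁻ u, g u.1 * k u.2 ∂polarPair α μ =
      ∫⁻ z, ∫⁻ σ, g (z * σ) * tailOp μ k (z * σ) ∂signLaw p ∂powMeasure α := by
  have := h.isProbability
  obtain ⟨κ, hκ, rfl⟩ := h.exists_tailStepLaw
  have hm : Measurable fun u : ℝ × ℝ => g u.1 * k u.2 :=
    (hg.comp measurable_fst).mul (hk.comp measurable_snd)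
  have hm2 : Measurable fun q : ℝ × (ℝ × ℝ) => g (q.1 * q.2.1) * k (q.1 * q.2.2) :=
    hm.comp measurable_polarPair_map
  rw [polarPair, lintegral_map hm measurable_polarPair_map]
  refine (lintegral_prod _ hm2.aemeasurable).trans ?_
  refine lintegral_congr_ae ?_
  filter_upwards [ae_powMeasure_pos α] with z hz
  have hmz : Measurable fun q : ℝ × ℝ => g (z * q.1) * k (z * q.2) :=
    hm2.comp measurable_prodMk_left
  have hma := measurable_tailStepLaw_map (a := pairCoef) measurable_pairCoef
  have : SFinite (signLaw p) := by unfold signLaw; infer_instance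
  refine (lintegral_map hmz hma).trans ((lintegral_prod _ (hmz.comp hma).aemeasurable).trans ?_)
  refine lintegral_congr_ae ?_
  filter_upwards [ae_signLaw_pos p] with σ hσ
  have hadm : z * σ = 0 ∨ 0 < signProb p (Real.sign (z * σ)) := by
    right
    rw [sign_mul_of_pos hz, sign_eq_self hσ.1]
    exact hσ.2
  have hts : Measurable (tailStep pairCoef (z * σ)) :=
    (measurable_tailStep measurable_pairCoef).comp (measurable_const.prodMk measurable_id)
  rw [tailOp, stepKernel_tailStepLaw measurable_pairCoef hadm, lintegral_map hk hts,
    ← lintegral_const_mul _ (show Measurable fun v => k (tailStep pairCoef (z * σ) v) from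
      hk.comp hts)]
  refine lintegral_congr fun v => ?_
  change g (z * σ) * k (z * (tailStep pairCoef σ v)) = _
  rw [← tailStep_mul pairCoef hz]

theorem posPow_abs (α x : ℝ) : posPow α |x| = ENNReal.ofReal (|x| ^ α) := by
  rw [posPow, max_eq_left (abs_nonneg x)]

theorem powMeasure_lt_abs_mul {α : ℝ} (hα : 0 < α) {a : ℝ} (ha : 0 < a) (w : ℝ) :
    powMeasure α {z | a < |z * w|} = ENNReal.ofReal (a ^ (-α)) * ENNReal.ofReal (|w| ^ α) := by
  rw [← posPow_abs, ← powMeasure_lt_mul hα ha]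
  refine measure_congr ?_
  filter_upwards [ae_powMeasure_pos α] with z hz
  refine propext ?_
  change a < |z * w| ↔ a < z * |w|
  rw [abs_mul, abs_of_pos hz]

/-- The `α`-moment of the second coordinate of one law is the probability that the second
coordinate of the adjoint law does not vanish. -/
theorem IsAdjoint.moment_eq {p α : ℝ} (hα : 0 < α) {μ μ' : Measure (ℝ × ℝ)}
    (h : IsAdjoint p α μ μ') :
    ∫⁻ q, ENNReal.ofReal (|q.2| ^ α) ∂μ' = μ {q | q.2 ≠ 0} := by
  have := h.mem_left.isProbability
  have := h.mem_right.isProbability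
  have key : ∀ w v : ℝ, powMeasure α {z | 1 < |z * w| ∧ z * v ≠ 0} =
      if v = 0 then 0 else ENNReal.ofReal (|w| ^ α) := by
    intro w v
    split_ifs with hv
    · simp [hv]
    · have h1 := powMeasure_lt_abs_mul hα one_pos w
      rw [Real.one_rpow, ENNReal.ofReal_one, one_mul] at h1
      rw [← h1]
      refine measure_congr ?_
      filter_upwards [ae_powMeasure_pos α] with z hz
      refine propext ?_
      change (1 < |z * w| ∧ z * v ≠ 0) ↔ 1 < |z * w|
      exact and_iff_left (mul_ne_zero hz.ne' hv)
  -- On this set the swap identity compares the mass of `{|z I| > 1, z M ≠ 0}` with that of `{|z M*|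
  -- > 1, z I* ≠ 0}`. As `|I| = 1`, the first is `P(M ≠ 0)`; as `I* ≠ 0`, the second is `E|M*|^α`.
  set A : Set (ℝ × ℝ) := {u | 1 < |u.1| ∧ u.2 ≠ 0} with hAdef
  have hA : MeasurableSet A := (measurableSet_lt measurable_const measurable_fst.abs).inter
    (measurable_snd (measurableSet_singleton 0).compl)
  have hAo : A ⊆ offAxes := by
    rintro u ⟨h1, h2⟩
    refine ⟨fun h0 => ?_, h2⟩
    rw [h0, abs_zero] at h1
    norm_num at h1
  have h1 := congrArg (fun ν => ν A) (h.restrict_polarPair hα)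
  rw [Measure.restrict_apply hA, Measure.restrict_apply hA, Set.inter_eq_left.2 hAo,
    Measure.map_apply measurable_swap hA, polarPair, polarPair,
    Measure.map_apply measurable_polarPair_map hA,
    Measure.map_apply measurable_polarPair_map (measurable_swap hA),
    Measure.prod_apply_symm (measurable_polarPair_map hA),
    Measure.prod_apply_symm (measurable_polarPair_map (measurable_swap hA))] at h1
  have e1 : ∀ q : ℝ × ℝ, powMeasure α ((fun z => (z, q)) ⁻¹'
      ((fun q : ℝ × (ℝ × ℝ) => (q.1 * q.2.1, q.1 * q.2.2)) ⁻¹' A)) =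
      if q.2 = 0 then 0 else ENNReal.ofReal (|q.1| ^ α) := fun q => key q.1 q.2
  have e2 : ∀ q : ℝ × ℝ, powMeasure α ((fun z => (z, q)) ⁻¹'
      ((fun q : ℝ × (ℝ × ℝ) => (q.1 * q.2.1, q.1 * q.2.2)) ⁻¹' (Prod.swap ⁻¹' A))) =
      if q.1 = 0 then 0 else ENNReal.ofReal (|q.2| ^ α) := fun q => key q.2 q.1
  simp only [e1, e2] at h1
  have hs : MeasurableSet {q : ℝ × ℝ | q.2 ≠ 0} :=
    measurable_snd (measurableSet_singleton 0).compl
  rw [← lintegral_indicator_one hs]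
  refine (lintegral_congr_ae ?_).trans (h1.symm.trans (lintegral_congr_ae ?_))
  · filter_upwards [h.mem_right.support] with q hq
    rw [if_neg]
    rcases hq with hq | hq <;> rw [hq] <;> norm_num
  · filter_upwards [h.mem_left.support] with q hq
    by_cases h0 : q.2 = 0
    · rw [if_pos h0, Set.indicator_of_notMem (show q ∉ {q : ℝ × ℝ | q.2 ≠ 0} from
        fun hn => hn h0)]
    · rw [if_neg h0, Set.indicator_of_mem (show q ∈ {q : ℝ × ℝ | q.2 ≠ 0} from h0)]
      rcases hq with hq | hq <;> rw [hq] <;> simp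

/-! ### Time reversal of tail chains -/

/-- Detailed balance: the forward and backward transition operators are dual with respect to the law
of `z σ`, on functions that vanish at `0`. -/
theorem IsAdjoint.lintegral_tailOp {p α : ℝ} (hα : 0 < α) {μ μ' : Measure (ℝ × ℝ)}
    (h : IsAdjoint p α μ μ') {g k : ℝ → ENNReal} (hg : Measurable g) (hk : Measurable k)
    (hg0 : g 0 = 0) (hk0 : k 0 = 0) :
    ∫⁻ z, ∫⁻ σ, g (z * σ) * tailOp μ k (z * σ) ∂signLaw p ∂powMeasure α =
      ∫⁻ z, ∫⁻ σ, k (z * σ) * tailOp μ' g (z * σ) ∂signLaw p ∂powMeasure α := by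
  rw [← h.mem_left.lintegral_polarPair hg hk, h.lintegral_polarPair hα hg hk hg0 hk0,
    h.mem_right.lintegral_polarPair hk hg]

theorem rectFun_zero (μ : Measure (ℝ × ℝ)) {B : ℕ → Set ℝ} {n : ℕ} (h : 0 ∉ B n) (k : ℕ) :
    rectFun μ B k n 0 = 0 := by
  cases k <;> exact Set.indicator_of_notMem h _

theorem rectFun_of_notMem (μ : Measure (ℝ × ℝ)) {B : ℕ → Set ℝ} {n : ℕ} {x : ℝ} (h : x ∉ B n)
    (k : ℕ) : rectFun μ B k n x = 0 := by
  cases k <;> exact Set.indicator_of_notMem h _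

/-- Integrate over the state at a pivot time `j`, with forward transitions after it and backward
ones before it. Duality moves the pivot by one step, so the value does not depend on `j`; the sets
must avoid `0` for duality to apply. -/
theorem IsAdjoint.lintegral_rectFun {p α : ℝ} (hα : 0 < α) {μ μ' : Measure (ℝ × ℝ)}
    (h : IsAdjoint p α μ μ') {B : ℕ → Set ℝ} (hB : ∀ i, MeasurableSet (B i)) (h0 : ∀ i, 0 ∉ B i)
    (t k : ℕ) : ∀ j, j + k = t →
    ∫⁻ z, ∫⁻ σ, rectFun μ B k j (z * σ) * rectFun μ' (fun i => B (t - i)) j k (z * σ)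
        ∂signLaw p ∂powMeasure α =
      ∫⁻ z, ∫⁻ σ, rectFun μ B 0 t (z * σ) * rectFun μ' (fun i => B (t - i)) t 0 (z * σ)
        ∂signLaw p ∂powMeasure α := by
  have := h.mem_left.isProbability
  have := h.mem_right.isProbability
  induction k with
  | zero =>
    rintro j rfl
    rfl
  | succ k ih =>
    intro j hj
    have hr : t - (k + 1) = j := by omega
    have hr2 : t - k = j + 1 := by omega
    rw [← ih (j + 1) (by omega)]
    -- Both factors carry the indicator of `B j`; one copy is redundant, and dropping it exposes a
    -- bare transition operator.
    have e1 : ∀ x, rectFun μ B (k + 1) j x * rectFun μ' (fun i => B (t - i)) j (k + 1) x =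
        rectFun μ' (fun i => B (t - i)) j (k + 1) x * tailOp μ (rectFun μ B k (j + 1)) x := by
      intro x
      by_cases hx : x ∈ B j
      · rw [rectFun, Set.indicator_of_mem hx, mul_comm]
      · rw [rectFun_of_notMem μ hx, rectFun_of_notMem μ' (by simpa only [hr] using hx), zero_mul,
          zero_mul]
    have e2 : ∀ x, rectFun μ B k (j + 1) x * rectFun μ' (fun i => B (t - i)) (j + 1) k x =
        rectFun μ B k (j + 1) x * tailOp μ' (rectFun μ' (fun i => B (t - i)) j (k + 1)) x := by
      intro x
      by_cases hx : x ∈ B (j + 1)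
      · congr 1
        exact Set.indicator_of_mem (by simpa only [hr2] using hx) _
      · rw [rectFun_of_notMem μ hx, zero_mul, zero_mul]
    simp only [e1, e2]
    exact h.lintegral_tailOp hα (measurable_rectFun μ' (fun i => hB _) _ _)
      (measurable_rectFun μ hB _ _) (rectFun_zero μ' (B := fun i => B (t - i)) (h0 _) _)
      (rectFun_zero μ (h0 _) _)

section Reverse

variable {Ω Ω' : Type*} [MeasurableSpace Ω] [MeasurableSpace Ω'] {Q : Measure Ω} {Q' : Measure Ω'}
  {p α : ℝ} {μ μ' : Measure (ℝ × ℝ)} {N : ℕ → Ω → ℝ} {N' : ℕ → Ω' → ℝ}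

/-- The extreme pivots `0` and `t` of `IsAdjoint.lintegral_rectFun`: one of the two factors is then
a single indicator already contained in the other. -/
theorem IsAdjoint.lintegral_measure_rect (hα : 0 < α) (h : IsAdjoint p α μ μ')
    (hN : IsTailMarkov Q p μ N) (hN' : IsTailMarkov Q' p μ' N') {B : ℕ → Set ℝ}
    (hB : ∀ i, MeasurableSet (B i)) (h0 : ∀ i, 0 ∉ B i) (t : ℕ) :
    ∫⁻ z, Q {ω | ∀ i < t + 1, z * N i ω ∈ B i} ∂powMeasure α =
      ∫⁻ z, Q' {ω | ∀ i < t + 1, z * N' i ω ∈ B (t - i)} ∂powMeasure α := by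
  have := h.mem_left.isProbability
  have := h.mem_right.isProbability
  have e1 : ∀ x, rectFun μ B t 0 x * rectFun μ' (fun i => B (t - i)) 0 t x =
      rectFun μ B t 0 x := by
    intro x
    by_cases hx : x ∈ B 0
    · rw [rectFun, Set.indicator_of_mem (by simpa using hx), Pi.one_apply, mul_one]
    · rw [rectFun_of_notMem μ hx, zero_mul]
  have e2 : ∀ x, rectFun μ B 0 t x * rectFun μ' (fun i => B (t - i)) t 0 x =
      rectFun μ' (fun i => B (t - i)) t 0 x := by
    intro x
    by_cases hx : x ∈ B t
    · rw [rectFun, Set.indicator_of_mem hx, Pi.one_apply, one_mul]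
    · rw [rectFun_of_notMem μ' (by simpa using hx), mul_zero]
  have h1 := h.lintegral_rectFun hα hB h0 t t 0 (zero_add t)
  simp only [e1, e2] at h1
  refine Eq.trans (lintegral_congr_ae ?_) (h1.trans (lintegral_congr_ae ?_))
  · filter_upwards [ae_powMeasure_pos α] with z hz
    exact hN.measure_rect hB hz t
  · filter_upwards [ae_powMeasure_pos α] with z hz
    exact (hN'.measure_rect (fun i => hB (t - i)) hz t).symm

theorem measurable_polarLaw_map {d : ℕ} {V : Fin d → Ω → ℝ} (hV : ∀ i, Measurable (V i)) :
    Measurable fun (q : ℝ × Ω) i => q.1 * V i q.2 :=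
  measurable_pi_lambda _ fun i => measurable_fst.mul ((hV i).comp measurable_snd)

theorem polarLaw_apply [SFinite Q] {d : ℕ} {V : Fin d → Ω → ℝ} (hV : ∀ i, Measurable (V i))
    {A : Set (Fin d → ℝ)} (hA : MeasurableSet A) :
    polarLaw α Q V A = ∫⁻ z, Q {ω | (fun i => z * V i ω) ∈ A} ∂powMeasure α := by
  rw [polarLaw, Measure.map_apply (measurable_polarLaw_map hV) hA,
    Measure.prod_apply (measurable_polarLaw_map hV hA)]
  rfl

theorem polarLaw_lt_abs [SFinite Q] (hα : 0 < α) {d : ℕ} {V : Fin d → Ω → ℝ}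
    (hV : ∀ i, Measurable (V i)) {a : ℝ} (ha : 0 < a) (i : Fin d) :
    polarLaw α Q V {y | a < |y i|} =
      ENNReal.ofReal (a ^ (-α)) * ∫⁻ ω, ENNReal.ofReal (|V i ω| ^ α) ∂Q := by
  have hA : MeasurableSet {y : Fin d → ℝ | a < |y i|} :=
    measurableSet_lt measurable_const (measurable_pi_apply i).abs
  rw [polarLaw, Measure.map_apply (measurable_polarLaw_map hV) hA,
    Measure.prod_apply_symm (measurable_polarLaw_map hV hA), ← lintegral_const_mul' _ _
      ENNReal.ofReal_ne_top]
  exact lintegral_congr fun ω => powMeasure_lt_abs_mul hα ha (V i ω)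

/-- The vectors without vanishing coordinates. -/
def nonvanishing (d : ℕ) : Set (Fin d → ℝ) := {y | ∀ i, y i ≠ 0}

theorem measurableSet_nonvanishing (d : ℕ) : MeasurableSet (nonvanishing d) := by
  have : nonvanishing d = ⋂ i, (fun y : Fin d → ℝ => y i) ⁻¹' {0}ᶜ := by
    ext y
    simp [nonvanishing]
  rw [this]
  exact MeasurableSet.iInter fun i => measurable_pi_apply i (measurableSet_singleton 0).compl

/-- Boxes with `0` removed from every side are the rectangles covered by
`IsAdjoint.lintegral_measure_rect`, and restricting to vectors without zeros turns every box into
one of these. -/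
theorem IsAdjoint.polarLaw_reverse [SFinite Q] [SFinite Q'] (hα : 0 < α) (h : IsAdjoint p α μ μ')
    (hN : IsTailMarkov Q p μ N) (hN' : IsTailMarkov Q' p μ' N') (t : ℕ)
    (hfin : ∀ a : ℝ, 0 < a → polarLaw α Q (fun i : Fin (t + 1) => N i) {y | a < |y 0|} ≠ ⊤) :
    (polarLaw α Q fun i : Fin (t + 1) => N i).restrict (nonvanishing (t + 1)) =
      (polarLaw α Q' fun i : Fin (t + 1) => N' (t - i)).restrict (nonvanishing (t + 1)) := by
  set ν := polarLaw α Q fun i : Fin (t + 1) => N i with hν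
  set ν' := polarLaw α Q' fun i : Fin (t + 1) => N' (t - i) with hν'
  set U := nonvanishing (t + 1)
  have hU := measurableSet_nonvanishing (t + 1)
  have hbox : ∀ s : Fin (t + 1) → Set ℝ, (∀ i, MeasurableSet (s i)) →
      ν.restrict U (Set.univ.pi s) = ν'.restrict U (Set.univ.pi s) := by
    intro s hs
    have hpi : MeasurableSet (Set.univ.pi s) := MeasurableSet.univ_pi hs
    rw [Measure.restrict_apply hpi, Measure.restrict_apply hpi, hν, hν',
      polarLaw_apply (fun i => hN.measurable _) (hpi.inter hU),
      polarLaw_apply (fun i => hN'.measurable _) (hpi.inter hU)]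
    have hB : ∀ i, MeasurableSet (extendSets s i \ {0}) := fun i =>
      (measurableSet_extendSets hs i).diff (measurableSet_singleton 0)
    have h1 := h.lintegral_measure_rect hα hN hN' hB (fun i => by simp) t
    refine Eq.trans (lintegral_congr fun z => ?_) (h1.trans (lintegral_congr fun z => ?_))
    · congr 1
      ext ω
      simp only [Set.mem_inter_iff, Set.mem_pi, Set.mem_univ, true_imp_iff, Set.mem_ofPred_eq,
        nonvanishing, Set.mem_sdiff, Set.mem_singleton_iff, ← forall_and]
      constructor
      · intro h i hi
        have := h ⟨i, hi⟩
        rwa [← extendSets_val s] at this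
      · intro h i
        have := h i i.2
        rwa [extendSets_val s] at this
    · congr 1
      ext ω
      simp only [Set.mem_inter_iff, Set.mem_pi, Set.mem_univ, true_imp_iff, Set.mem_ofPred_eq,
        nonvanishing, Set.mem_sdiff, Set.mem_singleton_iff, ← forall_and]
      constructor
      · intro h i
        have := h (t - i) (by omega)
        rwa [show t - (t - (i : ℕ)) = i by omega, extendSets_val s] at this
      · intro h i hi
        have := h ⟨t - i, by omega⟩
        rw [← extendSets_val s] at this
        simpa only [show t - (t - i) = i by omega] using this
  have hz : ∀ (m : Measure (Fin (t + 1) → ℝ)) (A : Set (Fin (t + 1) → ℝ)), A ⊆ Uᶜ →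
      m.restrict U A = 0 := by
    intro m A hA
    refine measure_mono_null hA ?_
    rw [Measure.restrict_apply hU.compl, Set.compl_inter_self, measure_empty]
  -- Finiteness is known only away from `y 0 = 0`. These sets are themselves boxes, so the cover
  -- fits the π-system.
  set b : ℕ → Set (Fin (t + 1) → ℝ) := fun n => {y | ((n : ℝ) + 1)⁻¹ < |y 0|} with hb
  have hbpi : ∀ n, b n = Set.univ.pi (Function.update (fun _ => Set.univ) 0
      {x : ℝ | ((n : ℝ) + 1)⁻¹ < |x|}) := by
    intro n
    ext y
    simp only [hb, Set.mem_pi, Set.mem_univ, true_imp_iff, Set.mem_ofPred_eq]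
    constructor
    · intro hy i
      by_cases hi : i = 0
      · subst hi
        simpa using hy
      · rw [Function.update_of_ne hi]
        trivial
    · intro hy
      simpa using hy 0
  have hbm : ∀ (n : ℕ) (i : Fin (t + 1)), MeasurableSet (Function.update (fun _ => Set.univ) 0
      {x : ℝ | ((n : ℝ) + 1)⁻¹ < |x|} i) := by
    intro n i
    by_cases hi : i = 0
    · subst hi
      rw [Function.update_self]
      exact measurableSet_lt measurable_const measurable_id.abs
    · rw [Function.update_of_ne hi]
      exact MeasurableSet.univ
  refine Measure.ext_of_generateFrom_of_cover (T := insert Uᶜ (Set.range b)) generateFrom_pi.symm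
    ((Set.countable_range _).insert _) isPiSystem_pi ?_ ?_ ?_ ?_
  · refine Set.eq_univ_of_forall fun y => ?_
    by_cases hy : y ∈ U
    · obtain ⟨n, hn⟩ := exists_nat_one_div_lt (abs_pos.2 (hy 0))
      exact ⟨_, Or.inr ⟨n, rfl⟩, by simpa [hb] using hn⟩
    · exact ⟨_, Or.inl rfl, hy⟩
  · rintro _ (rfl | ⟨n, rfl⟩)
    · rw [hz _ _ subset_rfl]
      exact ENNReal.zero_ne_top
    · exact ne_top_of_le_ne_top (hfin _ (by positivity)) (Measure.restrict_apply_le _ _)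
  · rintro _ (rfl | ⟨n, rfl⟩) _ ⟨s, hs, rfl⟩
    · rw [hz _ _ Set.inter_subset_right, hz _ _ Set.inter_subset_right]
    · rw [hbpi, ← Set.pi_inter_distrib]
      have hs' : ∀ i, MeasurableSet (s i) := fun i => hs i (Set.mem_univ i)
      exact hbox _ fun i => (hs' i).inter (hbm n i)
  · rintro _ (rfl | ⟨n, rfl⟩)
    · rw [hz _ _ subset_rfl, hz _ _ subset_rfl]
    · rw [hbpi]
      exact hbox _ (hbm n)

end Reverse

/-! ### Moments and reversal of back-and-forth tail chains -/

theorem IsBFTC.moment_backward {Ω : Type*} [MeasurableSpace Ω] {Q : Measure Ω} {p α : ℝ}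
    (hα : 0 < α) {μ : Measure (ℝ × ℝ)} {M : ℤ → Ω → ℝ} (h : IsBFTC Q p α μ M) :
    ∫⁻ ω, ENNReal.ofReal (|M (-1) ω| ^ α) ∂Q = Q {ω | M 1 ω ≠ 0} := by
  have h1 := h.law_backward.moment_eq hα
  have hs : MeasurableSet {q : ℝ × ℝ | q.2 ≠ 0} :=
    measurable_snd (measurableSet_singleton 0).compl
  have hf : Measurable fun q : ℝ × ℝ => ENNReal.ofReal (|q.2| ^ α) := by fun_prop
  rw [lintegral_map hf ((h.measurable 0).prodMk (h.measurable (-1)))] at h1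
  rw [h1, ← h.law_forward, Measure.map_apply ((h.measurable 0).prodMk (h.measurable 1)) hs]
  rfl

/-- The definition is symmetric in time once adjointness is, so each forward statement has a
backward counterpart. -/
theorem IsBFTC.reverse {Ω : Type*} [MeasurableSpace Ω] {Q : Measure Ω} {p α : ℝ}
    {μ : Measure (ℝ × ℝ)} {M : ℤ → Ω → ℝ} (h : IsBFTC Q p α μ M) :
    IsBFTC Q p α (Q.map fun ω => (M 0 ω, M (-1) ω)) fun t => M (-t) := by
  refine ⟨h.isProbability, fun t => h.measurable _, ?_, ?_, h.backward, ?_⟩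
  · simp only [neg_zero]
  · simp only [neg_zero, neg_neg, h.law_forward]
    exact h.law_backward.symm
  · simpa only [neg_neg] using h.forward

theorem IsBFTC.moment_forward {Ω : Type*} [MeasurableSpace Ω] {Q : Measure Ω} {p α : ℝ}
    (hα : 0 < α) {μ : Measure (ℝ × ℝ)} {M : ℤ → Ω → ℝ} (h : IsBFTC Q p α μ M) :
    ∫⁻ ω, ENNReal.ofReal (|M 1 ω| ^ α) ∂Q = Q {ω | M (-1) ω ≠ 0} := by
  simpa only [neg_neg] using h.reverse.moment_backward hα

theorem measure_eq_zero_iff_compl_eq_one {Ω : Type*} [MeasurableSpace Ω] {Q : Measure Ω}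
    [IsProbabilityMeasure Q] {f : Ω → ℝ} (hf : Measurable f) :
    Q {ω | f ω = 0} = 0 ↔ Q {ω | f ω ≠ 0} = 1 := by
  have hs : MeasurableSet {ω | f ω = 0} := hf (measurableSet_singleton 0)
  rw [← prob_compl_eq_one_iff hs]
  rfl

theorem IsBFTC.isTailMarkov {Ω : Type*} [MeasurableSpace Ω] {Q : Measure Ω} {p α : ℝ}
    {μ : Measure (ℝ × ℝ)} {M : ℤ → Ω → ℝ} (h : IsBFTC Q p α μ M) :
    IsTailMarkov Q p μ fun n => M n := by
  have := h.forward.isTailMarkov (α := α) h.measurable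
    (by rw [h.law_forward]; exact h.law_backward.mem_left)
  rwa [h.law_forward] at this

/-! ### Stationarity of the path -/

section Shift

variable {Ω S : Type*} [MeasurableSpace Ω] [MeasurableSpace S]
  {P : Measure Ω} {Ψ : ℝ → S → ℝ} {ε : ℕ → Ω → S} {X : ℕ → Ω → ℝ}

theorem indepFun_zero_succ (hε : ∀ n, Measurable (ε n)) (h : iIndepFun ε P) :
    IndepFun (ε 0) (fun ω n => ε (n + 1) ω) P := by
  have h1 := indep_iSup_of_disjoint (fun n => (hε n).comap_le) h
    (S := {0}) (T := {n | n ≠ 0}) (by simp)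
  refine indep_of_indep_of_le_left (indep_of_indep_of_le_right h1 ?_) ?_
  · rw [MeasurableSpace.pi, MeasurableSpace.comap_iSup]
    refine iSup_le fun n => ?_
    rw [MeasurableSpace.comap_comp]
    exact le_iSup₂_of_le (n + 1) (by simp) le_rfl
  · exact le_iSup₂_of_le 0 (by simp) le_rfl

theorem IsStationaryChain.map_innov (hX : IsStationaryChain P Ψ ε X) {c : ℕ → ℕ}
    (hc : Function.Injective c) :
    P.map (fun ω n => ε (c n) ω) = Measure.infinitePi fun _ : ℕ => P.map (ε 0) := by
  rw [(hX.indep_innov.precomp hc).map_fun_eq_infinitePi_map fun n => hX.measurable_innov _]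
  congr 1
  funext n
  exact (hX.ident_innov _).map_eq

/-- `X 1` depends on `(X 0, ε 0)` only, hence is independent of the later innovations. The marginals
agree by stationarity of one step and since the innovations are i.i.d.; as the path is a function of
this pair, all finite-dimensional laws are stationary. -/
theorem IsStationaryChain.map_shift [IsProbabilityMeasure P] (hX : IsStationaryChain P Ψ ε X) :
    P.map (fun ω => (X 1 ω, fun n => ε (n + 1) ω)) = P.map fun ω => (X 0 ω, fun n => ε n ω) := by
  have hε : Measurable fun ω n => ε n ω := measurable_pi_lambda _ hX.measurable_innov
  have hε' : Measurable fun ω n => ε (n + 1) ω :=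
    measurable_pi_lambda _ fun n => hX.measurable_innov _
  have hε0 := hX.measurable_innov 0
  have hX0 := hX.measurable_init
  have hL : P.map (fun ω n => ε (n + 1) ω) = P.map fun ω n => ε n ω :=
    (hX.map_innov (add_left_injective 1)).trans (hX.map_innov Function.injective_id).symm
  have h1 := (indepFun_iff_map_prod_eq_prod_map_map hX0.aemeasurable hε.aemeasurable).1
    hX.indep_init
  have h2 := (indepFun_iff_map_prod_eq_prod_map_map hε0.aemeasurable hε'.aemeasurable).1
    (indepFun_zero_succ hX.measurable_innov hX.indep_innov)
  have hsplit : Measurable fun e : ℕ → S => (e 0, fun n => e (n + 1)) :=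
    (measurable_pi_apply 0).prodMk (measurable_pi_lambda _ fun n => measurable_pi_apply (n + 1))
  have h3 : P.map (fun ω => (X 0 ω, (ε 0 ω, fun n => ε (n + 1) ω))) =
      (P.map (X 0)).prod ((P.map (ε 0)).prod (P.map fun ω n => ε (n + 1) ω)) := by
    have : (fun ω => (X 0 ω, (ε 0 ω, fun n => ε (n + 1) ω))) =
        Prod.map id (fun e : ℕ → S => (e 0, fun n => e (n + 1))) ∘
          fun ω => (X 0 ω, fun n => ε n ω) := rfl
    rw [this, ← Measure.map_map (measurable_id.prodMap hsplit) (hX0.prodMk hε), h1, ← h2,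
      ← Measure.map_prod_map _ _ measurable_id hsplit, Measure.map_id, Measure.map_map hsplit hε]
    rfl
  have h4 : P.map (fun ω => ((X 0 ω, ε 0 ω), fun n => ε (n + 1) ω)) =
      ((P.map (X 0)).prod (P.map (ε 0))).prod (P.map fun ω n => ε (n + 1) ω) := by
    have hp1 := Measure.isProbabilityMeasure_map hX0.aemeasurable (μ := P)
    have hp2 := Measure.isProbabilityMeasure_map hε0.aemeasurable (μ := P)
    have hp3 := Measure.isProbabilityMeasure_map hε'.aemeasurable (μ := P)
    rw [← (measurePreserving_prodAssoc (P.map (X 0)) (P.map (ε 0))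
      (P.map fun ω n => ε (n + 1) ω)).symm.map_eq, ← h3, Measure.map_map
      (MeasurableEquiv.measurable _) (hX0.prodMk (hε0.prodMk hε'))]
    rfl
  have h5 : IndepFun (fun ω => (X 0 ω, ε 0 ω)) (fun ω n => ε (n + 1) ω) P := by
    rw [indepFun_iff_map_prod_eq_prod_map_map (hX0.prodMk hε0).aemeasurable hε'.aemeasurable, h4]
    congr 1
    have hi : IndepFun (X 0) (ε 0) P := hX.indep_init.comp measurable_id (measurable_pi_apply 0)
    exact ((indepFun_iff_map_prod_eq_prod_map_map hX0.aemeasurable hε0.aemeasurable).1 hi).symm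
  have hX1 : X 1 = fun ω => Ψ (X 0 ω) (ε 0 ω) := funext fun ω => hX.recursion 0 ω
  have hX1m : Measurable (X 1) := by
    rw [hX1]
    exact hX.measurable_update.comp (hX0.prodMk hε0)
  have h6 : IndepFun (X 1) (fun ω n => ε (n + 1) ω) P := by
    rw [hX1]
    exact h5.comp hX.measurable_update measurable_id
  rw [(indepFun_iff_map_prod_eq_prod_map_map hX1m.aemeasurable hε'.aemeasurable).1 h6, h1, hL,
    hX.identDistrib_one.map_eq]

theorem IsStationaryChain.measurable (hX : IsStationaryChain P Ψ ε X) (n : ℕ) :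
    Measurable (X n) := by
  have : X n = fun ω => chainPath Ψ (X 0 ω) (fun k => ε k ω) n := funext fun ω =>
    hX.eq_chainPath n ω
  rw [this]
  exact (measurable_chainPath hX.measurable_update n).comp
    (hX.measurable_init.prodMk (measurable_pi_lambda _ hX.measurable_innov))

theorem IsStationaryChain.map_path_succ [IsProbabilityMeasure P] (hX : IsStationaryChain P Ψ ε X)
    (t : ℕ) :
    P.map (fun ω (i : Fin t) => X (i + 1) ω) = P.map fun ω (i : Fin t) => X i ω := by
  have hsucc : ∀ n ω, X (n + 1) ω = chainPath Ψ (X 1 ω) (fun k => ε (k + 1) ω) n := by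
    intro n ω
    induction n with
    | zero => rfl
    | succ n ih => rw [hX.recursion, ih, chainPath]
  have hm : Measurable fun (q : ℝ × (ℕ → S)) (i : Fin t) => chainPath Ψ q.1 q.2 i :=
    measurable_pi_lambda _ fun i => measurable_chainPath hX.measurable_update i
  have e1 : (fun ω (i : Fin t) => X (i + 1) ω) =
      (fun (q : ℝ × (ℕ → S)) (i : Fin t) => chainPath Ψ q.1 q.2 i) ∘
        fun ω => (X 1 ω, fun n => ε (n + 1) ω) := by
    ext ω i
    exact hsucc i ω
  have e2 : (fun ω (i : Fin t) => X i ω) =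
      (fun (q : ℝ × (ℕ → S)) (i : Fin t) => chainPath Ψ q.1 q.2 i) ∘
        fun ω => (X 0 ω, fun n => ε n ω) := by
    ext ω i
    exact hX.eq_chainPath i ω
  rw [e1, e2, ← Measure.map_map hm ((hX.measurable 1).prodMk
      (measurable_pi_lambda _ fun n => hX.measurable_innov _)), hX.map_shift,
    Measure.map_map hm (hX.measurable_init.prodMk (measurable_pi_lambda _ hX.measurable_innov))]

theorem IsStationaryChain.map_eq_map_zero [IsProbabilityMeasure P] (hX : IsStationaryChain P Ψ ε X)
    (n : ℕ) :
    P.map (X n) = P.map (X 0) := by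
  have h : ∀ n, P.map (X (n + 1)) = P.map (X n) := by
    intro n
    have h1 := congrArg (fun ν => ν.map fun y : Fin (n + 1) → ℝ => y (Fin.last n))
      (hX.map_path_succ (n + 1))
    rw [Measure.map_map (measurable_pi_apply _)
        (measurable_pi_lambda _ fun i => hX.measurable _),
      Measure.map_map (measurable_pi_apply _)
        (measurable_pi_lambda _ fun i => hX.measurable _)] at h1
    exact h1
  induction n with
  | zero => rfl
  | succ n ih => rw [h, ih]

theorem IsStationaryChain.real_lt_abs [IsProbabilityMeasure P] (hX : IsStationaryChain P Ψ ε X)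
    (n : ℕ) (a : ℝ) :
    P.real {ω | a < |X n ω|} = P.real {ω | a < |X 0 ω|} := by
  have hs : MeasurableSet {y : ℝ | a < |y|} := measurableSet_lt measurable_const measurable_id.abs
  have h : ∀ n, P {ω | a < |X n ω|} = P.map (X n) {y : ℝ | a < |y|} := fun n =>
    (Measure.map_apply (hX.measurable n) hs).symm
  rw [Measure.real, Measure.real, h n, h 0, hX.map_eq_map_zero]

end Shift

/-! ### Existence of limits for functions vanishing near the origin -/

/-- A function that is approximated up to arbitrarily small errors by convergent functions
converges. -/
theorem exists_tendsto_of_approx {f : ℝ → ℝ}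
    (h : ∀ e > 0, ∃ (g : ℝ → ℝ) (l : ℝ), Tendsto g atTop (𝓝 l) ∧ ∀ᶠ x in atTop, |f x - g x| ≤ e) :
    ∃ l, Tendsto f atTop (𝓝 l) := by
  refine cauchy_map_iff_exists_tendsto.1 (Metric.cauchy_iff.2 ⟨inferInstance, fun e he => ?_⟩)
  obtain ⟨g, l, hg, hfg⟩ := h (e / 5) (by positivity)
  have h1 : ∀ᶠ x in atTop, |g x - l| < e / 5 := by
    simpa only [Real.dist_eq] using (Metric.tendsto_nhds.1 hg) (e / 5) (by positivity)
  refine ⟨f '' {x | |f x - g x| ≤ e / 5 ∧ |g x - l| < e / 5}, image_mem_map (hfg.and h1), ?_⟩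
  rintro _ ⟨x, ⟨hx1, hx2⟩, rfl⟩ _ ⟨y, ⟨hy1, hy2⟩, rfl⟩
  rw [Real.dist_eq]
  rw [abs_le] at hx1 hy1
  rw [abs_lt] at hx2 hy2 ⊢
  constructor <;> linarith [hx1.1, hx1.2, hx2.1, hx2.2, hy1.1, hy1.2, hy2.1, hy2.2]

section Limit

variable {Ω S : Type*} [MeasurableSpace Ω] [MeasurableSpace S]
  {P : Measure Ω} {Ψ : ℝ → S → ℝ} {ε : ℕ → Ω → S} {X : ℕ → Ω → ℝ}
  {φ : S → ℝ → ℝ} {α p : ℝ}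

/-- The path `(X_0, …, X_t)` divided by `x`, in `[-∞, ∞]^{t+1}`. -/
def scaledPath (X : ℕ → Ω → ℝ) (t : ℕ) (x : ℝ) (ω : Ω) : Fin (t + 1) → EReal :=
  coeVec fun i => x⁻¹ * X i ω

theorem measurable_scaledPath (hX : IsStationaryChain P Ψ ε X) (t : ℕ) (x : ℝ) :
    Measurable (scaledPath X t x) :=
  continuous_coeVec.measurable.comp
    (measurable_pi_lambda _ fun i => (hX.measurable i).const_mul x⁻¹)

/-- If the total size exceeds `δ`, some coordinate exceeds `δ / (t + 1)`. By stationarity a union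
bound reduces this to the tail of `X 0`. The cap `1/2` keeps the level in the range where `esize` is
the absolute value. -/
theorem exists_tail_bound [IsProbabilityMeasure P] (hX : IsStationaryChain P Ψ ε X)
    (hRV : HasRegVarTails P (X 0) α p)
    (t : ℕ) {δ : ℝ} (hδ : 0 < δ) : ∃ C, 0 ≤ C ∧ ∀ᶠ x in atTop,
      (P.real {ω | x < |X 0 ω|})⁻¹ * P.real {ω | δ < vsize (scaledPath X t x ω)} ≤ C := by
  set δ' := min (δ / (t + 1 : ℕ)) (1 / 2) with hδ'
  have hδ'0 : 0 < δ' := lt_min (by positivity) (by norm_num)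
  have hδ'1 : δ' < 1 := (min_le_right _ _).trans_lt (by norm_num)
  refine ⟨(t + 1 : ℕ) * (δ' ^ (-α) + 1), by positivity, ?_⟩
  filter_upwards [(hRV.regVar δ' hδ'0).eventually (gt_mem_nhds (lt_add_one _)),
    eventually_gt_atTop 0] with x hx hx0
  have hsub : {ω | δ < vsize (scaledPath X t x ω)} ⊆ ⋃ i : Fin (t + 1), {ω | x * δ' < |X i ω|} := by
    intro ω hω
    obtain ⟨i, hi⟩ := exists_esize_gt hδ.le hω
    have h1 : δ' < esize (((x⁻¹ * X i ω : ℝ)) : EReal) := (min_le_left _ _).trans_lt hi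
    rw [lt_esize_coe hδ'1, abs_mul, abs_of_pos (inv_pos.2 hx0), inv_mul_eq_div,
      lt_div_iff₀ hx0, mul_comm] at h1
    exact Set.mem_iUnion.2 ⟨i, h1⟩
  have h2 : P.real {ω | δ < vsize (scaledPath X t x ω)} ≤
      (t + 1 : ℕ) * P.real {ω | x * δ' < |X 0 ω|} := by
    refine (measureReal_mono hsub).trans ((measureReal_iUnion_fintype_le _).trans (le_of_eq ?_))
    simp only [hX.real_lt_abs, Finset.sum_const, Finset.card_univ, Fintype.card_fin, nsmul_eq_mul]
  have hb := hRV.tail_pos x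
  rw [inv_mul_le_iff₀ hb]
  rw [div_lt_iff₀ hb] at hx
  refine h2.trans ?_
  rw [mul_left_comm, mul_comm (P.real {ω | x < |X 0 ω|})]
  exact mul_le_mul_of_nonneg_left hx.le (Nat.cast_nonneg _)

theorem integrable_comp_scaledPath [IsProbabilityMeasure P] (hX : IsStationaryChain P Ψ ε X) (t : ℕ)
    (x : ℝ)
    {F : (Fin (t + 1) → EReal) → ℝ} (hF : Continuous F) :
    Integrable (fun ω => F (scaledPath X t x ω)) P := by
  obtain ⟨C, hC⟩ := exists_abs_le_of_continuous hF
  exact Integrable.of_bound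
    (hF.measurable.comp (measurable_scaledPath hX t x)).aestronglyMeasurable C
    (Eventually.of_forall fun ω => hC _)

theorem integral_scaledPath_tail [IsProbabilityMeasure P] (hX : IsStationaryChain P Ψ ε X) (t : ℕ)
    (x : ℝ)
    {F : (Fin (t + 1) → EReal) → ℝ} (hF : Continuous F) :
    ∫ ω, F (Fin.tail (scaledPath X (t + 1) x ω)) ∂P = ∫ ω, F (scaledPath X t x ω) ∂P := by
  have hG : Measurable fun y : Fin (t + 1) → ℝ => F (coeVec fun i => x⁻¹ * y i) :=
    hF.measurable.comp (continuous_coeVec.measurable.comp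
      (measurable_pi_lambda _ fun i => (measurable_pi_apply (X := fun _ => ℝ) i).const_mul x⁻¹))
  have h1 : ∀ Z : ℕ → Ω → ℝ, (∀ n, Measurable (Z n)) →
      ∫ ω, F (scaledPath Z t x ω) ∂P =
      ∫ y, F (coeVec fun i => x⁻¹ * y i) ∂P.map fun ω (i : Fin (t + 1)) => Z i ω := by
    intro Z hZ
    rw [integral_map (measurable_pi_lambda _ fun i => hZ _).aemeasurable
      hG.aestronglyMeasurable]
    rfl
  have h2 : ∀ ω, Fin.tail (scaledPath X (t + 1) x ω) =
      scaledPath (fun n => X (n + 1)) t x ω := fun ω => rfl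
  simp only [h2]
  rw [h1 _ fun n => hX.measurable (n + 1), h1 _ hX.measurable, hX.map_path_succ]

theorem vsize_cons_zero {d : ℕ} (y : Fin d → EReal) :
    vsize (Fin.cons 0 y : Fin (d + 1) → EReal) = vsize y := by
  simp [vsize, Fin.sum_univ_succ, esize_zero]

theorem vsize_tail_le {d : ℕ} (x : Fin (d + 1) → EReal) : vsize (Fin.tail x) ≤ vsize x := by
  rw [vsize, vsize, Fin.sum_univ_succ]
  exact le_add_of_nonneg_left (esize_nonneg _)

theorem continuous_cons_zero {d : ℕ} :
    Continuous fun y : Fin d → EReal => (Fin.cons 0 y : Fin (d + 1) → EReal) :=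
  continuous_const.finCons continuous_id

theorem continuous_tail {d : ℕ} : Continuous fun x : Fin (d + 1) → EReal => Fin.tail x :=
  continuous_pi fun _ => continuous_apply _

/-- A continuous function that is small where the first coordinate vanishes is small where the
first coordinate is small. -/
theorem exists_esize_le_imp_lt {d : ℕ} {H : (Fin (d + 1) → EReal) → ℝ} (hH : Continuous H)
    (h0 : ∀ x, x 0 = 0 → H x = 0) {e : ℝ} (he : 0 < e) :
    ∃ η > 0, ∀ x, esize (x 0) ≤ η → |H x| ≤ e := by
  -- On this compact set the first coordinate never vanishes, so its size has a positive minimum.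
  have hK : IsCompact {x | e ≤ |H x|} := (isClosed_le continuous_const hH.abs).isCompact
  have hs : Continuous fun x : Fin (d + 1) → EReal => esize (x 0) :=
    continuous_esize.comp (continuous_apply 0)
  rcases {x | e ≤ |H x|}.eq_empty_or_nonempty with hne | hne
  · refine ⟨1, one_pos, fun x _ => ?_⟩
    have : x ∉ {x | e ≤ |H x|} := by
      rw [hne]
      exact Set.notMem_empty x
    exact (not_le.1 this).le
  · obtain ⟨x₀, hx₀, hmin⟩ := hK.exists_isMinOn hne hs.continuousOn
    have hpos : 0 < esize (x₀ 0) := by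
      refine esize_pos.2 fun h => ?_
      have h1 : e ≤ |H x₀| := hx₀
      rw [h0 _ h, abs_zero] at h1
      linarith
    refine ⟨esize (x₀ 0) / 2, half_pos hpos, fun x hx => ?_⟩
    by_contra! hlt
    have h2 : esize (x₀ 0) ≤ esize (x 0) := hmin hlt.le
    linarith

/-- Paths with negligible `X 0` but a later large value escape the forward limit. Subtracting the
trace of `F` on `{x_0 = 0}` removes their contribution; that trace ignores `x_0`, so by stationarity
it is an expectation for a path shorter by one. -/
theorem exists_tendsto_integral [IsProbabilityMeasure P] (hX : IsStationaryChain P Ψ ε X)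
    (hRV : HasRegVarTails P (X 0) α p) (hφ : ∀ σ, Measurable fun v => φ v σ)
    (hconv : ∀ᵐ ω ∂P, ∀ t, ConvergesAlong p Ψ φ t fun n => ε n ω) (t : ℕ) :
    ∀ {F : (Fin (t + 1) → EReal) → ℝ}, Continuous F → ∀ {δ : ℝ}, 0 < δ →
    (∀ x, vsize x ≤ δ → F x = 0) → ∃ l, Tendsto (fun x => (P.real {ω | x < |X 0 ω|})⁻¹ *
        ∫ ω, F (scaledPath X t x ω) ∂P) atTop (𝓝 l) := by
  have hfirst : ∀ (t : ℕ) {F : (Fin (t + 1) → EReal) → ℝ}, Continuous F → ∀ {η : ℝ}, 0 < η →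
      (∀ x, esize (x 0) ≤ η → F x = 0) → ∃ l, Tendsto (fun x => (P.real {ω | x < |X 0 ω|})⁻¹ *
        ∫ ω, F (scaledPath X t x ω) ∂P) atTop (𝓝 l) := fun t F hF η hη hF0 =>
    ⟨_, tendsto_integral_scaled hX hRV hφ (hconv.mono fun ω h => h t) hF hη hF0⟩
  induction t with
  | zero =>
    intro F hF δ hδ hF0
    refine hfirst 0 hF hδ fun x hx => hF0 x ?_
    simpa [vsize] using hx
  | succ t ih =>
    intro F hF δ hδ hF0
    set G : (Fin (t + 1) → EReal) → ℝ := fun y => F (Fin.cons 0 y) with hG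
    have hGc : Continuous G := hF.comp continuous_cons_zero
    obtain ⟨l₁, hl₁⟩ := ih hGc hδ fun y hy => hF0 _ (by rwa [vsize_cons_zero])
    set H : (Fin (t + 2) → EReal) → ℝ := fun x => F x - G (Fin.tail x) with hH
    have hHc : Continuous H := hF.sub (hGc.comp continuous_tail)
    have hH0 : ∀ x, x 0 = 0 → H x = 0 := by
      intro x hx
      have : Fin.cons 0 (Fin.tail x) = x := by
        rw [← hx]
        exact Fin.cons_self_tail x
      rw [hH]
      simp only [hG, this, sub_self]
    have hHδ : ∀ x, vsize x ≤ δ → H x = 0 := by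
      intro x hx
      have h1 : G (Fin.tail x) = 0 := hF0 _ (by
        rw [vsize_cons_zero]
        exact (vsize_tail_le x).trans hx)
      simp only [hH, hF0 x hx, h1, sub_zero]
    obtain ⟨C, hC0, hC⟩ := exists_tail_bound hX hRV (t + 1) hδ
    have hHl : ∃ l, Tendsto (fun x => (P.real {ω | x < |X 0 ω|})⁻¹ *
        ∫ ω, H (scaledPath X (t + 1) x ω) ∂P) atTop (𝓝 l) := by
      refine exists_tendsto_of_approx fun e he => ?_
      -- The error made below is at most `e'` and lives on `{δ < vsize}`, whose normalized mass is
      -- at most `C`.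
      set e' := e / (C + 1) with he'
      have he'0 : 0 < e' := by positivity
      obtain ⟨η, hη, hHη⟩ := exists_esize_le_imp_lt hHc hH0 he'0
      -- Soft thresholding: `K` is continuous, within `e'` of `H`, and exactly zero where `|H| ≤
      -- e'`, in particular where the first coordinate is small.
      set K : (Fin (t + 2) → EReal) → ℝ := fun x => H x - max (-e') (min (H x) e') with hK
      have hKc : Continuous K := hHc.sub (continuous_const.max (hHc.min continuous_const))
      have hK0 : ∀ x, |H x| ≤ e' → K x = 0 := by
        intro x hx
        rw [abs_le] at hx
        simp only [hK, min_eq_left hx.2, max_eq_right hx.1, sub_self]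
      obtain ⟨l, hl⟩ := hfirst (t + 1) hKc hη fun x hx => hK0 x (hHη x hx)
      refine ⟨_, l, hl, ?_⟩
      filter_upwards [hC] with x hx
      have hb := hRV.tail_pos x
      have hs : MeasurableSet {ω | δ < vsize (scaledPath X (t + 1) x ω)} :=
        measurableSet_lt measurable_const
          (continuous_vsize.measurable.comp (measurable_scaledPath hX _ x))
      rw [← mul_sub, ← integral_sub (integrable_comp_scaledPath hX _ x hHc)
        (integrable_comp_scaledPath hX _ x hKc), abs_mul, abs_of_pos (inv_pos.2 hb)]
      have hbound : |∫ ω, (H (scaledPath X (t + 1) x ω) - K (scaledPath X (t + 1) x ω)) ∂P| ≤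
          ∫ ω, {ω | δ < vsize (scaledPath X (t + 1) x ω)}.indicator (fun _ => e') ω ∂P := by
        have hi : Integrable ({ω | δ < vsize (scaledPath X (t + 1) x ω)}.indicator
            fun _ => e') P := (integrable_const e').indicator hs
        rw [← Real.norm_eq_abs]
        refine norm_integral_le_of_norm_le hi (Eventually.of_forall fun ω => ?_)
        rw [Real.norm_eq_abs]
        by_cases hω : δ < vsize (scaledPath X (t + 1) x ω)
        · rw [Set.indicator_of_mem (show ω ∈ {ω | δ < vsize (scaledPath X (t + 1) x ω)} from hω)]
          simp only [hK, sub_sub_cancel]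
          exact abs_le.2 ⟨le_max_left _ _, max_le (by linarith) (min_le_right _ _)⟩
        · rw [Set.indicator_of_notMem
            (show ω ∉ {ω | δ < vsize (scaledPath X (t + 1) x ω)} from hω)]
          have h1 := hHδ _ (not_lt.1 hω)
          rw [h1, hK0 _ (by rw [h1, abs_zero]; exact he'0.le), sub_zero, abs_zero]
      rw [integral_indicator_const _ hs, smul_eq_mul] at hbound
      calc (P.real {ω | x < |X 0 ω|})⁻¹ *
            |∫ ω, (H (scaledPath X (t + 1) x ω) - K (scaledPath X (t + 1) x ω)) ∂P|
          ≤ (P.real {ω | x < |X 0 ω|})⁻¹ *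
            (P.real {ω | δ < vsize (scaledPath X (t + 1) x ω)} * e') :=
            mul_le_mul_of_nonneg_left hbound (inv_pos.2 hb).le
        _ ≤ C * e' := by
            rw [← mul_assoc]
            exact mul_le_mul_of_nonneg_right hx he'0.le
        _ ≤ e := by
            rw [he', mul_div_assoc', div_le_iff₀ (by positivity)]
            nlinarith
    obtain ⟨l₂, hl₂⟩ := hHl
    refine ⟨l₂ + l₁, (hl₂.add hl₁).congr fun x => ?_⟩
    rw [← mul_add, ← integral_scaledPath_tail hX t x hGc,
      ← integral_add (integrable_comp_scaledPath hX _ x hHc)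
        (integrable_comp_scaledPath hX _ x (F := fun y => G (Fin.tail y))
        (hGc.comp continuous_tail))]
    simp only [hH, sub_add_cancel]

end Limit

/-! ### Uniqueness and existence of the limit measures -/

/-- Two measures agree on `{0 < s}` if they integrate to the same values the continuous functions
that vanish where `s` is small. -/
theorem restrict_pos_eq_of_integral_eq {Y : Type*} [TopologicalSpace Y] [CompactSpace Y]
    [MeasurableSpace Y] [BorelSpace Y] [HasOuterApproxClosed Y] {s : Y → ℝ} (hs : Continuous s)
    {m₁ m₂ : Measure Y} (h₁ : ∀ η > 0, m₁ {y | η < s y} ≠ ⊤) (h₂ : ∀ η > 0, m₂ {y | η < s y} ≠ ⊤)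
    (h : ∀ F : Y → ℝ, Continuous F → ∀ η > 0, (∀ y, s y ≤ η → F y = 0) →
      ∫ y, F y ∂m₁ = ∫ y, F y ∂m₂) :
    m₁.restrict {y | 0 < s y} = m₂.restrict {y | 0 < s y} := by
  have hU : {y | 0 < s y} = ⋃ n : ℕ, {y | 1 / ((n : ℝ) + 1) < s y} := by
    ext y
    simp only [Set.mem_iUnion, Set.mem_ofPred_eq]
    exact ⟨fun hy => exists_nat_one_div_lt hy, fun ⟨n, hn⟩ => lt_trans (by positivity) hn⟩
  rw [hU]
  refine Measure.restrict_iUnion_congr.2 fun n => ?_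
  set η : ℝ := 1 / ((n : ℝ) + 1)
  have hη : 0 < η := by positivity
  have hA : MeasurableSet {y | η < s y} := measurableSet_lt measurable_const hs.measurable
  -- A continuous weight, positive exactly where `η < s`. It makes the measures finite, and for
  -- every bounded continuous `f` the product `w f` is an admissible test function.
  set w : Y → ℝ := fun y => max (s y - η) 0 with hw
  have hwc : Continuous w := (hs.sub continuous_const).max continuous_const
  have hw0 : ∀ y, 0 ≤ w y := fun y => le_max_right _ _
  have hwz : ∀ y, s y ≤ η → w y = 0 := fun y hy => max_eq_right (sub_nonpos.2 hy)
  have hwm : Measurable fun y => ENNReal.ofReal (w y) := hwc.measurable.ennreal_ofReal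
  obtain ⟨C, hC⟩ := (isCompact_range hwc).bddAbove
  have hfin : ∀ m : Measure Y, m {y | η < s y} ≠ ⊤ →
      IsFiniteMeasure (m.withDensity fun y => ENNReal.ofReal (w y)) := by
    intro m hm
    refine isFiniteMeasure_withDensity (ne_top_of_le_ne_top
      (b := ENNReal.ofReal C * m {y | η < s y}) (ENNReal.mul_ne_top ENNReal.ofReal_ne_top hm) ?_)
    calc ∫⁻ y, ENNReal.ofReal (w y) ∂m
        ≤ ∫⁻ y, {y | η < s y}.indicator (fun _ => ENNReal.ofReal C) y ∂m := by
          refine lintegral_mono fun y => ?_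
          by_cases hy : y ∈ {y | η < s y}
          · rw [Set.indicator_of_mem hy]
            exact ENNReal.ofReal_le_ofReal (hC ⟨y, rfl⟩)
          · rw [Set.indicator_of_notMem hy, hwz y (not_lt.1 hy), ENNReal.ofReal_zero]
      _ = ENNReal.ofReal C * m {y | η < s y} := by rw [lintegral_indicator_const hA]
  have hf1 := hfin m₁ (h₁ η hη)
  have hf2 := hfin m₂ (h₂ η hη)
  have heq : m₁.withDensity (fun y => ENNReal.ofReal (w y)) =
      m₂.withDensity fun y => ENNReal.ofReal (w y) := by
    refine ext_of_forall_integral_eq_of_IsFiniteMeasure fun f => ?_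
    have hd : ∀ m : Measure Y, ∫ y, f y ∂m.withDensity (fun y => ENNReal.ofReal (w y)) =
        ∫ y, w y * f y ∂m := by
      intro m
      rw [integral_withDensity_eq_integral_toReal_smul hwm
        (Eventually.of_forall fun y => ENNReal.ofReal_lt_top)]
      simp only [ENNReal.toReal_ofReal (hw0 _), smul_eq_mul]
    rw [hd, hd]
    exact h _ (hwc.mul f.continuous) η hη fun y hy => by rw [hwz y hy, zero_mul]
  -- The weight is positive and finite on this set, so it can be divided out again.
  have hinv : ∀ m : Measure Y, m.restrict {y | η < s y} =
      ((m.withDensity fun y => ENNReal.ofReal (w y)).restrict {y | η < s y}).withDensity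
        fun y => (ENNReal.ofReal (w y))⁻¹ := by
    intro m
    rw [restrict_withDensity hA]
    refine (withDensity_inv_same hwm ?_ (Eventually.of_forall fun y => ENNReal.ofReal_ne_top)).symm
    filter_upwards [ae_restrict_mem hA] with y hy
    have : 0 < w y := lt_max_of_lt_left (sub_pos.2 hy)
    exact (ENNReal.ofReal_pos.2 this).ne'
  rw [hinv m₁, hinv m₂, heq]

section Punctured

variable {d : ℕ}

theorem isOpen_ne_zero : IsOpen {x : Fin d → EReal | x ≠ 0} := isOpen_ne

theorem measurableEmbedding_val :
    MeasurableEmbedding (Subtype.val : PuncturedSpace d → Fin d → EReal) :=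
  MeasurableEmbedding.subtype_coe isOpen_ne_zero.measurableSet

instance locallyCompactSpace_puncturedSpace : LocallyCompactSpace (PuncturedSpace d) :=
  (isOpen_ne_zero (d := d)).isOpenEmbedding_subtypeVal.locallyCompactSpace

theorem isCompact_le_vsize {δ : ℝ} (hδ : 0 < δ) :
    IsCompact {u : PuncturedSpace d | δ ≤ vsize u.1} := by
  have h1 : IsCompact {x : Fin d → EReal | δ ≤ vsize x} :=
    (isClosed_le continuous_const continuous_vsize).isCompact
  refine (IsInducing.subtypeVal.isCompact_preimage_iff
    fun x hx => ?_).2 h1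
  have hx : δ ≤ vsize x := hx
  exact ⟨(⟨x, vsize_pos.1 (hδ.trans_le hx)⟩ : PuncturedSpace d), rfl⟩

theorem hasCompactSupport_of_vsize {F : (Fin d → EReal) → ℝ} {δ : ℝ} (hδ : 0 < δ)
    (hF0 : ∀ x, vsize x ≤ δ → F x = 0) : HasCompactSupport fun u : PuncturedSpace d => F u.1 :=
  HasCompactSupport.intro (isCompact_le_vsize hδ) fun _ hu => hF0 _ (not_le.1 hu).le

/-- The extension by zero of a function on the punctured space. -/
def extendZero (g : PuncturedSpace d → ℝ) : (Fin d → EReal) → ℝ :=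
  Function.extend Subtype.val g (0 : (Fin d → EReal) → ℝ)

theorem extendZero_val (g : PuncturedSpace d → ℝ) (u : PuncturedSpace d) :
    extendZero g u.1 = g u := Subtype.val_injective.extend_apply g _ u

theorem extendZero_zero (g : PuncturedSpace d → ℝ) : extendZero g 0 = 0 :=
  Function.extend_apply' g _ _ fun ⟨u, hu⟩ => u.2 hu

theorem continuous_extendZero {g : PuncturedSpace d → ℝ} (hg : Continuous g)
    (hs : HasCompactSupport g) : Continuous (extendZero g) :=
  HasCompactSupport.continuous_extend_zero isOpen_ne_zero hg hs

theorem exists_extendZero_eq_zero {g : PuncturedSpace d → ℝ} (hs : HasCompactSupport g) :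
    ∃ δ > 0, ∀ x, vsize x ≤ δ → extendZero g x = 0 := by
  have hv : Continuous fun u : PuncturedSpace d => vsize u.1 :=
    continuous_vsize.comp continuous_subtype_val
  have key : ∃ δ > 0, ∀ u : PuncturedSpace d, vsize u.1 ≤ δ → g u = 0 := by
    rcases (tsupport g).eq_empty_or_nonempty with hne | hne
    · refine ⟨1, one_pos, fun u _ => image_eq_zero_of_notMem_tsupport ?_⟩
      rw [hne]
      exact Set.notMem_empty u
    · obtain ⟨u₀, hu₀, hmin⟩ := hs.isCompact.exists_isMinOn hne hv.continuousOn
      have hpos : 0 < vsize u₀.1 := vsize_pos.2 u₀.2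
      refine ⟨vsize u₀.1 / 2, half_pos hpos, fun u hu => ?_⟩
      refine image_eq_zero_of_notMem_tsupport fun hmem => ?_
      have : vsize u₀.1 ≤ vsize u.1 := hmin hmem
      linarith
  obtain ⟨δ, hδ, h⟩ := key
  refine ⟨δ, hδ, fun x hx => ?_⟩
  by_cases h0 : x = 0
  · rw [h0, extendZero_zero]
  · rw [extendZero_val g ⟨x, h0⟩]
    exact h ⟨x, h0⟩ hx

end Punctured

section LimitMeasure

variable {Ω S : Type*} [MeasurableSpace Ω] [MeasurableSpace S]
  {P : Measure Ω} {Ψ : ℝ → S → ℝ} {ε : ℕ → Ω → S} {X : ℕ → Ω → ℝ}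
  {φ : S → ℝ → ℝ} {α p : ℝ} {t : ℕ}

theorem integral_scaledLaw (hX : IsStationaryChain P Ψ ε X) (x : ℝ)
    {F : (Fin (t + 1) → EReal) → ℝ} (hF : Continuous F) (hF0 : F 0 = 0) :
    ∫ u, F u.1 ∂scaledLaw P X t x =
      (P.real {ω | x < |X 0 ω|})⁻¹ * ∫ ω, F (scaledPath X t x ω) ∂P := by
  have hU : MeasurableSet {x : Fin (t + 1) → EReal | x ≠ 0} := isOpen_ne_zero.measurableSet
  rw [scaledLaw, integral_smul_measure, ENNReal.toReal_inv, smul_eq_mul]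
  congr 1
  refine (integral_subtype_comap hU F).trans ?_
  rw [setIntegral_eq_integral_of_forall_compl_eq_zero fun y hy => by
    rw [not_not.1 hy, hF0]]
  exact integral_map (measurable_scaledPath hX t x).aemeasurable hF.measurable.aestronglyMeasurable

/-- Limit measures are characterized by the limits of the integrals of the continuous functions
that vanish near the origin. -/
theorem isLimitMeasure_iff (hX : IsStationaryChain P Ψ ε X)
    {m : Measure (PuncturedSpace (t + 1))} :
    IsLimitMeasure P X t m ↔ (∀ δ > 0, m.map Subtype.val {x | δ < vsize x} ≠ ⊤) ∧
      ∀ F : (Fin (t + 1) → EReal) → ℝ, Continuous F → ∀ δ > 0, (∀ x, vsize x ≤ δ → F x = 0) →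
        Tendsto (fun x => (P.real {ω | x < |X 0 ω|})⁻¹ * ∫ ω, F (scaledPath X t x ω) ∂P) atTop
          (𝓝 (∫ x, F x ∂m.map Subtype.val)) := by
  have hemb := measurableEmbedding_val (d := t + 1)
  have hint : ∀ F : (Fin (t + 1) → EReal) → ℝ, ∫ x, F x ∂m.map Subtype.val = ∫ u, F u.1 ∂m :=
    fun F => hemb.integral_map F
  have hz : ∀ {F : (Fin (t + 1) → EReal) → ℝ} {δ : ℝ}, 0 < δ → (∀ x, vsize x ≤ δ → F x = 0) →
      F 0 = 0 := fun hδ hF0 => hF0 0 (by rw [vsize_eq_zero.2 rfl]; exact hδ.le)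
  constructor
  · rintro ⟨hfin, hlim⟩
    refine ⟨fun δ hδ => ?_, fun F hF δ hδ hF0 => ?_⟩
    · rw [hemb.map_apply]
      refine ne_top_of_le_ne_top (isCompact_le_vsize hδ).measure_lt_top.ne
        (measure_mono fun u hu => ?_)
      have hu : δ < vsize u.1 := hu
      exact hu.le
    · have := hlim (fun u => F u.1) (hF.comp continuous_subtype_val)
        (hasCompactSupport_of_vsize hδ hF0)
      rw [hint]
      simpa only [integral_scaledLaw hX _ hF (hz hδ hF0)] using this
  · rintro ⟨hfin, hlim⟩
    refine ⟨⟨fun K hK => ?_⟩, fun g hg hs => ?_⟩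
    · rcases K.eq_empty_or_nonempty with hne | hne
      · rw [hne, measure_empty]
        exact ENNReal.zero_lt_top
      · have hv : Continuous fun u : PuncturedSpace (t + 1) => vsize u.1 :=
          continuous_vsize.comp continuous_subtype_val
        obtain ⟨u₀, hu₀, hmin⟩ := hK.exists_isMinOn hne hv.continuousOn
        have hpos : 0 < vsize u₀.1 := vsize_pos.2 u₀.2
        refine lt_of_le_of_lt (measure_mono fun u hu => ?_)
          ((hemb.map_apply m _).symm.trans_lt (hfin _ (half_pos hpos)).lt_top)
        have : vsize u₀.1 ≤ vsize u.1 := hmin hu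
        change vsize u₀.1 / 2 < vsize u.1
        linarith
    · obtain ⟨δ, hδ, h0⟩ := exists_extendZero_eq_zero hs
      have hc := continuous_extendZero hg hs
      have := hlim _ hc δ hδ h0
      rw [hint] at this
      simp only [← integral_scaledLaw hX _ hc (hz hδ h0), extendZero_val] at this
      exact this

theorem map_val_ne_zero (m : Measure (PuncturedSpace t)) :
    (m.map Subtype.val).restrict {x | x ≠ 0} = m.map Subtype.val := by
  have hemb := measurableEmbedding_val (d := t)
  refine Measure.restrict_eq_self_of_ae_mem ((hemb.ae_map_iff).2 (Eventually.of_forall fun u =>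
    u.2))

theorem IsLimitMeasure.unique (hX : IsStationaryChain P Ψ ε X)
    {m m' : Measure (PuncturedSpace (t + 1))} (h : IsLimitMeasure P X t m)
    (h' : IsLimitMeasure P X t m') : m = m' := by
  have hemb := measurableEmbedding_val (d := t + 1)
  obtain ⟨h1, h2⟩ := (isLimitMeasure_iff hX).1 h
  obtain ⟨h1', h2'⟩ := (isLimitMeasure_iff hX).1 h'
  have := restrict_pos_eq_of_integral_eq continuous_vsize h1 h1' fun F hF η hη hF0 =>
    tendsto_nhds_unique (h2 F hF η hη hF0) (h2' F hF η hη hF0)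
  simp only [vsize_pos, map_val_ne_zero] at this
  rw [← hemb.comap_map m, ← hemb.comap_map m', this]

/-- The limits define a positive linear functional on compactly supported continuous functions, and
the Riesz–Markov–Kakutani theorem represents it. Compact support in the punctured space means
vanishing near the origin, so extension by zero is continuous. -/
theorem exists_isLimitMeasure [IsProbabilityMeasure P] (hX : IsStationaryChain P Ψ ε X)
    (hlim : ∀ F : (Fin (t + 1) → EReal) → ℝ, Continuous F → ∀ δ > 0,
      (∀ x, vsize x ≤ δ → F x = 0) → ∃ l, Tendsto (fun x => (P.real {ω | x < |X 0 ω|})⁻¹ *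
        ∫ ω, F (scaledPath X t x ω) ∂P) atTop (𝓝 l)) :
    ∃ m, IsLimitMeasure P X t m := by
  have hc : ∀ g : CompactlySupportedContinuousMap (PuncturedSpace (t + 1)) ℝ,
      Continuous (extendZero g) := fun g => continuous_extendZero g.continuous g.hasCompactSupport
  have hl : ∀ g : CompactlySupportedContinuousMap (PuncturedSpace (t + 1)) ℝ, ∃ l,
      Tendsto (fun x => (P.real {ω | x < |X 0 ω|})⁻¹ *
        ∫ ω, extendZero g (scaledPath X t x ω) ∂P) atTop (𝓝 l) := by
    intro g
    obtain ⟨δ, hδ, h0⟩ := exists_extendZero_eq_zero g.hasCompactSupport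
    exact hlim _ (hc g) δ hδ h0
  choose L hL using hl
  have hext : ∀ (f : (Fin (t + 1) → EReal) → ℝ) (g : PuncturedSpace (t + 1) → ℝ), f 0 = 0 →
      (∀ u : PuncturedSpace (t + 1), g u = f u.1) → extendZero g = f := by
    intro f g h0 h
    funext x
    by_cases hx : x = 0
    · rw [hx, extendZero_zero, h0]
    · rw [extendZero_val g ⟨x, hx⟩, h]
  let Λ₀ : CompactlySupportedContinuousMap (PuncturedSpace (t + 1)) ℝ →ₗ[ℝ] ℝ :=
    { toFun := L
      map_add' := fun g k => by
        have e : extendZero (g + k) = fun x => extendZero g x + extendZero k x :=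
          hext _ _ (by simp only [extendZero_zero, add_zero]) fun u => by
            simp only [extendZero_val]
            rfl
        refine tendsto_nhds_unique (hL (g + k)) (((hL g).add (hL k)).congr fun x => ?_)
        rw [← mul_add, ← integral_add (integrable_comp_scaledPath hX _ x (hc g))
          (integrable_comp_scaledPath hX _ x (hc k)), e]
      map_smul' := fun c g => by
        have e : extendZero (c • g) = fun x => c * extendZero g x :=
          hext _ _ (by simp only [extendZero_zero, mul_zero]) fun u => by
            simp only [extendZero_val]
            rfl
        refine tendsto_nhds_unique (hL (c • g)) (((hL g).const_mul c).congr fun x => ?_)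
        rw [e, integral_const_mul, mul_left_comm] }
  have hpos : ∀ g, 0 ≤ g → 0 ≤ Λ₀ g := by
    intro g hg
    refine ge_of_tendsto' (hL g) fun x => mul_nonneg (inv_nonneg.2 measureReal_nonneg)
      (integral_nonneg fun ω => ?_)
    by_cases h0 : scaledPath X t x ω = 0
    · simp only [h0, extendZero_zero, Pi.zero_apply, le_refl]
    · exact (hg ⟨_, h0⟩).trans_eq (extendZero_val g ⟨_, h0⟩).symm
  refine ⟨RealRMK.rieszMeasure (PositiveLinearMap.mk₀ Λ₀ hpos), inferInstance, fun g hg hs => ?_⟩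
  set G : CompactlySupportedContinuousMap (PuncturedSpace (t + 1)) ℝ := ⟨⟨g, hg⟩, hs⟩ with hG
  have h1 := RealRMK.integral_rieszMeasure (PositiveLinearMap.mk₀ Λ₀ hpos) G
  have h2 : PositiveLinearMap.mk₀ Λ₀ hpos G = L G := rfl
  rw [h2] at h1
  have h3 := hL G
  rw [← h1] at h3
  have h4 : ∀ x, ∫ u, g u ∂scaledLaw P X t x = (P.real {ω | x < |X 0 ω|})⁻¹ *
      ∫ ω, extendZero g (scaledPath X t x ω) ∂P := by
    intro x
    refine Eq.trans ?_ (integral_scaledLaw hX x (hc G) (extendZero_zero g))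
    exact integral_congr_ae (Eventually.of_forall fun u => (extendZero_val g u).symm)
  simp only [h4]
  exact h3

end LimitMeasure

/-! ### Absorption at zero -/

section Absorb

variable {Ω : Type*} [MeasurableSpace Ω] {Q : Measure Ω} {p α : ℝ} {μ : Measure (ℝ × ℝ)}
  {N : ℕ → Ω → ℝ}

/-- The point `0` is absorbing. -/
theorem IsTailMarkov.ae_absorb (h : IsTailMarkov Q p μ N) :
    ∀ᵐ ω ∂Q, ∀ n k, N n ω = 0 → N (n + k) ω = 0 := by
  have h1 : ∀ n, ∀ᵐ ω ∂Q, N n ω = 0 → N (n + 1) ω = 0 := by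
    intro n
    -- This rectangle expresses the event `N n = 0`, from which the transition law is the point mass
    -- at `0`.
    set B : ℕ → Set ℝ := fun i => if i = n then {0} else Set.univ with hB
    have hBm : ∀ i, MeasurableSet (B i) := fun i => by
      simp only [hB]
      split_ifs
      exacts [measurableSet_singleton 0, MeasurableSet.univ]
    have hA : {ω | ∀ i < n + 1, N i ω ∈ B i} = {ω | N n ω = 0} := by
      ext ω
      simp only [hB, Set.mem_ofPred_eq]
      constructor
      · intro h
        simpa using h n (Nat.lt_succ_self n)
      · intro h i _
        split_ifs with hi
        · rw [hi]
          exact h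
        · trivial
    have ht := h.transition n B hBm {0}ᶜ (measurableSet_singleton 0).compl
    rw [hA] at ht
    have hz : ∫⁻ ω in {ω | N n ω = 0}, stepKernel μ (N n ω) {0}ᶜ ∂Q = 0 := by
      refine (setLIntegral_congr_fun (g := fun _ => 0)
        (h.measurable n (measurableSet_singleton 0)) fun ω hω => ?_).trans (by simp)
      have hω : N n ω = 0 := hω
      simp only [hω, stepKernel, if_true]
      simp
    rw [hz] at ht
    rw [ae_iff]
    refine measure_mono_null (fun ω hω => ?_) ht
    have hω : ¬ (N n ω = 0 → N (n + 1) ω = 0) := hω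
    push Not at hω
    exact hω
  filter_upwards [ae_all_iff.2 h1] with ω hω n k hn
  induction k with
  | zero => exact hn
  | succ k ih => exact hω _ ih

/-- The chain does not vanish if the first step does not vanish. -/
theorem IsTailMarkov.ae_ne_zero (h : IsTailMarkov Q p μ N) (hmem : MemClass p α μ)
    (h0 : μ {q | q.2 = 0} = 0) (n : ℕ) : ∀ᵐ ω ∂Q, N n ω ≠ 0 := by
  have hker : ∀ x, x ≠ 0 → stepKernel μ x {0} = 0 := by
    intro x hx
    have hq : Measurable fun q : ℝ × ℝ => x * (q.2 / q.1) :=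
      (measurable_snd.div measurable_fst).const_mul x
    rw [stepKernel, if_neg hx, Measure.map_apply hq (measurableSet_singleton 0)]
    refine cond_absolutelyContinuous ?_
    have h1 : ∀ᵐ q ∂μ, q.2 ≠ 0 := by
      rw [ae_iff]
      simpa only [not_not] using h0
    have h2 : ∀ᵐ q ∂μ, ¬ x * (q.2 / q.1) = 0 := by
      filter_upwards [h1, hmem.support] with q hq2 hq1
      have hq1 : q.1 ≠ 0 := by rcases hq1 with h | h <;> rw [h] <;> norm_num
      exact mul_ne_zero hx (div_ne_zero hq2 hq1)
    rw [ae_iff] at h2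
    simp only [not_not] at h2
    exact h2
  induction n with
  | zero =>
    have h1 := ae_signLaw p
    rw [← h.law_zero] at h1
    filter_upwards [ae_of_ae_map (h.measurable 0).aemeasurable h1] with ω hω
    rcases hω with h | h <;> rw [h] <;> norm_num
  | succ n ih =>
    have ht := h.transition n (fun _ => Set.univ) (fun _ => MeasurableSet.univ) {0}
      (measurableSet_singleton 0)
    simp only [Set.mem_univ, implies_true, Set.ofPred_true, Set.univ_inter,
      Measure.restrict_univ] at ht
    rw [ae_iff]
    simp only [not_not]
    refine ht.trans ?_
    rw [lintegral_congr_ae (g := fun _ => 0), lintegral_zero]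
    filter_upwards [ih] with ω hω
    exact hker _ hω

theorem IsTailMarkov.ae_abs_zero (h : IsTailMarkov Q p μ N) : ∀ᵐ ω ∂Q, |N 0 ω| = 1 := by
  have h1 := ae_signLaw p
  rw [← h.law_zero] at h1
  filter_upwards [ae_of_ae_map (h.measurable 0).aemeasurable h1] with ω hω
  rcases hω with h | h <;> rw [h] <;> norm_num

end Absorb

/-! ### Polar laws on the extended space -/

section Polar

variable {Ω : Type*} [MeasurableSpace Ω] {Q : Measure Ω} {α : ℝ} {d : ℕ} {V : Fin d → Ω → ℝ}

/-- The law of `z V` on `[-∞, ∞]^d` for `z` distributed according to `d(-z^{-α})`. -/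
def epolarLaw (α : ℝ) (Q : Measure Ω) (V : Fin d → Ω → ℝ) : Measure (Fin d → EReal) :=
  (polarLaw α Q V).map coeVec

theorem ae_polarLaw_of_ae [SFinite Q] (hV : ∀ i, Measurable (V i)) {R : (Fin d → ℝ) → Prop}
    (hR : MeasurableSet {y | R y}) (h : ∀ᵐ ω ∂Q, ∀ z > 0, R fun i => z * V i ω) :
    ∀ᵐ y ∂polarLaw α Q V, R y := by
  rw [polarLaw, ae_map_iff (measurable_polarLaw_map hV).aemeasurable hR]
  have h1 : ∀ᵐ q ∂(powMeasure α).prod Q, 0 < q.1 :=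
    Measure.quasiMeasurePreserving_fst.ae (ae_powMeasure_pos α)
  filter_upwards [Measure.quasiMeasurePreserving_snd.ae h, h1] with q hq hq1
  exact hq q.1 hq1

theorem epolarLaw_lt_esize [SFinite Q] (hα : 0 < α) (hV : ∀ i, Measurable (V i)) {δ : ℝ}
    (hδ : 0 < δ) (hδ1 : δ < 1) (i : Fin d) :
    epolarLaw α Q V {x | δ < esize (x i)} =
      ENNReal.ofReal (δ ^ (-α)) * ∫⁻ ω, ENNReal.ofReal (|V i ω| ^ α) ∂Q := by
  have hs : MeasurableSet {x : Fin d → EReal | δ < esize (x i)} :=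
    measurableSet_lt measurable_const
      (continuous_esize.comp (continuous_apply i)).measurable
  rw [epolarLaw, Measure.map_apply continuous_coeVec.measurable hs, ← polarLaw_lt_abs hα hV hδ]
  congr 1
  ext y
  exact lt_esize_coe hδ1

/-- Change of variables and Fubini. An integrable `f` need not be measurable, so its almost
everywhere measurability and its integrability are first transported through the equality of image
measures. -/
theorem hasPolarFormula_of_map_eq [SFinite Q] (hV : ∀ i, Measurable (V i))
    {m : Measure (PuncturedSpace d)} (h : m.map Subtype.val = epolarLaw α Q V)
    {vec : ℝ → Ω → Fin d → EReal} (hvec : ∀ z ω, vec z ω = coeVec fun i => z * V i ω) :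
    HasPolarFormula Q α m vec := by
  intro f hf
  have hemb := measurableEmbedding_val (d := d)
  have hm : Measurable fun q : ℝ × Ω => vec q.1 q.2 := by
    simp only [hvec]
    exact continuous_coeVec.measurable.comp (measurable_polarLaw_map hV)
  have hmap : m.map Subtype.val = ((powMeasure α).prod Q).map fun q => vec q.1 q.2 := by
    rw [h, epolarLaw, polarLaw, Measure.map_map continuous_coeVec.measurable
      (measurable_polarLaw_map hV)]
    simp only [hvec]
    rfl
  have hf1 : Integrable f (m.map Subtype.val) := hemb.integrable_map_iff.2 hf
  rw [hmap] at hf1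
  have hf2 : Integrable (fun q : ℝ × Ω => f (vec q.1 q.2)) ((powMeasure α).prod Q) :=
    (integrable_map_measure hf1.aestronglyMeasurable hm.aemeasurable).1 hf1
  refine ⟨hf2, ?_⟩
  rw [← hemb.integral_map f, hmap, integral_map hm.aemeasurable hf1.aestronglyMeasurable,
    integral_prod _ hf2]

end Polar

/-! ### Limit measures and tail chains -/

section Identify

variable {Ω S : Type*} [MeasurableSpace Ω] [MeasurableSpace S]
  {P : Measure Ω} [IsProbabilityMeasure P] {Ψ : ℝ → S → ℝ} {ε : ℕ → Ω → S} {X : ℕ → Ω → ℝ}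
  {φ : S → ℝ → ℝ} {α p : ℝ} {Ω' : Type*} [MeasurableSpace Ω'] {Q : Measure Ω'}
  [IsProbabilityMeasure Q] {N : ℕ → Ω' → ℝ} {t : ℕ}

/-- The chain built from the innovations is a Markov chain with the same initial law and transitions
as `N`, so an arbitrary tail chain may replace it in the limit. -/
theorem polarLaw_innovChain (hX : IsStationaryChain P Ψ ε X) (hp0 : 0 ≤ p) (hp1 : p ≤ 1)
    (hφ : ∀ σ, Measurable fun v => φ v σ) (hmem : MemClass p α (tailStepLaw p (P.map (ε 0)) φ))
    (hN : IsTailMarkov Q p (tailStepLaw p (P.map (ε 0)) φ) N) (t : ℕ) :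
    polarLaw α ((signLaw p).prod P) (fun i : Fin (t + 1) => innovChain φ ε i) =
      polarLaw α Q fun i : Fin (t + 1) => N i := by
  have hps := isProbabilityMeasure_signLaw hp0 hp1
  have hK : IsProbabilityMeasure (P.map (ε 0)) :=
    Measure.isProbabilityMeasure_map (hX.measurable_innov 0).aemeasurable
  have := hmem.isProbability
  have hd := isInnovDriven_chainPath (κ := fun _ : ℕ => P.map (ε 0)) hp0 hp1 hφ
    (c := id) Function.injective_id fun _ => rfl
  rw [← (hd.isTailMarkov hmem).polarLaw_eq hN α t,
    polarLaw_eq_map fun i => measurable_innovChain hφ hX.measurable_innov i,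
    polarLaw_eq_map fun i : Fin (t + 1) => hd.measurable i]
  have he : Measurable fun ω n => ε n ω := measurable_pi_lambda _ hX.measurable_innov
  have hc : Measurable fun (q : ℝ × (ℕ → S)) (i : Fin (t + 1)) =>
      chainPath (tailStep φ) q.1 (fun k => q.2 (id k)) i := measurable_pi_lambda _ fun i =>
    hd.measurable i
  have h1 : (signLaw p).prod (Measure.infinitePi fun _ : ℕ => P.map (ε 0)) =
      ((signLaw p).prod P).map (Prod.map id fun ω n => ε n ω) := by
    rw [← Measure.map_prod_map _ _ measurable_id he, Measure.map_id,
      ← hX.map_innov Function.injective_id]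
    rfl
  rw [h1, Measure.map_map hc (measurable_id.prodMap he)]
  rfl

theorem measurableSet_ne_zero (i : Fin t) : MeasurableSet {x : Fin t → EReal | x i ≠ 0} :=
  measurable_pi_apply i (measurableSet_singleton 0).compl

theorem epolarLaw_restrict_first {V : Fin (t + 1) → Ω' → ℝ} (hV : ∀ i, Measurable (V i))
    (h0 : ∀ᵐ ω ∂Q, |V 0 ω| = 1) :
    (epolarLaw α Q V).restrict {x | x 0 ≠ 0} = epolarLaw α Q V := by
  refine Measure.restrict_eq_self_of_ae_mem ?_
  refine (ae_map_iff continuous_coeVec.measurable.aemeasurable (measurableSet_ne_zero 0)).2 ?_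
  refine ae_polarLaw_of_ae hV (continuous_coeVec.measurable (measurableSet_ne_zero 0)) ?_
  filter_upwards [h0] with ω hω z hz
  have h1 : V 0 ω ≠ 0 := fun h => by rw [h, abs_zero] at hω; norm_num at hω
  exact EReal.coe_ne_zero.2 (mul_ne_zero hz.ne' h1)

theorem lintegral_abs_rpow_of_abs_eq_one {V : Ω' → ℝ} (h : ∀ᵐ ω ∂Q, |V ω| = 1) :
    ∫⁻ ω, ENNReal.ofReal (|V ω| ^ α) ∂Q = 1 := by
  rw [lintegral_congr_ae (g := fun _ => 1)]
  · simp
  · filter_upwards [h] with ω hω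
    rw [hω, Real.one_rpow, ENNReal.ofReal_one]

/-- The part of the limit measure with nonvanishing first coordinate. -/
theorem IsLimitMeasure.restrict_first (hX : IsStationaryChain P Ψ ε X)
    (hRV : HasRegVarTails P (X 0) α p) (hφ : ∀ σ, Measurable fun v => φ v σ)
    (hconv : ∀ᵐ ω ∂P, ∀ t, ConvergesAlong p Ψ φ t fun n => ε n ω)
    (hmem : MemClass p α (tailStepLaw p (P.map (ε 0)) φ))
    (hN : IsTailMarkov Q p (tailStepLaw p (P.map (ε 0)) φ) N)
    {m : Measure (PuncturedSpace (t + 1))} (hm : IsLimitMeasure P X t m) :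
    (m.map Subtype.val).restrict {x | x 0 ≠ 0} =
      epolarLaw α Q fun i : Fin (t + 1) => N i := by
  obtain ⟨h1, h2⟩ := (isLimitMeasure_iff hX).1 hm
  have hα := hRV.index_pos
  have hV : ∀ i : Fin (t + 1), Measurable (N i) := fun i => hN.measurable i
  have hs : Continuous fun x : Fin (t + 1) → EReal => esize (x 0) :=
    continuous_esize.comp (continuous_apply 0)
  have key := restrict_pos_eq_of_integral_eq hs (m₁ := m.map Subtype.val)
    (m₂ := epolarLaw α Q fun i : Fin (t + 1) => N i) ?_ ?_ ?_
  · simp only [esize_pos] at key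
    rw [key]
    exact epolarLaw_restrict_first hV hN.ae_abs_zero
  · intro η hη
    refine ne_top_of_le_ne_top (h1 η hη) (measure_mono fun x hx => ?_)
    exact lt_of_lt_of_le hx (esize_le_vsize x 0)
  · intro η hη
    -- The mass formula `epolarLaw_lt_esize` requires a level below `1`; lowering the level only
    -- enlarges the set.
    have h3 : 0 < min η (1 / 2) := lt_min hη (by norm_num)
    have h4 : min η (1 / 2) < 1 := (min_le_right _ _).trans_lt (by norm_num)
    refine ne_top_of_le_ne_top (b := epolarLaw α Q (fun i : Fin (t + 1) => N i)
      {x | min η (1 / 2) < esize (x 0)}) ?_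
      (measure_mono fun x hx => ?_)
    on_goal 2 =>
      have hx : η < esize (x 0) := hx
      exact (min_le_left _ _).trans_lt hx
    rw [epolarLaw_lt_esize hα hV h3 h4]
    have := lintegral_abs_rpow_of_abs_eq_one (α := α) hN.ae_abs_zero
    simp only [Fin.val_zero, this, mul_one]
    exact ENNReal.ofReal_ne_top
  · intro F hF η hη hF0
    refine tendsto_nhds_unique (h2 F hF η hη fun x hx =>
      hF0 x ((esize_le_vsize x 0).trans hx)) ?_
    have := tendsto_integral_scaled hX hRV hφ (hconv.mono fun ω h => h t) hF hη hF0
    rw [polarLaw_innovChain hX hRV.balance_nonneg hRV.balance_le_one hφ hmem hN] at this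
    rwa [epolarLaw, integral_map continuous_coeVec.measurable.aemeasurable
      hF.measurable.aestronglyMeasurable]

/-- Stationarity of the limit measures. -/
theorem IsLimitMeasure.map_tail (hX : IsStationaryChain P Ψ ε X)
    {m : Measure (PuncturedSpace (t + 1))} {m' : Measure (PuncturedSpace (t + 1 + 1))}
    (hm : IsLimitMeasure P X t m) (hm' : IsLimitMeasure P X (t + 1) m')
    {A : Set (Fin (t + 1) → EReal)} (hA : MeasurableSet A) (h0 : 0 ∉ A) :
    m'.map Subtype.val (Fin.tail ⁻¹' A) = m.map Subtype.val A := by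
  obtain ⟨h1, h2⟩ := (isLimitMeasure_iff hX).1 hm
  obtain ⟨h1', h2'⟩ := (isLimitMeasure_iff hX).1 hm'
  have htm : Measurable fun x : Fin (t + 1 + 1) → EReal => Fin.tail x :=
    continuous_tail.measurable
  have hvm : ∀ η : ℝ, MeasurableSet {x : Fin (t + 1) → EReal | η < vsize x} := fun η =>
    measurableSet_lt measurable_const continuous_vsize.measurable
  have key := restrict_pos_eq_of_integral_eq (continuous_vsize (d := t + 1))
    (m₁ := (m'.map Subtype.val).map fun x => Fin.tail x) (m₂ := m.map Subtype.val) ?_ h1 ?_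
  · have h3 := congrArg (fun ν => ν A) key
    simp only [Measure.restrict_apply hA] at h3
    have h4 : A ∩ {x | 0 < vsize x} = A := Set.inter_eq_left.2 fun x hx =>
      vsize_pos.2 fun h => h0 (h ▸ hx)
    rw [h4, Measure.map_apply htm hA] at h3
    exact h3
  · intro η hη
    rw [Measure.map_apply htm (hvm η)]
    refine ne_top_of_le_ne_top (h1' η hη) (measure_mono fun x hx => ?_)
    have hx : η < vsize (Fin.tail x) := hx
    exact hx.trans_le (vsize_tail_le x)
  · intro F hF η hη hF0
    rw [integral_map htm.aemeasurable hF.measurable.aestronglyMeasurable]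
    refine tendsto_nhds_unique (h2' (fun x => F (Fin.tail x)) (hF.comp continuous_tail) η hη
      fun x hx => hF0 _ ((vsize_tail_le x).trans hx)) ?_
    simpa only [integral_scaledPath_tail hX t _ hF] using h2 F hF η hη hF0

end Identify

/-! ### Determination of the limit measures -/

/-- A family of measures on `[-∞, ∞]^{t+1}` that is consistent under removal of the first
coordinate and that has the law of the tail chain where the first coordinate does not vanish. -/
structure IsTailFamily {Ω : Type*} [MeasurableSpace Ω] (α : ℝ) (Q : Measure Ω) (N : ℕ → Ω → ℝ)
    (L : ∀ t : ℕ, Measure (Fin (t + 1) → EReal)) : Prop where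
  finite : ∀ t, ∀ δ > 0, L t {x | δ < vsize x} ≠ ⊤
  zero : ∀ t, L t {0} = 0
  first : ∀ t, (L t).restrict {x | x 0 ≠ 0} = epolarLaw α Q fun i : Fin (t + 1) => N i
  tail : ∀ t (A : Set (Fin (t + 1) → EReal)), MeasurableSet A → 0 ∉ A →
    L (t + 1) (Fin.tail ⁻¹' A) = L t A

section Family

variable {Ω : Type*} [MeasurableSpace Ω] {α p : ℝ} {Q : Measure Ω} [IsProbabilityMeasure Q]
  {N : ℕ → Ω → ℝ} {μ μ' : Measure (ℝ × ℝ)} {L : ∀ t : ℕ, Measure (Fin (t + 1) → EReal)}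

/-- The second `+ 1` keeps every level strictly below `1`, as the mass formulas require. -/
theorem exists_inv_lt_esize {u : EReal} (hu : u ≠ 0) : ∃ n : ℕ, 1 / ((n : ℝ) + 1 + 1) < esize u :=
    by
  obtain ⟨n, hn⟩ := exists_nat_one_div_lt (esize_pos.2 hu)
  refine ⟨n, lt_trans ?_ hn⟩
  exact one_div_lt_one_div_of_lt (by positivity) (lt_add_one _)

theorem inv_lt_one (n : ℕ) : 1 / ((n : ℝ) + 1 + 1) < 1 := by
  rw [div_lt_one (by positivity)]
  have : (0 : ℝ) ≤ n := Nat.cast_nonneg n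
  linarith

theorem measurableSet_lt_esize {d : ℕ} (δ : ℝ) (i : Fin d) :
    MeasurableSet {x : Fin d → EReal | δ < esize (x i)} :=
  measurableSet_lt measurable_const (continuous_esize.comp (continuous_apply i)).measurable

theorem IsTailFamily.lt_esize_first (h : IsTailFamily α Q N L) (hα : 0 < α)
    (hN : ∀ n, Measurable (N n)) (h0 : ∀ᵐ ω ∂Q, |N 0 ω| = 1) (t : ℕ) {δ : ℝ} (hδ : 0 < δ)
    (hδ1 : δ < 1) : L t {x | δ < esize (x 0)} = ENNReal.ofReal (δ ^ (-α)) := by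
  have hsub : {x : Fin (t + 1) → EReal | δ < esize (x 0)} ⊆ {x | x 0 ≠ 0} := fun x hx =>
    esize_pos.1 (hδ.trans hx)
  have h1 := Measure.restrict_eq_self (L t) hsub
  rw [h.first, epolarLaw_lt_esize hα (fun i => hN _) hδ hδ1] at h1
  rw [← h1]
  have := lintegral_abs_rpow_of_abs_eq_one (α := α) h0
  simp only [Fin.val_zero, this, mul_one]

theorem eq_zero_of_first {x : Fin 1 → EReal} (h : x 0 = 0) : x = 0 := by
  funext i
  rw [Subsingleton.elim i 0, h]
  rfl

theorem tail_ne_zero {d : ℕ} {x : Fin (d + 1) → EReal} (hx : x ≠ 0) (h0 : x 0 = 0) :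
    Fin.tail x ≠ 0 := by
  intro h
  refine hx (funext fun i => ?_)
  refine Fin.cases h0 (fun j => ?_) i
  exact congrFun h j

/-- A count of mass: `{δ < |x_1|}` has mass `δ^{-α}` by projection, and its part with `x_0 ≠ 0` has
mass `δ^{-α} E|N_1|^α`, which is the same number. So nothing lies on `{x_0 = 0, x_1 ≠ 0}`; points
with `x_0 = x_1 = 0` are excluded by projection and induction. -/
theorem IsTailFamily.first_eq_zero (h : IsTailFamily α Q N L) (hα : 0 < α)
    (hN : ∀ n, Measurable (N n)) (h0 : ∀ᵐ ω ∂Q, |N 0 ω| = 1)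
    (hmom : ∫⁻ ω, ENNReal.ofReal (|N 1 ω| ^ α) ∂Q = 1) (t : ℕ) : L t {x | x 0 = 0} = 0 := by
  induction t with
  | zero => exact measure_mono_null (fun x hx => eq_zero_of_first hx) (h.zero 0)
  | succ t ih =>
    have hA : L (t + 1) (Fin.tail ⁻¹' {y | y ≠ 0 ∧ y 0 = 0}) = 0 := by
      have hm : MeasurableSet {y : Fin (t + 1) → EReal | y ≠ 0 ∧ y 0 = 0} :=
        isOpen_ne_zero.measurableSet.inter (measurable_pi_apply 0 (measurableSet_singleton 0))
      rw [h.tail t _ hm fun h => h.1 rfl]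
      exact measure_mono_null (fun y hy => hy.2) ih
    have hB : ∀ n : ℕ, L (t + 1)
        ({x | 1 / ((n : ℝ) + 1 + 1) < esize (x 1)} \ {x | x 0 ≠ 0}) = 0 := by
      intro n
      set δ : ℝ := 1 / ((n : ℝ) + 1 + 1)
      have hδ : 0 < δ := by positivity
      have hδ1 : δ < 1 := inv_lt_one n
      have e1 : L (t + 1) {x | δ < esize (x 1)} = ENNReal.ofReal (δ ^ (-α)) := by
        rw [← h.lt_esize_first hα hN h0 t hδ hδ1]
        refine h.tail t _ (measurableSet_lt_esize δ 0) fun hz => ?_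
        have hz : δ < esize 0 := hz
        rw [esize_zero] at hz
        exact hz.not_gt hδ
      have e2 : L (t + 1) ({x | δ < esize (x 1)} ∩ {x | x 0 ≠ 0}) = ENNReal.ofReal (δ ^ (-α)) := by
        rw [← Measure.restrict_apply (measurableSet_lt_esize δ 1), h.first,
          epolarLaw_lt_esize hα (fun i => hN _) hδ hδ1]
        have : (((1 : Fin (t + 1 + 1)) : ℕ)) = 1 := rfl
        simp only [this, hmom, mul_one]
      have e3 := measure_inter_add_sdiff (μ := L (t + 1)) {x | δ < esize (x 1)}
        (measurableSet_ne_zero (t := t + 1 + 1) 0)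
      rw [e1, e2] at e3
      exact ENNReal.add_right_inj ENNReal.ofReal_ne_top |>.1 (e3.trans (add_zero _).symm)
    refine measure_mono_null (fun x hx => ?_)
      (measure_union_null (measure_union_null (h.zero (t + 1)) hA) (measure_iUnion_null hB))
    have hx : x 0 = 0 := hx
    by_cases hx0 : x = 0
    · exact Or.inl (Or.inl hx0)
    · by_cases h1 : x 1 = 0
      · exact Or.inl (Or.inr ⟨tail_ne_zero hx0 hx, h1⟩)
      · obtain ⟨n, hn⟩ := exists_inv_lt_esize h1
        exact Or.inr (Set.mem_iUnion.2 ⟨n, hn, fun hn => hn hx⟩)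

theorem IsTailFamily.eq_forward (h : IsTailFamily α Q N L) (hα : 0 < α)
    (hN : ∀ n, Measurable (N n)) (h0 : ∀ᵐ ω ∂Q, |N 0 ω| = 1)
    (hmom : ∫⁻ ω, ENNReal.ofReal (|N 1 ω| ^ α) ∂Q = 1) (t : ℕ) :
    L t = epolarLaw α Q fun i : Fin (t + 1) => N i := by
  rw [← h.first]
  refine (Measure.restrict_eq_self_of_ae_mem ?_).symm
  rw [ae_iff]
  simpa using h.first_eq_zero hα hN h0 hmom t

/-- Where `x_0 ≠ 0` the last coordinate is that of a nonvanishing chain; where `x_0 = 0`, projection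
reduces to a shorter path. -/
theorem IsTailFamily.last_eq_zero (h : IsTailFamily α Q N L) (hN : ∀ n, Measurable (N n))
    (hne : ∀ n, ∀ᵐ ω ∂Q, N n ω ≠ 0) (t : ℕ) : L t {x | x (Fin.last t) = 0} = 0 := by
  induction t with
  | zero => exact measure_mono_null (fun x hx => eq_zero_of_first hx) (h.zero 0)
  | succ t ih =>
    have hm : ∀ s : ℕ, MeasurableSet {x : Fin (s + 1) → EReal | x (Fin.last s) = 0} := fun s =>
      measurable_pi_apply _ (measurableSet_singleton 0)
    have hA : L (t + 1) (Fin.tail ⁻¹' {y | y ≠ 0 ∧ y (Fin.last t) = 0}) = 0 := by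
      have hm' : MeasurableSet {y : Fin (t + 1) → EReal | y ≠ 0 ∧ y (Fin.last t) = 0} :=
        isOpen_ne_zero.measurableSet.inter (hm t)
      rw [h.tail t _ hm' fun h => h.1 rfl]
      exact measure_mono_null (fun y hy => hy.2) ih
    have hB : L (t + 1) ({x | x (Fin.last (t + 1)) = 0} ∩ {x | x 0 ≠ 0}) = 0 := by
      rw [← Measure.restrict_apply (hm (t + 1)), h.first, epolarLaw,
        Measure.map_apply continuous_coeVec.measurable (hm _)]
      have h1 := ae_polarLaw_of_ae (α := α) (Q := Q) (V := fun i : Fin (t + 1 + 1) => N i)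
        (fun i => hN _) (R := fun y => y (Fin.last (t + 1)) ≠ 0)
        (measurable_pi_apply _ (measurableSet_singleton 0).compl) (by
          filter_upwards [hne (t + 1)] with ω hω z hz
          exact mul_ne_zero hz.ne' hω)
      rw [ae_iff] at h1
      refine measure_mono_null (fun y hy => ?_) h1
      have hy : y (Fin.last (t + 1)) = 0 := EReal.coe_eq_zero.1 hy
      exact fun hn => hn hy
    refine measure_mono_null (fun x hx => ?_)
      (measure_union_null (measure_union_null (h.zero (t + 1)) hA) hB)
    by_cases hx0 : x = 0
    · exact Or.inl (Or.inl hx0)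
    · by_cases h1 : x 0 = 0
      · exact Or.inl (Or.inr ⟨tail_ne_zero hx0 h1, hx⟩)
      · exact Or.inr ⟨hx, h1⟩

variable {Ω' : Type*} [MeasurableSpace Ω'] {Q' : Measure Ω'}
  {N' : ℕ → Ω' → ℝ}

/-- The forward law lives on vectors without zeros, where `IsAdjoint.polarLaw_reverse` applies. In
the reversed backward chain `y 0` is the state reached last, so by absorption at `0` it is nonzero
only if no coordinate vanishes. -/
theorem IsAdjoint.epolarLaw_reverse [IsProbabilityMeasure Q'] (hα : 0 < α)
    (hadj : IsAdjoint p α μ μ')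
    (hN : IsTailMarkov Q p μ N) (hN' : IsTailMarkov Q' p μ' N') (hne : ∀ n, ∀ᵐ ω ∂Q, N n ω ≠ 0)
    (t : ℕ) : epolarLaw α Q (fun i : Fin (t + 1) => N i) =
      (epolarLaw α Q' fun i : Fin (t + 1) => N' (t - i)).restrict {x | x 0 ≠ 0} := by
  have hfin : ∀ a : ℝ, 0 < a → polarLaw α Q (fun i : Fin (t + 1) => N i) {y | a < |y 0|} ≠ ⊤ := by
    intro a ha
    rw [polarLaw_lt_abs hα (fun i => hN.measurable _) ha]
    have := lintegral_abs_rpow_of_abs_eq_one (α := α) hN.ae_abs_zero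
    simp only [Fin.val_zero, this, mul_one]
    exact ENNReal.ofReal_ne_top
  have h1 : (polarLaw α Q fun i : Fin (t + 1) => N i).restrict (nonvanishing (t + 1)) =
      polarLaw α Q fun i : Fin (t + 1) => N i := by
    refine Measure.restrict_eq_self_of_ae_mem (ae_polarLaw_of_ae (fun i => hN.measurable _)
      (measurableSet_nonvanishing _) ?_)
    filter_upwards [ae_all_iff.2 hne] with ω hω z hz i
    exact mul_ne_zero hz.ne' (hω i)
  have hs : MeasurableSet {y : Fin (t + 1) → ℝ | y 0 ≠ 0} :=
    measurable_pi_apply 0 (measurableSet_singleton 0).compl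
  have h2 : (nonvanishing (t + 1) : Set (Fin (t + 1) → ℝ))
      =ᵐ[polarLaw α Q' fun i : Fin (t + 1) => N' (t - i)] {y | y 0 ≠ 0} := by
    have h3 := ae_polarLaw_of_ae (α := α) (Q := Q') (V := fun i : Fin (t + 1) => N' (t - i))
      (fun i => hN'.measurable _) (R := fun y => y 0 ≠ 0 → y ∈ nonvanishing (t + 1))
      (hs.imp (measurableSet_nonvanishing _)) (by
        filter_upwards [hN'.ae_absorb] with ω hω z hz h0 i hi
        refine h0 ?_
        have h4 : N' (t - i) ω = 0 := (mul_eq_zero.1 hi).resolve_left hz.ne'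
        have h5 := hω (t - i) i h4
        rw [Nat.sub_add_cancel (Nat.lt_succ_iff.1 i.2)] at h5
        simp [h5])
    filter_upwards [h3] with y hy
    exact propext ⟨fun h => h 0, hy⟩
  rw [epolarLaw, epolarLaw, Measure.restrict_map continuous_coeVec.measurable
    (measurableSet_ne_zero 0), ← h1, hadj.polarLaw_reverse hα hN hN' t hfin,
    Measure.restrict_congr_set h2]
  congr 2
  ext y
  exact (EReal.coe_ne_zero).symm

theorem epolarLaw_tail [SFinite Q'] (hN' : ∀ n, Measurable (N' n)) (t : ℕ)
    {A : Set (Fin (t + 1) → EReal)}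
    (hA : MeasurableSet A) :
    epolarLaw α Q' (fun i : Fin (t + 1 + 1) => N' (t + 1 - i)) (Fin.tail ⁻¹' A) =
      epolarLaw α Q' (fun i : Fin (t + 1) => N' (t - i)) A := by
  have hc : ∀ d : ℕ, Measurable (coeVec (d := d)) := fun d => continuous_coeVec.measurable
  have hA' : MeasurableSet ((Fin.tail : (Fin (t + 1 + 1) → EReal) → _) ⁻¹' A) :=
    continuous_tail.measurable hA
  rw [epolarLaw, epolarLaw, Measure.map_apply (hc _) hA', Measure.map_apply (hc _) hA, polarLaw,
    polarLaw, Measure.map_apply (measurable_polarLaw_map fun i => hN' _) (hc _ hA'),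
    Measure.map_apply (measurable_polarLaw_map fun i => hN' _) (hc _ hA)]
  congr 1
  ext q
  simp only [Set.mem_preimage]
  have : (Fin.tail (coeVec fun i : Fin (t + 1 + 1) => q.1 * N' (t + 1 - i) q.2)) =
      coeVec fun i : Fin (t + 1) => q.1 * N' (t - i) q.2 := by
    funext i
    simp only [Fin.tail, coeVec, Fin.val_succ, Nat.add_sub_add_right]
  rw [this]

/-- Both sides agree on `{x_0 ≠ 0}` by reversal, both satisfy the same projection rule, and both
live on nonzero last coordinates. Induction on `t` carries the equality to `{x_0 = 0}` by
subtraction, after localizing to `δ < |x_t|`, where masses are finite. -/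
theorem IsTailFamily.eq_backward [IsProbabilityMeasure Q'] (h : IsTailFamily α Q N L) (hα : 0 < α)
    (hadj : IsAdjoint p α μ μ') (hN : IsTailMarkov Q p μ N) (hN' : IsTailMarkov Q' p μ' N')
    (hne : ∀ n, ∀ᵐ ω ∂Q, N n ω ≠ 0) (t : ℕ) :
    L t = epolarLaw α Q' fun i : Fin (t + 1) => N' (t - i) := by
  have hfirst : ∀ t, (L t).restrict {x | x 0 ≠ 0} =
      (epolarLaw α Q' fun i : Fin (t + 1) => N' (t - i)).restrict {x | x 0 ≠ 0} := fun t => by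
    rw [h.first, hadj.epolarLaw_reverse hα hN hN' hne t]
  have hLlast : ∀ t, (L t).restrict {x | x (Fin.last t) ≠ 0} = L t := by
    intro t
    refine Measure.restrict_eq_self_of_ae_mem ?_
    rw [ae_iff]
    simpa using h.last_eq_zero hN.measurable hne t
  have hBlast : ∀ t, (epolarLaw α Q' fun i : Fin (t + 1) => N' (t - i)).restrict
      {x | x (Fin.last t) ≠ 0} = epolarLaw α Q' fun i : Fin (t + 1) => N' (t - i) := by
    intro t
    refine Measure.restrict_eq_self_of_ae_mem ?_
    refine (ae_map_iff continuous_coeVec.measurable.aemeasurable (measurableSet_ne_zero _)).2 ?_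
    refine ae_polarLaw_of_ae (fun i => hN'.measurable _)
      (continuous_coeVec.measurable (measurableSet_ne_zero (Fin.last t))) ?_
    filter_upwards [hN'.ae_abs_zero] with ω hω z hz
    have h1 : N' 0 ω ≠ 0 := fun h => by rw [h, abs_zero] at hω; norm_num at hω
    refine EReal.coe_ne_zero.2 (mul_ne_zero hz.ne' ?_)
    simpa using h1
  induction t with
  | zero =>
    rw [← hLlast, ← hBlast]
    exact hfirst 0
  | succ t ih =>
    rw [← hLlast, ← hBlast]
    have hU : {x : Fin (t + 1 + 1) → EReal | x (Fin.last (t + 1)) ≠ 0} =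
        ⋃ n : ℕ, {x | 1 / ((n : ℝ) + 1 + 1) < esize (x (Fin.last (t + 1)))} := by
      ext x
      simp only [Set.mem_iUnion, Set.mem_ofPred_eq]
      exact ⟨exists_inv_lt_esize, fun ⟨n, hn⟩ => esize_pos.1 (lt_trans (by positivity) hn)⟩
    rw [hU]
    refine Measure.restrict_iUnion_congr.2 fun n => ?_
    set δ : ℝ := 1 / ((n : ℝ) + 1 + 1)
    have hδ : 0 < δ := by positivity
    set B := epolarLaw α Q' fun i : Fin (t + 1 + 1) => N' (t + 1 - i)
    set U := {x : Fin (t + 1 + 1) → EReal | x 0 ≠ 0}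
    have hUm : MeasurableSet U := measurableSet_ne_zero 0
    have hinter : ∀ E : Set (Fin (t + 1 + 1) → EReal), MeasurableSet E →
        L (t + 1) (E ∩ U) = B (E ∩ U) := by
      intro E hE
      rw [← Measure.restrict_apply hE, ← Measure.restrict_apply hE, hfirst]
    ext E hE
    have hEA : MeasurableSet (E ∩ {x | δ < esize (x (Fin.last (t + 1)))}) :=
      hE.inter (measurableSet_lt_esize δ _)
    rw [Measure.restrict_apply hE, Measure.restrict_apply hE]
    set E' := E ∩ {x | δ < esize (x (Fin.last (t + 1)))}
    rw [← measure_inter_add_sdiff E' hUm, ← measure_inter_add_sdiff (μ := B) E' hUm,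
      hinter E' hEA]
    congr 1
    -- The slice of `E'` at `x_0 = 0`. Its cylinder has equal mass on both sides by projection and
    -- the induction hypothesis, and coincides with `E'` on `{x_0 = 0}`.
    set F : Set (Fin (t + 1) → EReal) := (fun y => (Fin.cons 0 y : Fin (t + 1 + 1) → EReal)) ⁻¹' E'
    have hF : MeasurableSet F := continuous_cons_zero.measurable hEA
    have hFδ : ∀ y ∈ F, δ < esize (y (Fin.last t)) := fun y hy => hy.2
    have hF0 : 0 ∉ F := fun h => by
      have h1 := hFδ 0 h
      rw [Pi.zero_apply, esize_zero] at h1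
      exact h1.not_gt hδ
    have hTm : MeasurableSet ((Fin.tail : (Fin (t + 1 + 1) → EReal) → _) ⁻¹' F) :=
      continuous_tail.measurable hF
    have hdiff : E' \ U = (Fin.tail ⁻¹' F) \ U := by
      ext x
      simp only [Set.mem_sdiff, U, Set.mem_ofPred_eq, not_not]
      refine and_congr_left fun hx => ?_
      have : (Fin.cons 0 (Fin.tail x) : Fin (t + 1 + 1) → EReal) = x := by
        rw [← hx]
        exact Fin.cons_self_tail x
      simp only [F, Set.mem_preimage, this]
    have hLB : L (t + 1) (Fin.tail ⁻¹' F) = B (Fin.tail ⁻¹' F) := by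
      rw [h.tail t F hF hF0, ih, epolarLaw_tail hN'.measurable t hF]
    have hfin : L (t + 1) (Fin.tail ⁻¹' F) ≠ ⊤ :=
      ne_top_of_le_ne_top (h.finite (t + 1) δ hδ) (measure_mono fun x hx =>
        (hFδ _ hx).trans_le (esize_le_vsize x (Fin.last (t + 1))))
    have e1 := measure_inter_add_sdiff (μ := L (t + 1)) (Fin.tail ⁻¹' F) hUm
    have e2 := measure_inter_add_sdiff (μ := B) (Fin.tail ⁻¹' F) hUm
    rw [← hLB, ← e1, hinter _ hTm] at e2
    rw [hdiff]
    -- Subtract the common, finite mass of the cylinder on `{x_0 ≠ 0}`.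
    refine ((ENNReal.add_right_inj ?_).1 e2).symm
    rw [← hinter _ hTm]
    exact ne_top_of_le_ne_top hfin (measure_mono Set.inter_subset_left)

end Family

end TailChain

end

/-! ### Conclusion -/

theorem corollaryC {Ω S : Type*} [MeasurableSpace Ω] [MeasurableSpace S]
    (P : Measure Ω) [IsProbabilityMeasure P]
    (Ψ : ℝ → S → ℝ) (ε : ℕ → Ω → S) (X : ℕ → Ω → ℝ) (φ : S → ℝ → ℝ) (α p : ℝ)
    (hX : TailChain.IsStationaryChain P Ψ ε X)
    (hRV : TailChain.HasRegVarTails P (X 0) α p)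
    (hφ : TailChain.AsympLinear P Ψ (ε 0) p φ) :
    (∃ (Q : Measure (ℤ → ℝ)),
      TailChain.IsBFTC Q p α (TailChain.tailStepLaw p (P.map (ε 0)) φ) (fun t x => x t)) ∧
    (∀ t : ℕ, ∃! m : Measure (TailChain.PuncturedSpace (t + 1)),
      TailChain.IsLimitMeasure P X t m) ∧
    ∀ (Ω' : Type*) [MeasurableSpace Ω'] (Q : Measure Ω') (M : ℤ → Ω' → ℝ),
      TailChain.IsBFTC Q p α (TailChain.tailStepLaw p (P.map (ε 0)) φ) M →
      (Q {ω | M 1 ω = 0} = 0 ↔ ∫⁻ ω, ENNReal.ofReal (|M (-1) ω| ^ α) ∂Q = 1) ∧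
      (Q {ω | M (-1) ω = 0} = 0 ↔ ∫⁻ ω, ENNReal.ofReal (|M 1 ω| ^ α) ∂Q = 1) ∧
      ∀ (t : ℕ) (m : Measure (TailChain.PuncturedSpace (t + 1))),
        TailChain.IsLimitMeasure P X t m →
        (Q {ω | M 1 ω = 0} = 0 →
          TailChain.HasPolarFormula Q α m (TailChain.backwardVec M t)) ∧
        (Q {ω | M (-1) ω = 0} = 0 →
          TailChain.HasPolarFormula Q α m (TailChain.forwardVec M t)) := by
  have hp0 := hRV.balance_nonneg
  have hp1 := hRV.balance_le_one
  have hα := hRV.index_pos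
  obtain ⟨φ', hφ', hA, hlaw⟩ :=
    hφ.exists_measurable (hX.measurable_innov 0) hX.measurable_update
  obtain ⟨hmem, hconv⟩ := TailChain.ae_convergesAlong hX hRV hφ' hA
  rw [hlaw]
  have hex : ∀ t : ℕ, ∃ m : Measure (TailChain.PuncturedSpace (t + 1)),
      TailChain.IsLimitMeasure P X t m := fun t =>
    TailChain.exists_isLimitMeasure hX fun F hF δ hδ hF0 =>
      TailChain.exists_tendsto_integral hX hRV hφ' hconv t hF hδ hF0
  refine ⟨hmem.exists_isBFTC hα hp0 hp1, fun t => ?_, fun Ω' _ Q M hM => ?_⟩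
  · obtain ⟨m, hm⟩ := hex t
    exact ⟨m, hm, fun m' hm' => hm'.unique hX hm⟩
  have hQ := hM.isProbability
  have hfam : ∀ t (m : Measure (TailChain.PuncturedSpace (t + 1))),
      TailChain.IsLimitMeasure P X t m → ∃ L, TailChain.IsTailFamily α Q (fun n => M n) L ∧
        m.map Subtype.val = L t := by
    intro t m hm
    -- A tail family needs limit measures for all `t` at once; by uniqueness the given `m` is the
    -- member with its index.
    choose l hl using hex
    refine ⟨fun t => (l t).map Subtype.val, ⟨fun t => ?_, fun t => ?_, fun t => ?_,
      fun t A hA h0 => ?_⟩, ?_⟩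
    · exact ((TailChain.isLimitMeasure_iff hX).1 (hl t)).1
    · rw [TailChain.measurableEmbedding_val.map_apply]
      refine measure_mono_null (fun u hu => ?_) measure_empty
      exact u.2 hu
    · exact (hl t).restrict_first hX hRV hφ' hconv hmem hM.isTailMarkov
    · exact (hl t).map_tail hX (hl (t + 1)) hA h0
    · rw [hm.unique hX (hl t)]
  have hbw := hM.moment_backward hα
  have hfw := hM.moment_forward hα
  refine ⟨?_, ?_, fun t m hm => ?_⟩
  · rw [hbw, TailChain.measure_eq_zero_iff_compl_eq_one (hM.measurable 1)]
  · rw [hfw, TailChain.measure_eq_zero_iff_compl_eq_one (hM.measurable (-1))]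
  obtain ⟨L, hL, hmL⟩ := hfam t m hm
  constructor
  · intro h0
    have hμ0 : (TailChain.tailStepLaw p (P.map (ε 0)) φ') {q | q.2 = 0} = 0 := by
      have hs : MeasurableSet {q : ℝ × ℝ | q.2 = 0} := measurable_snd (measurableSet_singleton 0)
      rw [← hM.law_forward, Measure.map_apply ((hM.measurable 0).prodMk (hM.measurable 1)) hs]
      exact h0
    have hne := hM.isTailMarkov.ae_ne_zero hmem hμ0
    have hrev := hM.reverse.isTailMarkov
    -- The subtraction in `ℕ` is exact because `i ≤ t`; the vector is the reversed chain `t ↦ M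
    -- (-t)` read from time `t` down to `0`.
    refine TailChain.hasPolarFormula_of_map_eq (V := fun i : Fin (t + 1) => M (-((t - i : ℕ) : ℤ)))
      (fun i => hM.measurable _) ?_ fun z ω => ?_
    · rw [hmL]
      exact hL.eq_backward hα hM.law_backward hM.isTailMarkov hrev hne t
    · funext i
      have hi : ((i : ℕ) : ℤ) - (t : ℤ) = -((t - i : ℕ) : ℤ) := by omega
      simp only [TailChain.backwardVec, TailChain.coeVec, hi]
  · intro h0
    -- Nonvanishing of `M (-1)` enters only through the equivalent moment condition `E|M_1|^α = 1`.
    rw [TailChain.measure_eq_zero_iff_compl_eq_one (hM.measurable (-1)), ← hfw] at h0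
    refine TailChain.hasPolarFormula_of_map_eq (V := fun i : Fin (t + 1) => M (i : ℕ))
      (fun i => hM.measurable _) ?_ fun z ω => rfl
    rw [hmL]
    exact hL.eq_forward hα (fun n => hM.measurable n) hM.isTailMarkov.ae_abs_zero h0 t
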